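/- Let $n\ge 3$, let $(M^n,\bar g)$ be a compact smooth Riemannian manifold without boundary, and let $\Omega\subset M$ be a domain (a nonempty connected open set) endowed with a conformal metric $g=e^{2u}\bar g$, where $u\in C^\infty(\Omega)$; $g$ is not assumed to be complete. For a metric $g$ let $Ric^-_g(x)=\max\{0,-\min_{g(\xi,\xi)=1}Ric_g(\xi,\xi)\}$ be the negative part of the smallest Ricci curvature at $x$. For a compact set $K$ contained in an open set $D$ of a Riemannian manifold and $1<p<\infty$, let $$cap_p(K,D)=\inf\Big\{\int_D|\nabla v|^p\,dvol:\ v\in C_0^\infty(D),\ v\ge 1\text{ on }K\Big\},$$ and call a Riemannian manifold $(N,g)$ $p$-parabolic if $cap_p(K,N)=0$ for every compact $K\subset N$. Assume that $u(x)\to+\infty$ as $x\in\Omega$ tends to any point of $\partial\Omega$, and that $$\text{either } Ric^-_g\in L^{n/2}(\Omega,g),\quad\text{or } Ric^-_g\,|\nabla u|^{n-2}e^{2u}\in L^1(\Omega,\bar g),$$ where $|\nabla u|$ is taken with respect to $\bar g$. Then, with respect to $\bar g$, $cap_n(\partial\Omega,D)=0$ for every open neighborhood $D$ of $\partial\Omega$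 in $M$; moreover $(\Omega,g)$ is $n$-parabolic, and $\partial\Omega$ has Hausdorff dimension $0$ in $(M,\bar g)$. -/

import Mathlib

open Set Filter Topology MeasureTheory Bundle
open scoped Manifold ContDiff ENNReal

noncomputable section

namespace ConformalHuber

variable {n : ℕ} {M : Type*} [TopologicalSpace M] [ChartedSpace (EuclideanSpace ℝ (Fin n)) M]

/-- A field of (real-valued) functions of two tangent vectors on the `n`-manifold `M`.  A Riemannian
metric on an open set `U ⊆ M` is such a field that is a smooth inner product at the points of `U`;
all the operators below, on an open set `U`, depend only on the values of the field on `U`. -/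
abbrev MetricField (n : ℕ) (M : Type*) [TopologicalSpace M]
    [ChartedSpace (EuclideanSpace ℝ (Fin n)) M] :=
  (x : M) → TangentSpace (𝓡 n) x → TangentSpace (𝓡 n) x → ℝ

/-- The metric of a Riemannian bundle structure on the tangent bundle. -/
def baseMetric (n : ℕ) (M : Type*) [TopologicalSpace M]
    [ChartedSpace (EuclideanSpace ℝ (Fin n)) M]
    [RiemannianBundle (fun x : M => TangentSpace (𝓡 n) x)] : MetricField n M :=
  fun _ v w => inner ℝ v w

/-- The conformal metric `e^{2u} g`. -/
def conformal (u : M → ℝ) (g : MetricField n M) : MetricField n M :=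
  fun x v w => Real.exp (2 * u x) * g x v w

/-- The `i`-th partial derivative of a function on `ℝⁿ`. -/
def partialD (i : Fin n) (f : EuclideanSpace ℝ (Fin n) → ℝ) (y : EuclideanSpace ℝ (Fin n)) : ℝ :=
  fderiv ℝ f y (EuclideanSpace.single i 1)

/-- The `i`-th coordinate vector `∂ᵢ` of the preferred chart at `x`, at the point with
coordinates `y`. -/
def coordVec (x : M) (y : EuclideanSpace ℝ (Fin n)) (i : Fin n) :
    TangentSpace (𝓡 n) ((extChartAt (𝓡 n) x).symm y) :=
  mfderiv (𝓡 n) (𝓡 n) (extChartAt (𝓡 n) x).symm y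
    (EuclideanSpace.single i (1 : ℝ) : EuclideanSpace ℝ (Fin n))

/-- The matrix `g_{ij} = g(∂ᵢ, ∂ⱼ)` of the metric in the preferred chart at `x`, at the point with
coordinates `y`. -/
def metricMatrix (g : MetricField n M) (x : M) (y : EuclideanSpace ℝ (Fin n)) :
    Matrix (Fin n) (Fin n) ℝ :=
  Matrix.of fun i j => g ((extChartAt (𝓡 n) x).symm y) (coordVec x y i) (coordVec x y j)

/-- The Christoffel symbols
`Γ^k_{ij} = ½ ∑ₗ g^{kl} (∂ᵢ g_{jl} + ∂ⱼ g_{il} - ∂ₗ g_{ij})` in the preferred chart at `x`. -/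
def christoffel (g : MetricField n M) (x : M) (k i j : Fin n) (y : EuclideanSpace ℝ (Fin n)) : ℝ :=
  (1 / 2 : ℝ) * ∑ l, (metricMatrix g x y)⁻¹ k l *
    (partialD i (fun z => metricMatrix g x z j l) y + partialD j (fun z => metricMatrix g x z i l) y
      - partialD l (fun z => metricMatrix g x z i j) y)

/-- The components of the Ricci tensor at `x`, in the preferred chart at `x`:
`Ric_{ij} = ∂ₖ Γ^k_{ij} - ∂ⱼ Γ^k_{ik} + Γ^k_{kl} Γ^l_{ij} - Γ^k_{jl} Γ^l_{ik}`
(summed over `k`, `l`). -/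
def ricci (g : MetricField n M) (x : M) (i j : Fin n) : ℝ :=
  let y := extChartAt (𝓡 n) x x
  ∑ k, (partialD k (christoffel g x k i j) y - partialD j (christoffel g x k i k) y)
    + ∑ k, ∑ l, (christoffel g x k k l y * christoffel g x l i j y
      - christoffel g x k j l y * christoffel g x l i k y)

/-- The smallest Ricci curvature at `x`: the minimum of `Ric(ξ, ξ)` over the vectors `ξ` at `x`
with `g(ξ, ξ) = 1`. -/
def lowestRicci (g : MetricField n M) (x : M) : ℝ :=
  sInf {r : ℝ | ∃ ξ : Fin n → ℝ,
    ∑ i, ∑ j, metricMatrix g x (extChartAt (𝓡 n) x x) i j * ξ i * ξ j = 1 ∧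
      r = ∑ i, ∑ j, ricci g x i j * ξ i * ξ j}

/-- `Ric⁻`, the negative part of the smallest Ricci curvature. -/
def ricciNeg (g : MetricField n M) (x : M) : ℝ :=
  max 0 (-lowestRicci g x)

/-- The length of the gradient, `|∇v|_g = (∑ g^{ij} ∂ᵢv ∂ⱼv)^{1/2}`. -/
def gradNorm (g : MetricField n M) (v : M → ℝ) (x : M) : ℝ :=
  let y := extChartAt (𝓡 n) x x
  Real.sqrt (∑ i, ∑ j, (metricMatrix g x y)⁻¹ i j *
    partialD i (v ∘ (extChartAt (𝓡 n) x).symm) y * partialD j (v ∘ (extChartAt (𝓡 n) x).symm) y)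

/-- The Riemannian volume measure of a metric `g` on the open set `U`, extended by zero to `M`.
In the preferred chart at `x` it is the measure with density `√(det g_{ij})` with respect to Lebesgue
measure; these measures on the chart domains agree on overlaps, so their supremum is the measure
that restricts to each one of them. -/
def riemVolume [MeasurableSpace M] (g : MetricField n M) (U : Set M) : Measure M :=
  ⨆ x : M, Measure.map (extChartAt (𝓡 n) x).symm
    ((volume.restrict ((extChartAt (𝓡 n) x).target ∩ (extChartAt (𝓡 n) x).symm ⁻¹' U)).withDensity
      fun y => ENNReal.ofReal (Real.sqrt (metricMatrix g x y).det))

/-- The `p`-capacity of `K` in the open set `D` for the metric `g`: the infimum of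
`∫_D |∇v|^p dvol` over the smooth functions `v` with compact support in `D` and `v ≥ 1` on `K`. -/
def capacity [MeasurableSpace M] (p : ℝ) (g : MetricField n M) (K D : Set M) : ℝ≥0∞ :=
  ⨅ v ∈ {v : M → ℝ | ContMDiff (𝓡 n) 𝓘(ℝ, ℝ) ∞ v ∧ HasCompactSupport v ∧ tsupport v ⊆ D ∧
      ∀ x ∈ K, 1 ≤ v x},
    ∫⁻ x, ENNReal.ofReal (gradNorm g v x ^ p) ∂(riemVolume g D)

/-- `(U, g)` is `p`-parabolic: every compact subset of `U` has `p`-capacity zero in `U`. -/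
def IsParabolic [MeasurableSpace M] (p : ℝ) (g : MetricField n M) (U : Set M) : Prop :=
  ∀ K : Set M, IsCompact K → K ⊆ U → capacity p g K U = 0

end ConformalHuber

end

set_option linter.unusedSectionVars false

noncomputable section
namespace ConformalHuber

/-! ### Christoffel symbols and curvature under changes of coordinates. -/

section TensorCalculus

set_option synthInstance.maxHeartbeats 400000

variable {E : Type*} [NormedAddCommGroup E] [NormedSpace ℝ E]

/-! Contract the law of conformal change of the Ricci tensor twice with ∇u, the gradient for the
background metric. The second-order terms then combine into an exact divergence: −div(|∇u|^(n−2) ∇u)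
= |∇u|^(n−4) (Ric_g − Ric)(∇u, ∇u), where Ric is the background Ricci tensor
(`ricciForm_conformal_grad`, and in weak form `integral_conformal_ricci`). Since Ric_g(∇u, ∇u) ≥
−Ric⁻_g e^(2u) |∇u|² and Ric is bounded on the compact manifold, the n-Laplacian of u is at most
Ric⁻_g e^(2u) |∇u|^(n−2) + C |∇u|^(n−2) in the weak sense (`exists_integral_pairing_le`).

Because u → ∞ at the boundary, u has a minimum b, its sublevel sets are compact subsets of Ω, and (T
− u)₊³ is an admissible test function. Its gradient produces 3 ∫ (T − u)₊² |∇u|^n. By Young's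
inequality each of the two terms on the other side costs at most one copy of this integral plus a
multiple of L^(2 + n/2), with T = b + L. One copy survives, and on a smaller sublevel set it gives
(`exists_energy_bound`) ∫_{u ≤ b + L} |∇u|^n ≤ K L^(n/2). A function of u that climbs from 0 at
level s to 1 at level s + L therefore has n-energy O(L^(−n) L^(n/2)), which tends to zero
(`exists_cutoff`).

These cutoffs v, zero where u ≤ s and one near M \ Ω, yield all three conclusions. The n-energy is
conformally invariant, so 1 − v shows that Ω is n-parabolic for g. For the dimension, read v in a
chart: it is 1 at a point outside Ω and 0 on a fixed ball inside Ω, so some ball of radius r about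
that point carries energy at least δ r^s (`exists_lt_setLIntegral_ball`); as the total energy is
arbitrarily small, a Vitali covering shows that the complement of Ω has s-dimensional measure zero
near the boundary, for every s > 0. In particular this complement has no interior there, so the
closure of Ω is open and closed, and v cut off to this closure is admissible for the capacity of ∂Ω
in D.

The curvature, gradient and volume of the statement are defined through the preferred charts. Much
of the work is to show that these quantities do not depend on the chart, so that the divergence
identity, proved in ℝⁿ, can be summed over a partition of unity. -/

instance bilinNormedAddCommGroup {F : Type*} [NormedAddCommGroup F] [NormedSpace ℝ F] :
    NormedAddCommGroup (E →L[ℝ] E →L[ℝ] F) := inferInstance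

instance bilinNormedSpace {F : Type*} [NormedAddCommGroup F] [NormedSpace ℝ F] :
    NormedSpace ℝ (E →L[ℝ] E →L[ℝ] F) := inferInstance

/-- The bilinear map `Γ` satisfies the Koszul formula for the metric `g` at `y`. -/
def IsChristoffelAt (g : E → E →L[ℝ] E →L[ℝ] ℝ) (Γ : E →L[ℝ] E →L[ℝ] E) (y : E) : Prop :=
  ∀ a b c, 2 * g y (Γ a b) c = fderiv ℝ g y a b c + fderiv ℝ g y b a c - fderiv ℝ g y c a b

/-- The curvature `d ↦ R(d, a) b` of a field of Christoffel symbols. -/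
def curvature (Γ : E → E →L[ℝ] E →L[ℝ] E) (y a b : E) : E →ₗ[ℝ] E where
  toFun d := fderiv ℝ Γ y d a b - fderiv ℝ Γ y a d b + Γ y d (Γ y a b) - Γ y a (Γ y d b)
  map_add' d d' := by simp only [map_add, _root_.add_apply]; abel
  map_smul' c d := by
    simp only [map_smul, _root_.smul_apply, RingHom.id_apply, smul_sub, smul_add]

theorem curvature_apply (Γ : E → E →L[ℝ] E →L[ℝ] E) (y a b d : E) :
    curvature Γ y a b d =
      fderiv ℝ Γ y d a b - fderiv ℝ Γ y a d b + Γ y d (Γ y a b) - Γ y a (Γ y d b) := rfl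

/-- The Ricci form of a field of Christoffel symbols. -/
def ricciForm (Γ : E → E →L[ℝ] E →L[ℝ] E) (y a b : E) : ℝ :=
  LinearMap.trace ℝ E (curvature Γ y a b)

theorem fderiv_pullback_metric {φ : E → E} {g g' : E → E →L[ℝ] E →L[ℝ] ℝ} {y : E}
    (hφ : ContDiffAt ℝ 2 φ y) (hg : DifferentiableAt ℝ g (φ y))
    (hg' : ∀ᶠ z in 𝓝 y, ∀ b c, g' z b c = g (φ z) (fderiv ℝ φ z b) (fderiv ℝ φ z c))
    (hg'd : DifferentiableAt ℝ g' y) (a b c : E) :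
    fderiv ℝ g' y a b c = fderiv ℝ g (φ y) (fderiv ℝ φ y a) (fderiv ℝ φ y b) (fderiv ℝ φ y c)
      + g (φ y) (fderiv ℝ (fderiv ℝ φ) y a b) (fderiv ℝ φ y c)
      + g (φ y) (fderiv ℝ φ y b) (fderiv ℝ (fderiv ℝ φ) y a c) := by
  have hφd : HasFDerivAt φ (fderiv ℝ φ y) y := (hφ.differentiableAt (by norm_num)).hasFDerivAt
  have hφ2 : HasFDerivAt (fderiv ℝ φ) (fderiv ℝ (fderiv ℝ φ) y) y :=
    ((hφ.fderiv_right (m := 1) (by norm_num)).differentiableAt (by norm_num)).hasFDerivAt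
  have h1 : HasFDerivAt (fun z => g (φ z)) _ y := HasFDerivAt.comp (g := g) y hg.hasFDerivAt hφd
  have h2 := (h1.clm_apply (hφ2.clm_apply (hasFDerivAt_const b y))).clm_apply
    (hφ2.clm_apply (hasFDerivAt_const c y))
  have h3 := (hg'd.hasFDerivAt.clm_apply (hasFDerivAt_const b y)).clm_apply (hasFDerivAt_const c y)
  have h4 := h3.congr_of_eventuallyEq (f₁ := fun z => g (φ z) (fderiv ℝ φ z b) (fderiv ℝ φ z c))
    (by filter_upwards [hg'] with z hz using (hz b c).symm)
  have h5 := congrArg (fun L => L a) (h4.unique h2)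
  simp at h5
  rw [h5]; ring

/-- In the Koszul combination for φ*g, the symmetry of D²φ cancels every second-derivative term
except 2 g(D²φ(a, b), dφ c). This is the inhomogeneous term of the transformation law, and
nondegeneracy of g removes c. -/
theorem IsChristoffelAt.pullback {φ : E → E} {g g' : E → E →L[ℝ] E →L[ℝ] ℝ} {y : E}
    {Γ Γ' : E →L[ℝ] E →L[ℝ] E}
    (hφ : ContDiffAt ℝ 2 φ y) (hg : DifferentiableAt ℝ g (φ y))
    (hg' : ∀ᶠ z in 𝓝 y, ∀ b c, g' z b c = g (φ z) (fderiv ℝ φ z b) (fderiv ℝ φ z c))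
    (hg'd : DifferentiableAt ℝ g' y) (hsymm : ∀ a b, g (φ y) a b = g (φ y) b a)
    (hnd : ∀ a, (∀ b, g (φ y) a b = 0) → a = 0)
    (hsurj : Function.Surjective (fderiv ℝ φ y))
    (hΓ : IsChristoffelAt g Γ (φ y)) (hΓ' : IsChristoffelAt g' Γ' y) (a b : E) :
    fderiv ℝ φ y (Γ' a b) = Γ (fderiv ℝ φ y a) (fderiv ℝ φ y b) + fderiv ℝ (fderiv ℝ φ) y a b := by
  have hs : ∀ a b, fderiv ℝ (fderiv ℝ φ) y a b = fderiv ℝ (fderiv ℝ φ) y b a := fun a b =>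
    (hφ.isSymmSndFDerivAt (by simp)) a b
  rw [← sub_eq_zero]
  apply hnd
  intro c'
  obtain ⟨c, rfl⟩ := hsurj c'
  have h1 := hΓ' a b c
  rw [hg'.self_of_nhds, fderiv_pullback_metric hφ hg hg' hg'd, fderiv_pullback_metric hφ hg hg' hg'd,
    fderiv_pullback_metric hφ hg hg' hg'd] at h1
  have h2 := hΓ (fderiv ℝ φ y a) (fderiv ℝ φ y b) (fderiv ℝ φ y c)
  simp only [map_sub, map_add, _root_.sub_apply, _root_.add_apply]
  rw [hs b a, hs c a, hs c b, hsymm (fderiv ℝ (fderiv ℝ φ) y a c)] at h1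
  linarith

/-- The curvature is a tensor: it is compatible with changes of coordinates. -/
theorem curvature_pullback {φ : E → E} {y : E} {Γ Γ' : E → E →L[ℝ] E →L[ℝ] E}
    (hφ : ContDiffAt ℝ 3 φ y)
    (hΓ : DifferentiableAt ℝ Γ (φ y)) (hΓ' : DifferentiableAt ℝ Γ' y)
    (h : ∀ᶠ z in 𝓝 y, ∀ a b, fderiv ℝ φ z (Γ' z a b) =
      Γ (φ z) (fderiv ℝ φ z a) (fderiv ℝ φ z b) + fderiv ℝ (fderiv ℝ φ) z a b) (a b d : E) :
    fderiv ℝ φ y (curvature Γ' y a b d) =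
      curvature Γ (φ y) (fderiv ℝ φ y a) (fderiv ℝ φ y b) (fderiv ℝ φ y d) := by
  have hφ' : ContDiffAt ℝ 2 (fderiv ℝ φ) y := hφ.fderiv_right (m := 2) (by norm_num)
  have hφd : HasFDerivAt φ (fderiv ℝ φ y) y := (hφ.differentiableAt (by norm_num)).hasFDerivAt
  have hφ2 : HasFDerivAt (fderiv ℝ φ) (fderiv ℝ (fderiv ℝ φ) y) y :=
    (hφ'.differentiableAt (by norm_num)).hasFDerivAt
  have hφ3 : HasFDerivAt (fderiv ℝ (fderiv ℝ φ)) (fderiv ℝ (fderiv ℝ (fderiv ℝ φ)) y) y :=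
    ((hφ'.fderiv_right (m := 1) (by norm_num)).differentiableAt (by norm_num)).hasFDerivAt
  -- The transformation law differentiated in the direction d. Antisymmetrizing in d and a kills
  -- D³φ, and the D²φ terms cancel against the law itself applied to Γ'(a, b) and Γ'(d, b).
  have key : ∀ d a b, fderiv ℝ (fderiv ℝ φ) y d (Γ' y a b) + fderiv ℝ φ y (fderiv ℝ Γ' y d a b) =
      fderiv ℝ Γ (φ y) (fderiv ℝ φ y d) (fderiv ℝ φ y a) (fderiv ℝ φ y b)
      + Γ (φ y) (fderiv ℝ (fderiv ℝ φ) y d a) (fderiv ℝ φ y b)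
      + Γ (φ y) (fderiv ℝ φ y a) (fderiv ℝ (fderiv ℝ φ) y d b)
      + fderiv ℝ (fderiv ℝ (fderiv ℝ φ)) y d a b := by
    intro d a b
    have hΓφ : HasFDerivAt (fun z => Γ (φ z)) _ y := HasFDerivAt.comp (g := Γ) y hΓ.hasFDerivAt hφd
    have h1 := hφ2.clm_apply ((hΓ'.hasFDerivAt.clm_apply (hasFDerivAt_const a y)).clm_apply
      (hasFDerivAt_const b y))
    have h2 := ((hΓφ.clm_apply
      (hφ2.clm_apply (hasFDerivAt_const a y))).clm_apply
      (hφ2.clm_apply (hasFDerivAt_const b y))).add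
      ((hφ3.clm_apply (hasFDerivAt_const a y)).clm_apply (hasFDerivAt_const b y))
    have h3 := h2.congr_of_eventuallyEq (f₁ := fun z => fderiv ℝ φ z (Γ' z a b))
      (by filter_upwards [h] with z hz using hz a b)
    have h5 := congrArg (fun L => L d) (h1.unique h3)
    simp at h5
    rw [add_comm, h5]; abel
  have hs2 : ∀ a b, fderiv ℝ (fderiv ℝ φ) y a b = fderiv ℝ (fderiv ℝ φ) y b a := fun a b =>
    (hφ.of_le (m := 2) (by norm_num)).isSymmSndFDerivAt (by simp) a b
  have hs3 : ∀ a b, fderiv ℝ (fderiv ℝ (fderiv ℝ φ)) y a b =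
      fderiv ℝ (fderiv ℝ (fderiv ℝ φ)) y b a := fun a b => hφ'.isSymmSndFDerivAt (by simp) a b
  have h0 := h.self_of_nhds
  have k1 := key d a b
  have k2 := key a d b
  have e1 := h0 d (Γ' y a b)
  have e2 := h0 a (Γ' y d b)
  rw [h0 a b] at e1
  rw [h0 d b] at e2
  rw [hs3 a d, hs2 a d] at k2
  simp only [curvature_apply, map_add, map_sub] at *
  rw [e1, e2]
  rw [← eq_sub_iff_add_eq'] at k1 k2
  rw [k1, k2]
  abel

/-- The two curvature endomorphisms are conjugate under dφ, and the trace is invariant under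
conjugation. -/
theorem ricciForm_pullback [FiniteDimensional ℝ E] {φ : E → E} {y : E}
    {Γ Γ' : E → E →L[ℝ] E →L[ℝ] E}
    (hφ : ContDiffAt ℝ 3 φ y)
    (hΓ : DifferentiableAt ℝ Γ (φ y)) (hΓ' : DifferentiableAt ℝ Γ' y)
    (h : ∀ᶠ z in 𝓝 y, ∀ a b, fderiv ℝ φ z (Γ' z a b) =
      Γ (φ z) (fderiv ℝ φ z a) (fderiv ℝ φ z b) + fderiv ℝ (fderiv ℝ φ) z a b)
    (hb : Function.Bijective (fderiv ℝ φ y)) (a b : E) :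
    ricciForm Γ' y a b = ricciForm Γ (φ y) (fderiv ℝ φ y a) (fderiv ℝ φ y b) := by
  let e : E ≃ₗ[ℝ] E := LinearEquiv.ofBijective (fderiv ℝ φ y : E →ₗ[ℝ] E) hb
  rw [ricciForm, ricciForm, ← LinearMap.trace_conj' _ e]
  congr 1
  ext d
  obtain ⟨d, rfl⟩ := e.surjective d
  simp only [LinearEquiv.conj_apply, LinearMap.comp_apply, LinearEquiv.coe_coe,
    LinearEquiv.symm_apply_apply]
  exact curvature_pullback hφ hΓ hΓ' h a b d

end TensorCalculus

end ConformalHuber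
end

noncomputable section
namespace ConformalHuber

/-! ### Conformal change of the Christoffel symbols and of the Ricci form. -/

section ConformalChange

set_option synthInstance.maxHeartbeats 400000

variable {E : Type*} [NormedAddCommGroup E] [NormedSpace ℝ E]

/-- The Koszul expression is symmetric in its first two arguments because every derivative of g is
again a symmetric form. -/
theorem IsChristoffelAt.symm {g : E → E →L[ℝ] E →L[ℝ] ℝ} {Γ : E →L[ℝ] E →L[ℝ] E} {y : E}
    (hΓ : IsChristoffelAt g Γ y) (hg : DifferentiableAt ℝ g y)
    (hsymm : ∀ᶠ z in 𝓝 y, ∀ a b, g z a b = g z b a)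
    (hnd : ∀ a, (∀ b, g y a b = 0) → a = 0) (a b : E) : Γ a b = Γ b a := by
  rw [← sub_eq_zero]
  apply hnd
  intro c
  have hd : ∀ a b c, fderiv ℝ g y c a b = fderiv ℝ g y c b a := by
    intro a b c
    have h1 := (hg.hasFDerivAt.clm_apply (hasFDerivAt_const a y)).clm_apply (hasFDerivAt_const b y)
    have h2 := (hg.hasFDerivAt.clm_apply (hasFDerivAt_const b y)).clm_apply (hasFDerivAt_const a y)
    have h3 := h1.congr_of_eventuallyEq (f₁ := fun z => g z b a)
      (by filter_upwards [hsymm] with z hz using hz b a)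
    have h5 := congrArg (fun L => L c) (h3.unique h2)
    simpa using h5
  have h1 := hΓ a b c
  have h2 := hΓ b a c
  rw [hd b a c] at h2
  simp only [ContinuousLinearMap.map_sub, _root_.sub_apply]
  linarith

theorem fderiv_conformal {g g' : E → E →L[ℝ] E →L[ℝ] ℝ} {u : E → ℝ} {y : E}
    (hg : DifferentiableAt ℝ g y) (hu : DifferentiableAt ℝ u y)
    (hg' : ∀ᶠ z in 𝓝 y, g' z = Real.exp (2 * u z) • g z) (a b c : E) :
    fderiv ℝ g' y a b c =
      Real.exp (2 * u y) * (2 * fderiv ℝ u y a * g y b c + fderiv ℝ g y a b c) := by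
  have h1 := ((hu.hasFDerivAt.const_mul 2).exp.smul hg.hasFDerivAt)
  rw [(h1.congr_of_eventuallyEq hg').fderiv]
  simp
  ring

/-- Here U is the gradient of u for g. The derivatives of e^(2u) in the Koszul formula give du(a)
g(b, c) + du(b) g(a, c) − du(c) g(a, b), after division by e^(2u). -/
theorem IsChristoffelAt.conformal {g g' : E → E →L[ℝ] E →L[ℝ] ℝ} {u : E → ℝ} {y U : E}
    {Γ Γ' : E →L[ℝ] E →L[ℝ] E}
    (hg : DifferentiableAt ℝ g y) (hu : DifferentiableAt ℝ u y)
    (hg' : ∀ᶠ z in 𝓝 y, g' z = Real.exp (2 * u z) • g z)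
    (hnd : ∀ a, (∀ b, g y a b = 0) → a = 0)
    (hU : ∀ c, g y U c = fderiv ℝ u y c)
    (hΓ : IsChristoffelAt g Γ y) (hΓ' : IsChristoffelAt g' Γ' y) (a b : E) :
    Γ' a b = Γ a b + fderiv ℝ u y a • b + fderiv ℝ u y b • a - g y a b • U := by
  rw [← sub_eq_zero]
  apply hnd
  intro c
  have h1 := hΓ' a b c
  have h2 := hΓ a b c
  rw [hg'.self_of_nhds, fderiv_conformal hg hu hg', fderiv_conformal hg hu hg',
    fderiv_conformal hg hu hg'] at h1
  simp only [ContinuousLinearMap.map_sub, ContinuousLinearMap.map_add, _root_.sub_apply,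
    _root_.add_apply, ContinuousLinearMap.map_smul, _root_.smul_apply, smul_eq_mul, hU] at h1 ⊢
  have he := Real.exp_pos (2 * u y)
  have h3 : Real.exp (2 * u y) * (g y (Γ' a b) c - (g y (Γ a b) c + fderiv ℝ u y a * g y b c +
      fderiv ℝ u y b * g y a c - g y a b * fderiv ℝ u y c)) = 0 := by
    linear_combination (1 / 2) * h1 - Real.exp (2 * u y) / 2 * h2
  exact (mul_eq_zero.mp h3).resolve_left he.ne'

/-- The contracted law of conformal change of the Ricci curvature. -/
theorem ricciForm_conformal_grad [FiniteDimensional ℝ E] {g g' : E → E →L[ℝ] E →L[ℝ] ℝ}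
    {u : E → ℝ} {y : E} {U : E → E} {Γ Γ' : E → E →L[ℝ] E →L[ℝ] E}
    (hg : ∀ᶠ z in 𝓝 y, DifferentiableAt ℝ g z) (hu : ContDiffAt ℝ 2 u y)
    (hg' : ∀ᶠ z in 𝓝 y, g' z = Real.exp (2 * u z) • g z)
    (hsymm : ∀ᶠ z in 𝓝 y, ∀ a b, g z a b = g z b a)
    (hnd : ∀ᶠ z in 𝓝 y, ∀ a, (∀ b, g z a b = 0) → a = 0)
    (hU : ∀ᶠ z in 𝓝 y, ∀ c, g z (U z) c = fderiv ℝ u z c) (hUd : DifferentiableAt ℝ U y)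
    (hΓd : DifferentiableAt ℝ Γ y) (hΓd' : DifferentiableAt ℝ Γ' y)
    (hΓ : ∀ᶠ z in 𝓝 y, IsChristoffelAt g (Γ z) z)
    (hΓ' : ∀ᶠ z in 𝓝 y, IsChristoffelAt g' (Γ' z) z) :
    ricciForm Γ' y (U y) (U y) - ricciForm Γ y (U y) (U y) =
      - g y (U y) (U y) * (LinearMap.trace ℝ E (fderiv ℝ U y)
          + LinearMap.trace ℝ E ((Γ y).flip (U y) : E →L[ℝ] E))
        - ((Module.finrank ℝ E : ℝ) - 2) / 2 * fderiv ℝ (fun z => g z (U z) (U z)) y (U y) := by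
  have hud : ∀ᶠ z in 𝓝 y, DifferentiableAt ℝ u z := by
    filter_upwards [hu.eventually (by simp)] with z hz using hz.differentiableAt (by norm_num)
  have hu2 : HasFDerivAt (fderiv ℝ u) (fderiv ℝ (fderiv ℝ u) y) y :=
    ((hu.fderiv_right (m := 1) (by norm_num)).differentiableAt (by norm_num)).hasFDerivAt
  have hs2 : ∀ a b, fderiv ℝ (fderiv ℝ u) y a b = fderiv ℝ (fderiv ℝ u) y b a := fun a b =>
    hu.isSymmSndFDerivAt (by simp) a b
  have hgy := hg.self_of_nhds.hasFDerivAt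
  have law : ∀ᶠ z in 𝓝 y, ∀ a b, Γ' z a b =
      Γ z a b + fderiv ℝ u z a • b + fderiv ℝ u z b • a - g z a b • U z := by
    filter_upwards [hg, hud, hg'.eventually_nhds, hnd, hU, hΓ, hΓ'] with z h1 h2 h3 h4 h5 h6 h7
    exact h6.conformal h1 h2 h3 h4 h5 h7
  have hΓs := hΓ.self_of_nhds.symm hg.self_of_nhds hsymm hnd.self_of_nhds
  have law0 := law.self_of_nhds
  have hU0 := hU.self_of_nhds
  have hs0 := hsymm.self_of_nhds
  have hU0' : ∀ c, g y c (U y) = fderiv ℝ u y c := fun c => by rw [hs0, hU0]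
  have key : ∀ d a b, fderiv ℝ Γ' y d a b = fderiv ℝ Γ y d a b
      + fderiv ℝ (fderiv ℝ u) y d a • b + fderiv ℝ (fderiv ℝ u) y d b • a
      - fderiv ℝ g y d a b • U y - g y a b • fderiv ℝ U y d := by
    intro d a b
    have h1 := (hΓd'.hasFDerivAt.clm_apply (hasFDerivAt_const a y)).clm_apply (hasFDerivAt_const b y)
    have h2 := ((((hΓd.hasFDerivAt.clm_apply (hasFDerivAt_const a y)).clm_apply
      (hasFDerivAt_const b y)).add
      ((hu2.clm_apply (hasFDerivAt_const a y)).smul (hasFDerivAt_const b y))).add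
      ((hu2.clm_apply (hasFDerivAt_const b y)).smul (hasFDerivAt_const a y))).sub
      (((hgy.clm_apply (hasFDerivAt_const a y)).clm_apply (hasFDerivAt_const b y)).smul
        hUd.hasFDerivAt)
    have h3 := h2.congr_of_eventuallyEq (f₁ := fun z => Γ' z a b)
      (by filter_upwards [law] with z hz using hz a b)
    have h5 := congrArg (fun L => L d) (h1.unique h3)
    simp at h5
    rw [h5]; abel
  set q := g y (U y) (U y) with hq
  have hq' : fderiv ℝ u y (U y) = q := by rw [hq, hU0]
  set W := Γ y (U y) (U y) with hW
  -- the difference of the two curvature maps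
  have hdiff : curvature Γ' y (U y) (U y) = curvature Γ y (U y) (U y)
      + (((fderiv ℝ (fderiv ℝ u) y).flip (U y) : E →ₗ[ℝ] ℝ).smulRight (U y)
      - (((fderiv ℝ g y).flip (U y)).flip (U y) : E →ₗ[ℝ] ℝ).smulRight (U y)
      - q • (fderiv ℝ U y : E →ₗ[ℝ] E)
      - fderiv ℝ (fderiv ℝ u) y (U y) (U y) • LinearMap.id
      + ((fderiv ℝ g y (U y)).flip (U y) : E →ₗ[ℝ] ℝ).smulRight (U y)
      + (fderiv ℝ u y : E →ₗ[ℝ] ℝ).smulRight (fderiv ℝ U y (U y))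
      + (fderiv ℝ u y : E →ₗ[ℝ] ℝ).smulRight W
      + fderiv ℝ u y W • LinearMap.id
      - ((g y).flip W : E →ₗ[ℝ] ℝ).smulRight (U y)
      - q • ((Γ y).flip (U y) : E →ₗ[ℝ] E)) := by
    ext d
    have e1 : Γ' y (U y) (U y) = W + q • U y := by
      rw [law0, hq', ← hq]; module
    have e2 : Γ' y d (U y) = Γ y d (U y) + q • d := by
      rw [law0, hU0', hq']; module
    simp only [curvature_apply, LinearMap.add_apply, LinearMap.sub_apply, LinearMap.smul_apply,
      LinearMap.smulRight_apply, ContinuousLinearMap.coe_coe, ContinuousLinearMap.flip_apply,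
      LinearMap.id_apply]
    rw [e1, e2, key, key, law0 d, law0 (U y)]
    simp only [ContinuousLinearMap.map_add, ContinuousLinearMap.map_smul, hU0, hU0', hq',
      ← hW, hs2 (U y) d, hΓs (U y) d, smul_eq_mul]
    module
  have htr : ∀ (f : E →ₗ[ℝ] ℝ) (v : E), LinearMap.trace ℝ E (f.smulRight v) = f v := by
    intro f v
    exact LinearMap.trace_smulRight f v
  -- Two computations of dq(U), one from q = g(U, U) and one from q = du(U). With the Koszul formula
  -- at (U, U, U) they express D²u(U, U) through du(DU(U)) and du(Γ(U, U)), after which the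
  -- remaining terms form the multiple (n − 2)/2 of dq(U).
  have hdq : fderiv ℝ (fun z => g z (U z) (U z)) y (U y) =
      fderiv ℝ g y (U y) (U y) (U y) + 2 * fderiv ℝ u y (fderiv ℝ U y (U y)) := by
    have h1 := (hgy.clm_apply hUd.hasFDerivAt).clm_apply hUd.hasFDerivAt
    rw [h1.fderiv]
    simp [hU0, hU0']
    ring
  have hdq2 : fderiv ℝ (fun z => g z (U z) (U z)) y (U y) =
      fderiv ℝ (fderiv ℝ u) y (U y) (U y) + fderiv ℝ u y (fderiv ℝ U y (U y)) := by
    have h1 := hu2.clm_apply hUd.hasFDerivAt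
    rw [(h1.congr_of_eventuallyEq (f₁ := fun z => g z (U z) (U z))
      (by filter_upwards [hU] with z hz using hz _)).fderiv]
    simp
    ring
  have hK := hΓ.self_of_nhds (U y) (U y) (U y)
  rw [← hW, hU0'] at hK
  rw [ricciForm, hdiff, map_add, ← ricciForm]
  simp only [map_add, map_sub, map_smul, htr, smul_eq_mul, LinearMap.trace_id,
    ContinuousLinearMap.coe_coe, ContinuousLinearMap.flip_apply, hU0]
  have hW' : g y (U y) W = fderiv ℝ u y W := hU0 W
  set X := fderiv ℝ u y (fderiv ℝ U y (U y))
  set H := fderiv ℝ (fderiv ℝ u) y (U y) (U y)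
  have e1 : H = X + 2 * fderiv ℝ u y W := by linarith
  rw [hdq2, e1]
  ring

end ConformalChange

end ConformalHuber
end

noncomputable section
namespace ConformalHuber

/-! ### Differentiability of q^r W at the zeros of q. -/

section PowerField

variable {E F : Type*} [NormedAddCommGroup E] [NormedSpace ℝ E] [NormedAddCommGroup F]
  [NormedSpace ℝ F]

theorem fderiv_eq_zero_of_nonneg_of_eq_zero {S : Set E} (hS : IsOpen S) {q : E → ℝ}
    (hq0 : ∀ z ∈ S, 0 ≤ q z) {y : E} (hy : y ∈ S) (h0 : q y = 0) : fderiv ℝ q y = 0 := by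
  apply IsLocalMin.fderiv_eq_zero
  filter_upwards [hS.mem_nhds hy] with z hz
  rw [h0]; exact hq0 z hz

/-- At a zero q is minimal, so dq = 0 and q = o(z − y). From ‖W‖ ≤ C √q and r ≥ 1/2 it follows that
q^r W = O(q), whence the derivative is zero, as the formula predicts. The borderline r = 1/2 is
dimension three. -/
theorem hasFDerivAt_rpow_smul {S : Set E} (hS : IsOpen S) {q : E → ℝ} {W : E → F}
    (hq0 : ∀ z ∈ S, 0 ≤ q z) {y : E} (hy : y ∈ S) (hq : DifferentiableAt ℝ q y)
    (hW : DifferentiableAt ℝ W y) (hC : ∃ C, ∀ᶠ z in 𝓝 y, ‖W z‖ ≤ C * √(q z))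
    {r : ℝ} (hr : 1 / 2 ≤ r) :
    HasFDerivAt (fun z => q z ^ r • W z)
      (q y ^ r • fderiv ℝ W y + (r * q y ^ (r - 1)) • (fderiv ℝ q y).smulRight (W y)) y := by
  rcases eq_or_lt_of_le (hq0 y hy) with h0 | h0
  · obtain ⟨C, hC⟩ := hC
    have hWy : W y = 0 := by
      have := hC.self_of_nhds
      rw [← h0] at this
      simpa using this
    have hr0 : r ≠ 0 := by linarith
    have hdq := fderiv_eq_zero_of_nonneg_of_eq_zero hS hq0 hy h0.symm
    rw [← h0, Real.zero_rpow hr0, zero_smul, hWy, hdq]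
    have hz : ((0 : E →L[ℝ] ℝ).smulRight (0 : F)) = 0 := by ext; simp
    rw [hz, smul_zero, add_zero]
    have hqo : (fun z => q z) =o[𝓝 y] fun z => z - y := by
      have := hq.hasFDerivAt
      rw [hdq, hasFDerivAt_iff_isLittleO] at this
      simpa [← h0] using this
    rw [hasFDerivAt_iff_isLittleO]
    simp only [hWy, smul_zero, sub_zero, zero_apply]
    refine Asymptotics.IsBigO.trans_isLittleO ?_ hqo
    refine Asymptotics.IsBigO.of_bound (|C|) ?_
    have hcont : ∀ᶠ z in 𝓝 y, q z < 1 :=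
      hq.continuousAt.eventually_lt continuousAt_const (by rw [← h0]; norm_num)
    filter_upwards [hC, hcont, hS.mem_nhds hy] with z h1 h2 h3
    have hz0 := hq0 z h3
    rw [norm_smul, Real.norm_of_nonneg (Real.rpow_nonneg hz0 _), Real.norm_of_nonneg hz0]
    have h4 : q z ^ r ≤ √(q z) := by
      rw [Real.sqrt_eq_rpow]
      exact Real.rpow_le_rpow_of_exponent_ge_of_imp hz0 h2.le hr (fun _ h => absurd h hr0)
    calc q z ^ r * ‖W z‖ ≤ √(q z) * (|C| * √(q z)) := by
          gcongr
          exact h1.trans (by gcongr; exact le_abs_self C)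
      _ = |C| * (√(q z) * √(q z)) := by ring
      _ = |C| * q z := by rw [Real.mul_self_sqrt hz0]
  · have h1 := (hq.hasFDerivAt.rpow_const (p := r) (Or.inl h0.ne')).smul hW.hasFDerivAt
    refine h1.congr_fderiv ?_
    ext v
    simp [mul_smul]

/-- Near a zero of q the possibly singular factor is harmless: q^(r−1) ‖W‖ ≤ C q^(r−1/2) stays
bounded while dq tends to zero. The field |∇u|^(n−2) ∇u is thus C¹ across critical points of u, and
no regularization is needed. -/
theorem contDiffOn_rpow_smul {S : Set E} (hS : IsOpen S) {q : E → ℝ} {W : E → F}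
    (hq0 : ∀ z ∈ S, 0 ≤ q z) (hq : ContDiffOn ℝ 1 q S)
    (hW : ContDiffOn ℝ 1 W S) (hC : ∀ y ∈ S, ∃ C, ∀ᶠ z in 𝓝 y, ‖W z‖ ≤ C * √(q z))
    {r : ℝ} (hr : 1 / 2 ≤ r) : ContDiffOn ℝ 1 (fun z => q z ^ r • W z) S := by
  have hqd : ∀ y ∈ S, DifferentiableAt ℝ q y := fun y hy =>
    (hq.contDiffAt (hS.mem_nhds hy)).differentiableAt (by norm_num)
  have hWd : ∀ y ∈ S, DifferentiableAt ℝ W y := fun y hy =>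
    (hW.contDiffAt (hS.mem_nhds hy)).differentiableAt (by norm_num)
  have hd := fun y hy =>
    hasFDerivAt_rpow_smul hS hq0 hy (hqd y hy) (hWd y hy) (hC y hy) hr
  rw [show (1 : WithTop ℕ∞) = 0 + 1 by norm_num, contDiffOn_succ_iff_fderiv_of_isOpen hS,
    contDiffOn_zero]
  refine ⟨fun y hy => (hd y hy).differentiableAt.differentiableWithinAt, by simp, ?_⟩
  have hcq : ∀ y ∈ S, ContinuousAt (fderiv ℝ q) y := fun y hy =>
    ((hq.continuousOn_fderiv_of_isOpen hS le_rfl).continuousAt (hS.mem_nhds hy))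
  have hcW : ∀ y ∈ S, ContinuousAt (fderiv ℝ W) y := fun y hy =>
    ((hW.continuousOn_fderiv_of_isOpen hS le_rfl).continuousAt (hS.mem_nhds hy))
  intro y hy
  apply ContinuousAt.continuousWithinAt
  have hev : (fun z => q z ^ r • fderiv ℝ W z + (r * q z ^ (r - 1)) • (fderiv ℝ q z).smulRight (W z))
      =ᶠ[𝓝 y] fderiv ℝ (fun z => q z ^ r • W z) := by
    filter_upwards [hS.mem_nhds hy] with z hz using (hd z hz).fderiv.symm
  refine ContinuousAt.congr ?_ hev
  have hr0 : 0 < r := by linarith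
  refine ContinuousAt.add (((hqd y hy).continuousAt.rpow_const (Or.inr hr0.le)).smul (hcW y hy)) ?_
  rcases eq_or_lt_of_le (hq0 y hy) with h0 | h0
  · obtain ⟨C, hC⟩ := hC y hy
    have hWy : W y = 0 := by
      have := hC.self_of_nhds
      rw [← h0] at this
      simpa using this
    have hval : (r * q y ^ (r - 1)) • (fderiv ℝ q y).smulRight (W y) = 0 := by
      rw [hWy]; ext; simp
    rw [ContinuousAt, hval]
    have hlim : Tendsto (fun z => r * |C| * ‖fderiv ℝ q z‖) (𝓝 y) (𝓝 0) := by
      have h1 : ContinuousAt (fun z => r * |C| * ‖fderiv ℝ q z‖) y :=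
        continuousAt_const.mul (hcq y hy).norm
      have h2 := h1.tendsto
      rwa [fderiv_eq_zero_of_nonneg_of_eq_zero hS hq0 hy h0.symm, norm_zero, mul_zero] at h2
    refine squeeze_zero_norm' ?_ hlim
    have hcont : ∀ᶠ z in 𝓝 y, q z < 1 :=
      (hqd y hy).continuousAt.eventually_lt continuousAt_const (by rw [← h0]; norm_num)
    filter_upwards [hC, hcont, hS.mem_nhds hy] with z h1 h2 h3
    have hz0 := hq0 z h3
    rw [norm_smul, ContinuousLinearMap.norm_smulRight_apply, norm_mul,
      Real.norm_of_nonneg hr0.le, Real.norm_of_nonneg (Real.rpow_nonneg hz0 _)]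
    have h4 : q z ^ (r - 1) * √(q z) ≤ 1 := by
      rcases eq_or_lt_of_le hz0 with h5 | h5
      · rw [← h5]; simp
      · rw [Real.sqrt_eq_rpow, ← Real.rpow_add h5]
        exact Real.rpow_le_one hz0 h2.le (by linarith)
    calc r * q z ^ (r - 1) * (‖fderiv ℝ q z‖ * ‖W z‖)
        ≤ r * q z ^ (r - 1) * (‖fderiv ℝ q z‖ * (|C| * √(q z))) := by
          have := Real.rpow_nonneg hz0 (r - 1)
          gcongr
          exact h1.trans (by gcongr; exact le_abs_self C)
      _ = r * |C| * ‖fderiv ℝ q z‖ * (q z ^ (r - 1) * √(q z)) := by ring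
      _ ≤ r * |C| * ‖fderiv ℝ q z‖ * 1 := by gcongr
      _ = _ := by ring
  · have h1 : ContinuousAt (fun z => (fderiv ℝ q z).smulRight (W z)) y :=
      ((ContinuousLinearMap.smulRightL ℝ E F).continuous₂.continuousAt).comp₂ (hcq y hy)
        (hWd y hy).continuousAt
    exact (continuousAt_const.mul ((hqd y hy).continuousAt.rpow_const (Or.inl h0.ne'))).smul h1

end PowerField

/-! ### The divergence theorem for compactly supported fields. -/

section Divergence

variable {E : Type*} [NormedAddCommGroup E] [NormedSpace ℝ E] [FiniteDimensional ℝ E]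
  [MeasurableSpace E] [BorelSpace E]

/-- In a basis the trace is a sum of partial derivatives, and each integrates to zero by parts
against the constant 1. -/
theorem integral_trace_fderiv_eq_zero (μ : Measure E) [μ.IsAddHaarMeasure] {V : E → E}
    (hV : ContDiff ℝ 1 V) (hc : HasCompactSupport V) :
    Integrable (fun z => LinearMap.trace ℝ E (fderiv ℝ V z)) μ ∧
      ∫ z, LinearMap.trace ℝ E (fderiv ℝ V z) ∂μ = 0 := by
  let b := Module.finBasis ℝ E
  let c : ∀ i, E →L[ℝ] ℝ := fun i => LinearMap.toContinuousLinearMap (b.coord i)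
  have htr : ∀ z, LinearMap.trace ℝ E (fderiv ℝ V z) =
      ∑ i, fderiv ℝ (fun z => c i (V z)) z (b i) := by
    intro z
    rw [LinearMap.trace_eq_matrix_trace ℝ b, Matrix.trace]
    refine Finset.sum_congr rfl fun i _ => ?_
    have h1 := (c i).hasFDerivAt.comp z (hV.differentiable (by norm_num) z).hasFDerivAt
    have h2 : fderiv ℝ (fun z => c i (V z)) z = (c i).comp (fderiv ℝ V z) := h1.fderiv
    rw [h2]
    simp [LinearMap.toMatrix_apply, c]
  have hcd : ∀ i, ContDiff ℝ 1 fun z => c i (V z) := fun i => (c i).contDiff.comp hV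
  have hcs : ∀ i, HasCompactSupport fun z => c i (V z) := fun i =>
    hc.comp_left (g := c i) (map_zero _)
  have hint : ∀ i, Integrable (fun z => fderiv ℝ (fun z => c i (V z)) z (b i)) μ := fun i =>
    (((hcd i).continuous_fderiv (by norm_num)).clm_apply continuous_const).integrable_of_hasCompactSupport
      ((hcs i).fderiv_apply (𝕜 := ℝ) (b i))
  have hzero : ∀ i, ∫ z, fderiv ℝ (fun z => c i (V z)) z (b i) ∂μ = 0 := by
    intro i
    have := integral_mul_fderiv_eq_neg_fderiv_mul_of_integrable (𝕜 := ℝ) (μ := μ)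
      (f := fun _ => (1 : ℝ)) (g := fun z => c i (V z)) (v := b i) (by simp) (by simpa using hint i)
      (by simpa using (hcd i).continuous.integrable_of_hasCompactSupport (hcs i))
      (by intro x _; fun_prop) (fun x _ => (hcd i).differentiable (by norm_num) x)
    simpa using this
  simp only [htr]
  refine ⟨integrable_finsetSum _ fun i _ => hint i, ?_⟩
  rw [integral_finsetSum _ fun i _ => hint i]
  exact Finset.sum_eq_zero fun i _ => hzero i

end Divergence

end ConformalHuber
end

noncomputable section
namespace ConformalHuber

/-! ### The divergence identity against a test function, in a vector space with a density. -/

section WeightedDivergence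

set_option synthInstance.maxHeartbeats 400000

theorem contDiff_of_contDiffOn_of_tsupport_subset {E F : Type*} [NormedAddCommGroup E]
    [NormedSpace ℝ E] [NormedAddCommGroup F] [NormedSpace ℝ F] {f : E → F} {S : Set E}
    (hS : IsOpen S) {k : WithTop ℕ∞} (hf : ContDiffOn ℝ k f S) (h : tsupport f ⊆ S) :
    ContDiff ℝ k f := by
  rw [contDiff_iff_contDiffAt]
  intro x
  by_cases hx : x ∈ tsupport f
  · exact hf.contDiffAt (hS.mem_nhds (h hx))
  · have h0 : f =ᶠ[𝓝 x] fun _ => 0 := notMem_tsupport_iff_eventuallyEq.mp hx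
    exact contDiffAt_const.congr_of_eventuallyEq h0

variable {E : Type*} [NormedAddCommGroup E] [NormedSpace ℝ E] [FiniteDimensional ℝ E]
  [MeasurableSpace E] [BorelSpace E]

/-- The weak form of the conformal change of the Ricci curvature: with `q = |∇u|²`, the field
`q ^ ((n - 2) / 2) ∇u` has divergence `- q ^ ((n - 4) / 2) (Ric' - Ric)(∇u, ∇u)`. -/
theorem integral_conformal_ricci (μ : Measure E) [μ.IsAddHaarMeasure]
    (hn : 3 ≤ Module.finrank ℝ E) {S : Set E} (hS : IsOpen S)
    {g g' : E → E →L[ℝ] E →L[ℝ] ℝ} {u σ w : E → ℝ} {U : E → E} {Γ Γ' : E → E →L[ℝ] E →L[ℝ] E}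
    (hg : ContDiffOn ℝ 1 g S) (hu : ContDiffOn ℝ 2 u S)
    (hg' : ∀ z ∈ S, g' z = Real.exp (2 * u z) • g z)
    (hsymm : ∀ z ∈ S, ∀ a b, g z a b = g z b a)
    (hcoer : ∀ y ∈ S, ∃ c > 0, ∀ᶠ z in 𝓝 y, ∀ a, c * ‖a‖ ^ 2 ≤ g z a a)
    (hU : ∀ z ∈ S, ∀ c, g z (U z) c = fderiv ℝ u z c) (hUd : ContDiffOn ℝ 1 U S)
    (hΓd : ∀ z ∈ S, DifferentiableAt ℝ Γ z) (hΓd' : ∀ z ∈ S, DifferentiableAt ℝ Γ' z)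
    (hΓ : ∀ z ∈ S, IsChristoffelAt g (Γ z) z) (hΓ' : ∀ z ∈ S, IsChristoffelAt g' (Γ' z) z)
    (hσ : ContDiffOn ℝ 1 σ S)
    (hσΓ : ∀ z ∈ S, ∀ d, fderiv ℝ σ z d = σ z * LinearMap.trace ℝ E (Γ z d : E →L[ℝ] E))
    (hw : ContDiff ℝ 1 w) (hwc : HasCompactSupport w) (hwS : tsupport w ⊆ S) :
    Integrable (fun z => σ z * g z (U z) (U z) ^ (((Module.finrank ℝ E : ℝ) - 2) / 2) *
        fderiv ℝ w z (U z)) μ ∧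
    Integrable (fun z => σ z * w z * g z (U z) (U z) ^ (((Module.finrank ℝ E : ℝ) - 2) / 2 - 1) *
        (ricciForm Γ' z (U z) (U z) - ricciForm Γ z (U z) (U z))) μ ∧
    ∫ z, σ z * g z (U z) (U z) ^ (((Module.finrank ℝ E : ℝ) - 2) / 2) * fderiv ℝ w z (U z) ∂μ =
      ∫ z, σ z * w z * g z (U z) (U z) ^ (((Module.finrank ℝ E : ℝ) - 2) / 2 - 1) *
        (ricciForm Γ' z (U z) (U z) - ricciForm Γ z (U z) (U z)) ∂μ := by
  set r : ℝ := ((Module.finrank ℝ E : ℝ) - 2) / 2 with hr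
  have hr2 : 1 / 2 ≤ r := by
    have : (3 : ℝ) ≤ Module.finrank ℝ E := by exact_mod_cast hn
    rw [hr]; linarith
  set q : E → ℝ := fun z => g z (U z) (U z) with hq
  have hq0 : ∀ z ∈ S, 0 ≤ q z := by
    intro z hz
    obtain ⟨c, hc, h⟩ := hcoer z hz
    exact le_trans (by positivity) (h.self_of_nhds (U z))
  have hUz : ∀ z ∈ S, q z = 0 → U z = 0 := by
    intro z hz h0
    obtain ⟨c, hc, h⟩ := hcoer z hz
    have h1 := h.self_of_nhds (U z)
    change c * ‖U z‖ ^ 2 ≤ q z at h1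
    rw [h0] at h1
    have h2 : ‖U z‖ ^ 2 ≤ 0 := nonpos_of_mul_nonpos_right h1 hc
    exact norm_eq_zero.mp (by nlinarith [norm_nonneg (U z)])
  have hqd : ContDiffOn ℝ 1 q S := (hg.clm_apply hUd).clm_apply hUd
  have hnd : ∀ z ∈ S, ∀ a, (∀ b, g z a b = 0) → a = 0 := by
    intro z hz a ha
    obtain ⟨c, hc, h⟩ := hcoer z hz
    have h1 := h.self_of_nhds a
    rw [ha a] at h1
    have h2 : ‖a‖ ^ 2 ≤ 0 := nonpos_of_mul_nonpos_right h1 hc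
    exact norm_eq_zero.mp (by nlinarith [norm_nonneg a])
  have hC : ∀ y ∈ S, ∃ C, ∀ᶠ z in 𝓝 y, ‖U z‖ ≤ C * √(q z) := by
    intro y hy
    obtain ⟨c, hc, h⟩ := hcoer y hy
    refine ⟨(√c)⁻¹, ?_⟩
    filter_upwards [h] with z hz
    have h1 := Real.sqrt_le_sqrt (hz (U z))
    rw [Real.sqrt_mul hc.le, Real.sqrt_sq (norm_nonneg _)] at h1
    rw [inv_mul_eq_div, le_div_iff₀ (Real.sqrt_pos.mpr hc)]
    linarith
  have hP := contDiffOn_rpow_smul hS hq0 hqd hUd hC hr2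
  set P : E → E := fun z => q z ^ r • U z with hPdef
  -- With the density σ inside the field, the trace of DV is the Riemannian divergence times σ: by
  -- `hσΓ`, dσ(U) supplies exactly the term tr Γ(U) that occurs in the contracted conformal law.
  set V : E → E := fun z => (w z * σ z) • P z with hV
  have hVS : tsupport V ⊆ S := by
    refine subset_trans ?_ hwS
    refine closure_mono ?_
    intro z hz
    rw [Function.mem_support] at hz ⊢
    contrapose! hz
    simp [hV, hz]
  have hVd : ContDiff ℝ 1 V :=
    contDiff_of_contDiffOn_of_tsupport_subset hS ((hw.contDiffOn.mul hσ).smul hP) hVS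
  have hVc : HasCompactSupport V := by
    refine hwc.mono ?_
    intro z hz
    rw [Function.mem_support] at hz ⊢
    contrapose! hz
    simp [hV, hz]
  obtain ⟨hi, h0⟩ := integral_trace_fderiv_eq_zero μ hVd hVc
  have hptw : ∀ z, LinearMap.trace ℝ E (fderiv ℝ V z) =
      σ z * q z ^ r * fderiv ℝ w z (U z) - σ z * w z * q z ^ (r - 1) *
        (ricciForm Γ' z (U z) (U z) - ricciForm Γ z (U z) (U z)) := by
    intro z
    by_cases hz : z ∈ tsupport w
    · have hzS := hwS hz
      have hSn := hS.mem_nhds hzS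
      have hqz : DifferentiableAt ℝ q z := (hqd.contDiffAt hSn).differentiableAt (by norm_num)
      have hUz' : DifferentiableAt ℝ U z := (hUd.contDiffAt hSn).differentiableAt (by norm_num)
      have hPz := hasFDerivAt_rpow_smul hS hq0 hzS hqz hUz' (hC z hzS) hr2
      have hwz := (hw.differentiable (by norm_num) z).hasFDerivAt
      have hσz := ((hσ.contDiffAt hSn).differentiableAt (by norm_num)).hasFDerivAt
      have hVz : HasFDerivAt V _ z := (hwz.mul hσz).smul hPz
      have hricci := ricciForm_conformal_grad (y := z) (g := g) (g' := g') (u := u) (U := U) (Γ := Γ)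
        (Γ' := Γ') (by filter_upwards [hSn] with x hx using
          (hg.contDiffAt (hS.mem_nhds hx)).differentiableAt (by norm_num)) (hu.contDiffAt hSn)
        (by filter_upwards [hSn] with x hx using hg' x hx)
        (by filter_upwards [hSn] with x hx using hsymm x hx)
        (by filter_upwards [hSn] with x hx using hnd x hx)
        (by filter_upwards [hSn] with x hx using hU x hx) hUz' (hΓd z hzS) (hΓd' z hzS)
        (by filter_upwards [hSn] with x hx using hΓ x hx)
        (by filter_upwards [hSn] with x hx using hΓ' x hx)
      have hΓs := (hΓ z hzS).symm ((hg.contDiffAt hSn).differentiableAt (by norm_num))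
        (by filter_upwards [hSn] with x hx using hsymm x hx) (hnd z hzS)
      have hflip : ((Γ z).flip (U z) : E →L[ℝ] E) = Γ z (U z) := by
        ext d; exact hΓs d (U z)
      rw [hflip, ← hr] at hricci
      rw [hVz.fderiv]
      have hlin : ((((w z * σ z) • (q z ^ r • fderiv ℝ U z + (r * q z ^ (r - 1)) •
            (fderiv ℝ q z).smulRight (U z)) + ((w z • fderiv ℝ σ z + σ z • fderiv ℝ w z)).smulRight
              (q z ^ r • U z)) : E →L[ℝ] E) : E →ₗ[ℝ] E) =
          (w z * σ z) • (q z ^ r • (fderiv ℝ U z : E →ₗ[ℝ] E) + (r * q z ^ (r - 1)) •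
            (fderiv ℝ q z : E →ₗ[ℝ] ℝ).smulRight (U z)) +
          (w z • (fderiv ℝ σ z : E →ₗ[ℝ] ℝ) + σ z • (fderiv ℝ w z : E →ₗ[ℝ] ℝ)).smulRight
              (q z ^ r • U z) := by
        ext d; simp
      refine (congrArg (LinearMap.trace ℝ E) hlin).trans ?_
      simp only [map_add, map_smul, LinearMap.trace_smulRight, smul_eq_mul, LinearMap.add_apply,
        LinearMap.smul_apply, ContinuousLinearMap.coe_coe, hσΓ z hzS]
      rw [hricci]
      -- Where q = 0 also U = 0, so both sides vanish whatever value 0 ^ (r - 1) takes. Elsewhere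
      -- q^r = q · q^(r−1).
      rcases eq_or_lt_of_le (hq0 z hzS) with hz0 | hz0
      · have hU0 := hUz z hzS hz0.symm
        have hr0 : r ≠ 0 := by linarith
        change _ = σ z * q z ^ r * _ - σ z * w z * q z ^ (r - 1) * (- q z * _ - _)
        rw [← hz0, Real.zero_rpow hr0, hU0]
        simp
      · have hpow : q z ^ r = q z * q z ^ (r - 1) := by
          rw [mul_comm, ← Real.rpow_add_one hz0.ne']; ring_nf
        change _ = σ z * q z ^ r * _ - σ z * w z * q z ^ (r - 1) * (- q z * _ - r * fderiv ℝ q z _)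
        rw [hpow]
        ring
    · have h1 : w z = 0 := image_eq_zero_of_notMem_tsupport hz
      have h2 : fderiv ℝ w z = 0 := fderiv_of_notMem_tsupport ℝ hz
      have h3 : fderiv ℝ V z = 0 := by
        apply fderiv_of_notMem_tsupport ℝ
        intro hz'
        refine hz (closure_mono ?_ hz')
        intro x hx
        rw [Function.mem_support] at hx ⊢
        contrapose! hx
        simp [hV, hx]
      rw [h1, h2, h3]
      simp
  have hi1 : Integrable (fun z => σ z * q z ^ r * fderiv ℝ w z (U z)) μ := by
    have hco : ContinuousOn (fun z => σ z * q z ^ r * fderiv ℝ w z (U z)) S :=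
      (hσ.continuousOn.mul (hqd.continuousOn.rpow_const fun _ _ => Or.inr (by linarith))).mul
        ((hw.continuous_fderiv (by norm_num)).continuousOn.clm_apply hUd.continuousOn)
    have hts : tsupport (fun z => σ z * q z ^ r * fderiv ℝ w z (U z)) ⊆ tsupport w := by
      refine closure_minimal ?_ (isClosed_tsupport w)
      intro z hz
      by_contra hzw
      rw [Function.mem_support, fderiv_of_notMem_tsupport ℝ hzw] at hz
      simp at hz
    refine Continuous.integrable_of_hasCompactSupport ?_ (hwc.of_isClosed_subset
      (isClosed_tsupport _) hts)
    refine continuous_of_tsupport fun x hx => hco.continuousAt (hS.mem_nhds (hwS (hts hx)))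
  -- The factor q^(r−1) is unbounded near critical points when n = 3, so integrability is read off
  -- as the difference of two continuous integrands with compact support.
  have hi2 : Integrable (fun z => σ z * w z * q z ^ (r - 1) *
        (ricciForm Γ' z (U z) (U z) - ricciForm Γ z (U z) (U z))) μ := by
    refine (hi1.sub hi).congr (Eventually.of_forall fun z => ?_)
    simp only [Pi.sub_apply, hptw]
    ring
  refine ⟨hi1, hi2, ?_⟩
  simp only [hptw] at h0
  rw [integral_sub hi1 hi2] at h0
  linarith

end WeightedDivergence

end ConformalHuber
end

noncomputable section
namespace ConformalHuber

/-! ### Matrix-valued metrics on open sets of ℝⁿ. -/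

section Coordinates

set_option synthInstance.maxHeartbeats 400000

variable {n : ℕ}

/-- The bilinear form with matrix `A`. -/
def matForm (A : Matrix (Fin n) (Fin n) ℝ) :
    EuclideanSpace ℝ (Fin n) →L[ℝ] EuclideanSpace ℝ (Fin n) →L[ℝ] ℝ :=
  ∑ i, ∑ j, A i j • (EuclideanSpace.proj (𝕜 := ℝ) i).smulRight (EuclideanSpace.proj (𝕜 := ℝ) j)

theorem matForm_apply (A : Matrix (Fin n) (Fin n) ℝ) (a b : EuclideanSpace ℝ (Fin n)) :
    matForm A a b = ∑ i, ∑ j, A i j * a i * b j := by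
  simp [matForm, mul_assoc]

theorem matForm_single (A : Matrix (Fin n) (Fin n) ℝ) (i j : Fin n) :
    matForm A (EuclideanSpace.single i 1) (EuclideanSpace.single j 1) = A i j := by
  simp [matForm_apply]

theorem matForm_smul (c : ℝ) (A : Matrix (Fin n) (Fin n) ℝ) :
    matForm (c • A) = c • matForm A := by
  ext a b
  simp [matForm_apply, Finset.mul_sum, mul_assoc]

theorem matForm_comm {A : Matrix (Fin n) (Fin n) ℝ} (hA : ∀ i j, A i j = A j i)
    (a b : EuclideanSpace ℝ (Fin n)) : matForm A a b = matForm A b a := by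
  rw [matForm_apply, matForm_apply, Finset.sum_comm]
  refine Finset.sum_congr rfl fun i _ => Finset.sum_congr rfl fun j _ => ?_
  rw [hA]; ring

theorem contDiffOn_matForm {S : Set (EuclideanSpace ℝ (Fin n))} {k : WithTop ℕ∞}
    {G : EuclideanSpace ℝ (Fin n) → Matrix (Fin n) (Fin n) ℝ}
    (hG : ∀ i j, ContDiffOn ℝ k (fun z => G z i j) S) :
    ContDiffOn ℝ k (fun z => matForm (G z)) S := by
  unfold matForm
  refine ContDiffOn.sum fun i _ => ContDiffOn.sum fun j _ => ?_
  exact (hG i j).smul contDiffOn_const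

/-- The vector-valued bilinear map with components `c k i j`. -/
def vecForm (c : Fin n → Fin n → Fin n → ℝ) :
    EuclideanSpace ℝ (Fin n) →L[ℝ] EuclideanSpace ℝ (Fin n) →L[ℝ] EuclideanSpace ℝ (Fin n) :=
  ∑ k, ∑ i, ∑ j, c k i j • (EuclideanSpace.proj (𝕜 := ℝ) i).smulRight
    ((EuclideanSpace.proj (𝕜 := ℝ) j).smulRight (EuclideanSpace.single k (1 : ℝ)))

theorem vecForm_apply (c : Fin n → Fin n → Fin n → ℝ) (a b : EuclideanSpace ℝ (Fin n))
    (k : Fin n) : vecForm c a b k = ∑ i, ∑ j, c k i j * a i * b j := by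
  simp only [vecForm, _root_.sum_apply, _root_.smul_apply, ContinuousLinearMap.smulRight_apply,
    PiLp.proj_apply, WithLp.ofLp_sum, WithLp.ofLp_smul, Finset.sum_apply, Pi.smul_apply,
    PiLp.single_apply, smul_eq_mul]
  rw [Finset.sum_eq_single k]
  · simp [mul_assoc]
  · intro l _ hl
    simp [hl.symm]
  · simp

theorem vecForm_single (c : Fin n → Fin n → Fin n → ℝ) (k i j : Fin n) :
    vecForm c (EuclideanSpace.single i 1) (EuclideanSpace.single j 1) k = c k i j := by
  simp [vecForm_apply]

theorem contDiffOn_vecForm {S : Set (EuclideanSpace ℝ (Fin n))} {m : WithTop ℕ∞}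
    {c : EuclideanSpace ℝ (Fin n) → Fin n → Fin n → Fin n → ℝ}
    (hc : ∀ k i j, ContDiffOn ℝ m (fun z => c z k i j) S) :
    ContDiffOn ℝ m (fun z => vecForm (c z)) S := by
  unfold vecForm
  refine ContDiffOn.sum fun k _ => ContDiffOn.sum fun i _ => ContDiffOn.sum fun j _ => ?_
  exact (hc k i j).smul contDiffOn_const

theorem contDiffOn_partialD {S : Set (EuclideanSpace ℝ (Fin n))} (hS : IsOpen S)
    {f : EuclideanSpace ℝ (Fin n) → ℝ} (hf : ContDiffOn ℝ ∞ f S) (i : Fin n) :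
    ContDiffOn ℝ ∞ (partialD i f) S :=
  (hf.fderiv_of_isOpen hS (by simp)).clm_apply contDiffOn_const

theorem contDiffOn_det {E : Type*} [NormedAddCommGroup E] [NormedSpace ℝ E] {S : Set E}
    {m : WithTop ℕ∞} {A : E → Matrix (Fin n) (Fin n) ℝ}
    (hA : ∀ i j, ContDiffOn ℝ m (fun z => A z i j) S) :
    ContDiffOn ℝ m (fun z => (A z).det) S := by
  simp only [Matrix.det_apply]
  refine ContDiffOn.sum fun σ _ => ?_
  exact (contDiffOn_prod fun i _ => hA (σ i) i).const_smul _

theorem contDiffOn_inv {E : Type*} [NormedAddCommGroup E] [NormedSpace ℝ E] {S : Set E}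
    {m : WithTop ℕ∞} {A : E → Matrix (Fin n) (Fin n) ℝ}
    (hA : ∀ i j, ContDiffOn ℝ m (fun z => A z i j) S) (hdet : ∀ z ∈ S, (A z).det ≠ 0)
    (i j : Fin n) : ContDiffOn ℝ m (fun z => (A z)⁻¹ i j) S := by
  -- Cramer's rule: the entries of the inverse are polynomials in the entries of A divided by the
  -- determinant.
  have h : ∀ z, (A z)⁻¹ i j = ((A z).det)⁻¹ * (Matrix.updateRow (A z) j (Pi.single i 1)).det := by
    intro z
    rw [Matrix.inv_def, Matrix.smul_apply, Ring.inverse_eq_inv', Matrix.adjugate_apply, smul_eq_mul]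
  simp only [h]
  refine ((contDiffOn_det hA).inv hdet).mul (contDiffOn_det fun a b => ?_)
  by_cases haj : a = j
  · subst haj
    simp only [Matrix.updateRow_self]
    exact contDiffOn_const
  · simp only [Matrix.updateRow_ne haj]
    exact hA a b

/-- The components of the Christoffel symbols of a matrix-valued metric. -/
def chr (G : EuclideanSpace ℝ (Fin n) → Matrix (Fin n) (Fin n) ℝ) (k i j : Fin n)
    (y : EuclideanSpace ℝ (Fin n)) : ℝ :=
  (1 / 2 : ℝ) * ∑ l, (G y)⁻¹ k l *
    (partialD i (fun z => G z j l) y + partialD j (fun z => G z i l) y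
      - partialD l (fun z => G z i j) y)

/-- The Christoffel symbols of a matrix-valued metric as a field of bilinear maps. -/
def chrMap (G : EuclideanSpace ℝ (Fin n) → Matrix (Fin n) (Fin n) ℝ)
    (y : EuclideanSpace ℝ (Fin n)) :
    EuclideanSpace ℝ (Fin n) →L[ℝ] EuclideanSpace ℝ (Fin n) →L[ℝ] EuclideanSpace ℝ (Fin n) :=
  vecForm fun k i j => chr G k i j y

/-- The components of the Ricci tensor of a matrix-valued metric. -/
def ricciMat (G : EuclideanSpace ℝ (Fin n) → Matrix (Fin n) (Fin n) ℝ)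
    (y : EuclideanSpace ℝ (Fin n)) (i j : Fin n) : ℝ :=
  ∑ k, (partialD k (chr G k i j) y - partialD j (chr G k i k) y)
    + ∑ k, ∑ l, (chr G k k l y * chr G l i j y - chr G k j l y * chr G l i k y)

/-- A smooth Riemannian metric on an open set of `ℝⁿ`, as a matrix-valued function. -/
structure IsMetricOn (G : EuclideanSpace ℝ (Fin n) → Matrix (Fin n) (Fin n) ℝ)
    (S : Set (EuclideanSpace ℝ (Fin n))) : Prop where
  smooth : ∀ i j, ContDiffOn ℝ ∞ (fun z => G z i j) S
  symm : ∀ z ∈ S, ∀ i j, G z i j = G z j i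
  pos : ∀ z ∈ S, ∀ a, a ≠ 0 → 0 < matForm (G z) a a

variable {G : EuclideanSpace ℝ (Fin n) → Matrix (Fin n) (Fin n) ℝ}
  {S : Set (EuclideanSpace ℝ (Fin n))}

theorem IsMetricOn.mono {T : Set (EuclideanSpace ℝ (Fin n))} (h : IsMetricOn G S) (hT : T ⊆ S) :
    IsMetricOn G T :=
  ⟨fun i j => (h.smooth i j).mono hT, fun z hz => h.symm z (hT hz), fun z hz => h.pos z (hT hz)⟩

theorem IsMetricOn.posDef (h : IsMetricOn G S) {z : EuclideanSpace ℝ (Fin n)} (hz : z ∈ S) :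
    (G z).PosDef := by
  refine Matrix.PosDef.of_dotProduct_mulVec_pos ?_ ?_
  · exact Matrix.IsHermitian.ext fun i j => by simpa using h.symm z hz j i
  · intro x hx
    have := h.pos z hz (WithLp.toLp 2 x) (by simpa using hx)
    rw [matForm_apply] at this
    refine lt_of_lt_of_eq this ?_
    simp only [dotProduct, Matrix.mulVec, Finset.mul_sum, Pi.star_apply, star_trivial]
    exact Finset.sum_congr rfl fun i _ => Finset.sum_congr rfl fun j _ => by ring

theorem IsMetricOn.det_pos (h : IsMetricOn G S) {z : EuclideanSpace ℝ (Fin n)} (hz : z ∈ S) :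
    0 < (G z).det := (h.posDef hz).det_pos

theorem IsMetricOn.mul_inv (h : IsMetricOn G S) {z : EuclideanSpace ℝ (Fin n)} (hz : z ∈ S) :
    G z * (G z)⁻¹ = 1 := Matrix.mul_nonsing_inv _ (h.det_pos hz).ne'.isUnit

theorem IsMetricOn.inv_symm (h : IsMetricOn G S) {z : EuclideanSpace ℝ (Fin n)} (hz : z ∈ S)
    (i j : Fin n) : (G z)⁻¹ i j = (G z)⁻¹ j i := by
  have := (h.posDef hz).isHermitian.inv
  simpa using this.apply j i

theorem IsMetricOn.smooth_inv (h : IsMetricOn G S) (i j : Fin n) :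
    ContDiffOn ℝ ∞ (fun z => (G z)⁻¹ i j) S :=
  contDiffOn_inv h.smooth (fun _ hz => (h.det_pos hz).ne') i j

theorem IsMetricOn.smooth_matForm (h : IsMetricOn G S) :
    ContDiffOn ℝ ∞ (fun z => matForm (G z)) S := contDiffOn_matForm h.smooth

theorem IsMetricOn.nondegenerate (h : IsMetricOn G S) {z : EuclideanSpace ℝ (Fin n)} (hz : z ∈ S)
    (a : EuclideanSpace ℝ (Fin n)) (ha : ∀ b, matForm (G z) a b = 0) : a = 0 := by
  by_contra hne
  exact (h.pos z hz a hne).ne' (ha a)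

theorem IsMetricOn.smooth_chr (h : IsMetricOn G S) (hS : IsOpen S) (k i j : Fin n) :
    ContDiffOn ℝ ∞ (chr G k i j) S := by
  unfold chr
  refine contDiffOn_const.mul (ContDiffOn.sum fun l _ => (h.smooth_inv k l).mul ?_)
  exact ((contDiffOn_partialD hS (h.smooth j l) i).add
    (contDiffOn_partialD hS (h.smooth i l) j)).sub (contDiffOn_partialD hS (h.smooth i j) l)

theorem IsMetricOn.smooth_chrMap (h : IsMetricOn G S) (hS : IsOpen S) :
    ContDiffOn ℝ ∞ (chrMap G) S := contDiffOn_vecForm fun k i j => h.smooth_chr hS k i j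

theorem continuousOn_ricciMat (h : IsMetricOn G S) (hS : IsOpen S) (i j : Fin n) :
    ContinuousOn (fun y => ricciMat G y i j) S := by
  unfold ricciMat
  have hc := fun k i j => (h.smooth_chr hS k i j).continuousOn
  have hp := fun l k i j => (contDiffOn_partialD hS (h.smooth_chr hS k i j) l).continuousOn
  refine ContinuousOn.add (continuousOn_finsetSum _ fun k _ => (hp _ _ _ _).sub (hp _ _ _ _))
    (continuousOn_finsetSum _ fun k _ => continuousOn_finsetSum _ fun l _ => ?_)
  exact ((hc _ _ _).mul (hc _ _ _)).sub ((hc _ _ _).mul (hc _ _ _))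

end Coordinates

end ConformalHuber
end

noncomputable section
namespace ConformalHuber

/-! ### The index formulas for Γ and Ric agree with the invariant ones. -/

section Coordinates

set_option synthInstance.maxHeartbeats 400000

variable {n : ℕ} {G : EuclideanSpace ℝ (Fin n) → Matrix (Fin n) (Fin n) ℝ}
  {S : Set (EuclideanSpace ℝ (Fin n))}

theorem eq_sum_single (a : EuclideanSpace ℝ (Fin n)) :
    a = ∑ i, a i • EuclideanSpace.single i (1 : ℝ) := by
  ext j
  simp [WithLp.ofLp_sum, Finset.sum_apply, Pi.single_apply]

theorem IsMetricOn.fderiv_matForm_single (h : IsMetricOn G S) (hS : IsOpen S)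
    {z : EuclideanSpace ℝ (Fin n)} (hz : z ∈ S) (i j l : Fin n) :
    fderiv ℝ (fun z => matForm (G z)) z (EuclideanSpace.single i 1) (EuclideanSpace.single j 1)
      (EuclideanSpace.single l 1) = partialD i (fun z => G z j l) z := by
  have hd : HasFDerivAt (fun z => matForm (G z)) (fderiv ℝ (fun z => matForm (G z)) z) z :=
    ((h.smooth_matForm.contDiffAt (hS.mem_nhds hz)).differentiableAt (by simp)).hasFDerivAt
  have h1 := (hd.clm_apply (hasFDerivAt_const (EuclideanSpace.single j (1 : ℝ)) z)).clm_apply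
    (hasFDerivAt_const (EuclideanSpace.single l (1 : ℝ)) z)
  simp only [matForm_single] at h1
  rw [partialD, h1.fderiv]
  simp

theorem trilinear_eq_of_single {F : Type*} [NormedAddCommGroup F] [NormedSpace ℝ F]
    {A B : EuclideanSpace ℝ (Fin n) → EuclideanSpace ℝ (Fin n) → EuclideanSpace ℝ (Fin n) → F}
    (hA1 : ∀ b c, IsLinearMap ℝ fun a => A a b c) (hA2 : ∀ a c, IsLinearMap ℝ fun b => A a b c)
    (hA3 : ∀ a b, IsLinearMap ℝ fun c => A a b c)
    (hB1 : ∀ b c, IsLinearMap ℝ fun a => B a b c) (hB2 : ∀ a c, IsLinearMap ℝ fun b => B a b c)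
    (hB3 : ∀ a b, IsLinearMap ℝ fun c => B a b c)
    (h : ∀ i j l, A (EuclideanSpace.single i 1) (EuclideanSpace.single j 1)
      (EuclideanSpace.single l 1) = B (EuclideanSpace.single i 1) (EuclideanSpace.single j 1)
      (EuclideanSpace.single l 1)) (a b c : EuclideanSpace ℝ (Fin n)) : A a b c = B a b c := by
  have ext1 : ∀ f g : EuclideanSpace ℝ (Fin n) → F, IsLinearMap ℝ f → IsLinearMap ℝ g →
      (∀ i, f (EuclideanSpace.single i 1) = g (EuclideanSpace.single i 1)) → ∀ a, f a = g a := by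
    intro f g hf hg hfg a
    have : hf.mk' f = hg.mk' g := by
      refine (EuclideanSpace.basisFun (Fin n) ℝ).toBasis.ext fun i => ?_
      simpa using hfg i
    exact congrArg (fun L => L a) this
  refine ext1 _ _ (hA1 b c) (hB1 b c) (fun i => ?_) a
  refine ext1 _ _ (hA2 _ c) (hB2 _ c) (fun j => ?_) b
  exact ext1 _ _ (hA3 _ _) (hB3 _ _) (fun l => h i j l) c

/-- Both sides are trilinear, so basis vectors suffice. There the contraction with `G` undoes the
factor `G⁻¹` in the Christoffel symbols. -/
theorem IsMetricOn.isChristoffelAt (h : IsMetricOn G S) (hS : IsOpen S)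
    {z : EuclideanSpace ℝ (Fin n)} (hz : z ∈ S) :
    IsChristoffelAt (fun z => matForm (G z)) (chrMap G z) z := by
  intro a b c
  refine trilinear_eq_of_single (n := n) (F := ℝ)
    (A := fun a b c => 2 * matForm (G z) (chrMap G z a b) c)
    (B := fun a b c => fderiv ℝ (fun z => matForm (G z)) z a b c
      + fderiv ℝ (fun z => matForm (G z)) z b a c - fderiv ℝ (fun z => matForm (G z)) z c a b)
    ?_ ?_ ?_ ?_ ?_ ?_ ?_ a b c
  rotate_right
  · intro i j l
    simp only [h.fderiv_matForm_single hS hz, matForm_apply]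
    simp only [chrMap, vecForm_single, PiLp.single_apply, mul_ite, mul_one, mul_zero,
      Finset.sum_ite_eq', Finset.mem_univ, if_true, chr]
    have h1 : ∀ t : Fin n → ℝ, ∑ k, G z k l * ((1 / 2 : ℝ) * ∑ m, (G z)⁻¹ k m * t m) =
        (1 / 2 : ℝ) * t l := by
      intro t
      simp only [Finset.mul_sum]
      rw [Finset.sum_comm]
      have h2 : ∀ m, ∑ k, G z k l * (G z)⁻¹ k m = if l = m then 1 else 0 := by
        intro m
        have := congrFun (congrFun (h.mul_inv hz) l) m
        rw [Matrix.mul_apply, Matrix.one_apply] at this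
        rw [← this]
        exact Finset.sum_congr rfl fun k _ => by rw [h.symm z hz]
      calc ∑ m, ∑ k, G z k l * ((1 / 2 : ℝ) * ((G z)⁻¹ k m * t m))
          = ∑ m, (1 / 2 : ℝ) * t m * ∑ k, G z k l * (G z)⁻¹ k m := by
            refine Finset.sum_congr rfl fun m _ => ?_
            rw [Finset.mul_sum]
            exact Finset.sum_congr rfl fun k _ => by ring
        _ = _ := by simp [h2]
    rw [h1]
    ring
  all_goals
    intro x y
    constructor <;> intros <;>
      simp only [ContinuousLinearMap.map_add, ContinuousLinearMap.map_smul, _root_.add_apply,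
        _root_.smul_apply, smul_eq_mul] <;> ring

theorem chr_comm (hG : IsMetricOn G S) (hS : IsOpen S) {z : EuclideanSpace ℝ (Fin n)} (hz : z ∈ S)
    (k i j : Fin n) : chr G k i j z = chr G k j i z := by
  have h1 := (hG.isChristoffelAt hS hz).symm
    ((hG.smooth_matForm.contDiffAt (hS.mem_nhds hz)).differentiableAt (by simp))
    (by filter_upwards [hS.mem_nhds hz] with x hx using matForm_comm (hG.symm x hx))
    (hG.nondegenerate hz) (EuclideanSpace.single i 1) (EuclideanSpace.single j 1)
  have h2 := congrArg (fun v : EuclideanSpace ℝ (Fin n) => v k) h1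
  simpa [chrMap, vecForm_single] using h2

theorem trace_eq_sum_apply_single (L : EuclideanSpace ℝ (Fin n) →ₗ[ℝ] EuclideanSpace ℝ (Fin n)) :
    LinearMap.trace ℝ _ L = ∑ k, L (EuclideanSpace.single k 1) k := by
  rw [LinearMap.trace_eq_matrix_trace ℝ (EuclideanSpace.basisFun (Fin n) ℝ).toBasis, Matrix.trace]
  refine Finset.sum_congr rfl fun k _ => ?_
  simp [LinearMap.toMatrix_apply]

theorem IsMetricOn.fderiv_chrMap_single (h : IsMetricOn G S) (hS : IsOpen S)
    {z : EuclideanSpace ℝ (Fin n)} (hz : z ∈ S) (d i j k : Fin n) :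
    fderiv ℝ (chrMap G) z (EuclideanSpace.single d 1) (EuclideanSpace.single i 1)
      (EuclideanSpace.single j 1) k = partialD d (chr G k i j) z := by
  have hd : HasFDerivAt (chrMap G) (fderiv ℝ (chrMap G) z) z :=
    (((h.smooth_chrMap hS).contDiffAt (hS.mem_nhds hz)).differentiableAt (by simp)).hasFDerivAt
  have h1 := (hd.clm_apply (hasFDerivAt_const (EuclideanSpace.single i (1 : ℝ)) z)).clm_apply
    (hasFDerivAt_const (EuclideanSpace.single j (1 : ℝ)) z)
  have h2 := (EuclideanSpace.proj (𝕜 := ℝ) k).hasFDerivAt.comp z h1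
  have h3 : (fun z => chr G k i j z) = (EuclideanSpace.proj (𝕜 := ℝ) k) ∘ fun z =>
      chrMap G z (EuclideanSpace.single i 1) (EuclideanSpace.single j 1) := by
    funext z
    simp [chrMap, vecForm_single]
  rw [partialD]
  change _ = fderiv ℝ (fun z => chr G k i j z) z _
  rw [h3, h2.fderiv]
  simp

/-- The arguments are swapped on purpose: the first slot of `ricciForm` is the one antisymmetrized
with the traced vector, which is the role of j in the index formula. Symmetry of Γ in its lower
indices does the rest. -/
theorem IsMetricOn.ricciForm_single (h : IsMetricOn G S) (hS : IsOpen S)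
    {z : EuclideanSpace ℝ (Fin n)} (hz : z ∈ S) (i j : Fin n) :
    ricciForm (chrMap G) z (EuclideanSpace.single j 1) (EuclideanSpace.single i 1) =
      ricciMat G z i j := by
  have hcomp : ∀ (a : EuclideanSpace ℝ (Fin n)) (d k : Fin n),
      chrMap G z (EuclideanSpace.single d 1) a k = ∑ l, chr G k d l z * a l := by
    intro a d k
    rw [chrMap, vecForm_apply, Finset.sum_eq_single d]
    · simp
    · intro b _ hb
      simp [hb]
    · simp
  have hev : ∀ k i j, chr G k i j =ᶠ[𝓝 z] chr G k j i := fun k i j => by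
    filter_upwards [hS.mem_nhds hz] with x hx using chr_comm h hS hx k i j
  have hpd : ∀ d k i j, partialD d (chr G k i j) z = partialD d (chr G k j i) z := fun d k i j => by
    rw [partialD, partialD, (hev k i j).fderiv_eq]
  rw [ricciForm, trace_eq_sum_apply_single, ricciMat, ← Finset.sum_add_distrib]
  refine Finset.sum_congr rfl fun k _ => ?_
  simp only [curvature_apply, PiLp.add_apply, PiLp.sub_apply, h.fderiv_chrMap_single hS hz]
  simp only [hcomp, PiLp.single_apply, mul_ite, mul_one, mul_zero, Finset.sum_ite_eq',
    Finset.mem_univ, if_true]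
  rw [hpd k k j i, hpd j k k i, Finset.sum_sub_distrib]
  have e1 : ∀ l, chr G l j i z = chr G l i j z := fun l => chr_comm h hS hz l j i
  have e2 : ∀ l, chr G l k i z = chr G l i k z := fun l => chr_comm h hS hz l k i
  simp only [e1, e2]
  ring

theorem IsMetricOn.sum_ricciMat (h : IsMetricOn G S) (hS : IsOpen S)
    {z : EuclideanSpace ℝ (Fin n)} (hz : z ∈ S) (a : EuclideanSpace ℝ (Fin n)) :
    ∑ i, ∑ j, ricciMat G z i j * a i * a j = ricciForm (chrMap G) z a a := by
  let B : EuclideanSpace ℝ (Fin n) → EuclideanSpace ℝ (Fin n) → ℝ := ricciForm (chrMap G) z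
  have hadd1 : ∀ a a' b, B (a + a') b = B a b + B a' b := by
    intro a a' b
    simp only [B, ricciForm, ← map_add]
    congr 1
    ext1 d
    simp only [curvature_apply, ContinuousLinearMap.map_add, _root_.add_apply, LinearMap.add_apply]
    abel
  have hsmul1 : ∀ (c : ℝ) a b, B (c • a) b = c * B a b := by
    intro c a b
    simp only [B, ricciForm, ← smul_eq_mul, ← map_smul]
    congr 1
    ext1 d
    simp only [curvature_apply, ContinuousLinearMap.map_smul, _root_.smul_apply,
      LinearMap.smul_apply]
    module
  have hadd2 : ∀ a b b', B a (b + b') = B a b + B a b' := by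
    intro a b b'
    simp only [B, ricciForm, ← map_add]
    congr 1
    ext1 d
    simp only [curvature_apply, ContinuousLinearMap.map_add, LinearMap.add_apply]
    abel
  have hsmul2 : ∀ (c : ℝ) a b, B a (c • b) = c * B a b := by
    intro c a b
    simp only [B, ricciForm, ← smul_eq_mul, ← map_smul]
    congr 1
    ext1 d
    simp only [curvature_apply, ContinuousLinearMap.map_smul, LinearMap.smul_apply]
    module
  let L : EuclideanSpace ℝ (Fin n) →ₗ[ℝ] EuclideanSpace ℝ (Fin n) →ₗ[ℝ] ℝ :=
    LinearMap.mk₂ ℝ B hadd1 hsmul1 hadd2 hsmul2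
  have hL : ricciForm (chrMap G) z a a = L a a := rfl
  rw [hL]
  conv_rhs => rw [eq_sum_single a]
  simp only [map_sum, map_smul, LinearMap.sum_apply, LinearMap.smul_apply, smul_eq_mul]
  have hLs : ∀ i j, L (EuclideanSpace.single i 1) (EuclideanSpace.single j 1) = ricciMat G z j i :=
    fun i j => h.ricciForm_single hS hz j i
  simp only [hLs, Finset.mul_sum]
  refine Finset.sum_congr rfl fun i _ => Finset.sum_congr rfl fun j _ => ?_
  ring

end Coordinates

end ConformalHuber
end

noncomputable section
namespace ConformalHuber

/-! ### Volume density, gradient and coercivity in coordinates. -/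

section Coordinates

set_option synthInstance.maxHeartbeats 400000

variable {n : ℕ} {G : EuclideanSpace ℝ (Fin n) → Matrix (Fin n) (Fin n) ℝ}
  {S : Set (EuclideanSpace ℝ (Fin n))}

/-- Jacobi's formula on a line: det(A + tH) = det A · det(1 + t A⁻¹H), and the last factor is a
polynomial 1 + t tr(A⁻¹H) + O(t²). -/
theorem hasDerivAt_det_add_smul (A H : Matrix (Fin n) (Fin n) ℝ) (hA : A.det ≠ 0) :
    HasDerivAt (fun t : ℝ => (A + t • H).det) (A.det * (A⁻¹ * H).trace) 0 := by
  have h1 : ∀ t : ℝ, (A + t • H).det = A.det * (1 + (A⁻¹ * H).trace * t +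
      (Matrix.det (1 + (Polynomial.X : Polynomial ℝ) •
        (A⁻¹ * H).map Polynomial.C)).divX.divX.eval t * t ^ 2) := by
    intro t
    rw [← Matrix.det_one_add_smul, ← Matrix.det_mul, mul_add, mul_one, Matrix.mul_smul,
      ← mul_assoc, Matrix.mul_nonsing_inv _ hA.isUnit, one_mul]
  simp only [h1]
  set P := (Matrix.det (1 + (Polynomial.X : Polynomial ℝ) •
        (A⁻¹ * H).map Polynomial.C)).divX.divX
  have h2 : HasDerivAt (fun t : ℝ => A.det * (1 + (A⁻¹ * H).trace * t + P.eval t * t ^ 2))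
      (A.det * (((A⁻¹ * H).trace * 1) +
        (P.derivative.eval 0 * 0 ^ 2 + P.eval 0 * (((2 : ℕ) : ℝ) * 0 ^ (2 - 1))))) 0 :=
    ((((hasDerivAt_id (0 : ℝ)).const_mul _).const_add 1).add
      ((P.hasDerivAt 0).mul (hasDerivAt_pow 2 0))).const_mul _
  convert h2 using 1
  simp

/-- The determinant is smooth in the entries, so its derivative in the direction dG is the
derivative along a straight line of matrices. -/
theorem fderiv_det {z : EuclideanSpace ℝ (Fin n)} (hG : ∀ i j, DifferentiableAt ℝ (fun z => G z i j) z)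
    (hdet : (G z).det ≠ 0) (d : EuclideanSpace ℝ (Fin n)) :
    fderiv ℝ (fun z => (G z).det) z d =
      (G z).det * ∑ k, ∑ l, (G z)⁻¹ k l * fderiv ℝ (fun z => G z l k) z d := by
  let D : (Fin n → Fin n → ℝ) → ℝ := fun A => (Matrix.of A).det
  have hD : ContDiff ℝ 1 D := by
    rw [← contDiffOn_univ]
    refine contDiffOn_det (m := 1) (A := fun A : Fin n → Fin n → ℝ => Matrix.of A) fun i j => ?_
    simp only [Matrix.of_apply]
    fun_prop
  have hDz : HasFDerivAt D (fderiv ℝ D (fun i j => G z i j)) (fun i j => G z i j) :=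
    (hD.differentiable (by norm_num) _).hasFDerivAt
  have hGz : HasFDerivAt (fun z => fun i j => G z i j)
      (ContinuousLinearMap.pi fun i => ContinuousLinearMap.pi fun j =>
        fderiv ℝ (fun z => G z i j) z) z :=
    hasFDerivAt_pi.mpr fun i => hasFDerivAt_pi.mpr fun j => (hG i j).hasFDerivAt
  have h1 : HasFDerivAt (fun z => (G z).det) _ z :=
    HasFDerivAt.comp (f := fun z => fun i j => G z i j) (g := D) z hDz hGz
  rw [h1.fderiv]
  set H : Matrix (Fin n) (Fin n) ℝ := Matrix.of fun i j => fderiv ℝ (fun z => G z i j) z d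
  have hline : HasDerivAt (fun t : ℝ => D ((fun i j => G z i j) + t • fun i j => H i j))
      (fderiv ℝ D (fun i j => G z i j) fun i j => H i j) 0 := by
    have h2 : HasDerivAt (fun t : ℝ => (fun i j => G z i j) + t • fun i j => H i j)
        (fun i j => H i j) 0 := by
      simpa using ((hasDerivAt_id (0 : ℝ)).smul_const (fun i j => H i j)).const_add
        (fun i j => G z i j)
    have h3 : HasFDerivAt D (fderiv ℝ D (fun i j => G z i j))
        ((fun i j => G z i j) + (0 : ℝ) • fun i j => H i j) := by simpa using hDz
    exact h3.comp_hasDerivAt 0 h2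
  have h4 := hline.unique (hasDerivAt_det_add_smul (G z) H hdet)
  refine Eq.trans ?_ (h4.trans ?_)
  · rfl
  · rfl

/-- This is ∂ᵢ log √det g = Γᵏᵢₖ. In the trace of Γ the last two derivative terms cancel, since they
are exchanged by the symmetry of `G⁻¹`, and Jacobi's formula identifies the remaining one. It makes
√det g admissible as the density σ of the divergence identity. -/
theorem IsMetricOn.fderiv_sqrt_det (h : IsMetricOn G S) (hS : IsOpen S)
    {z : EuclideanSpace ℝ (Fin n)} (hz : z ∈ S) (d : EuclideanSpace ℝ (Fin n)) :
    fderiv ℝ (fun z => √(G z).det) z d =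
      √(G z).det * LinearMap.trace ℝ (EuclideanSpace ℝ (Fin n)) (chrMap G z d) := by
  have hd : ∀ i j, DifferentiableAt ℝ (fun z => G z i j) z := fun i j =>
    ((h.smooth i j).contDiffAt (hS.mem_nhds hz)).differentiableAt (by simp)
  have hpos := h.det_pos hz
  have hdet : DifferentiableAt ℝ (fun z => (G z).det) z :=
    ((contDiffOn_det h.smooth).contDiffAt (hS.mem_nhds hz)).differentiableAt (by simp)
  have h1 := hdet.hasFDerivAt.sqrt hpos.ne'
  have htr : LinearMap.trace ℝ (EuclideanSpace ℝ (Fin n)) (chrMap G z d) =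
      1 / 2 * ∑ k, ∑ l, (G z)⁻¹ k l * fderiv ℝ (fun z => G z l k) z d := by
    have hlin : ∀ k l, fderiv ℝ (fun z => G z l k) z d =
        ∑ i, d i * partialD i (fun z => G z l k) z := by
      intro k l
      conv_lhs => rw [eq_sum_single d]
      simp [partialD]
    have h2 : ∀ i, ∑ k, chr G k i k z =
        1 / 2 * ∑ k, ∑ l, (G z)⁻¹ k l * partialD i (fun z => G z l k) z := by
      intro i
      simp only [chr, ← Finset.mul_sum]
      congr 1
      have hsy : ∀ a b c, partialD a (fun z => G z b c) z = partialD a (fun z => G z c b) z := by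
        intro a b c
        have : (fun z => G z b c) =ᶠ[𝓝 z] fun z => G z c b := by
          filter_upwards [hS.mem_nhds hz] with x hx using h.symm x hx b c
        rw [partialD, partialD, this.fderiv_eq]
      have hanti : ∑ k, ∑ l, (G z)⁻¹ k l * partialD k (fun z => G z i l) z =
          ∑ k, ∑ l, (G z)⁻¹ k l * partialD l (fun z => G z i k) z := by
        rw [Finset.sum_comm]
        refine Finset.sum_congr rfl fun k _ => Finset.sum_congr rfl fun l _ => ?_
        rw [h.inv_symm hz]
      simp only [mul_sub, mul_add, Finset.sum_sub_distrib, Finset.sum_add_distrib]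
      rw [hanti, add_sub_cancel_right]
      exact Finset.sum_congr rfl fun k _ => Finset.sum_congr rfl fun l _ => by rw [hsy]
    rw [trace_eq_sum_apply_single]
    simp only [ContinuousLinearMap.coe_coe, chrMap, vecForm_apply, PiLp.single_apply, mul_ite,
      mul_one, mul_zero, Finset.sum_ite_eq', Finset.mem_univ, if_true]
    rw [Finset.sum_comm]
    have h3 : ∀ i, ∑ k, chr G k i k z * d i =
        ∑ k, ∑ l, 1 / 2 * ((G z)⁻¹ k l * (d i * partialD i (fun z => G z l k) z)) := by
      intro i
      rw [← Finset.sum_mul, h2, Finset.mul_sum, Finset.sum_mul]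
      refine Finset.sum_congr rfl fun k _ => ?_
      rw [Finset.mul_sum, Finset.sum_mul]
      exact Finset.sum_congr rfl fun l _ => by ring
    simp only [h3, hlin, Finset.mul_sum]
    rw [Finset.sum_comm]
    exact Finset.sum_congr rfl fun k _ => Finset.sum_comm
  rw [h1.fderiv, htr]
  simp only [_root_.smul_apply, smul_eq_mul, fderiv_det hd hpos.ne']
  set T := ∑ k, ∑ l, (G z)⁻¹ k l * fderiv ℝ (fun z => G z l k) z d
  have hs : √(G z).det ≠ 0 := (Real.sqrt_pos.mpr hpos).ne'
  have hs2 : (G z).det = √(G z).det * √(G z).det := (Real.mul_self_sqrt hpos.le).symm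
  field_simp
  rw [sq, ← hs2]

/-- The gradient of a function for a matrix-valued metric. -/
def gradVec (G : EuclideanSpace ℝ (Fin n) → Matrix (Fin n) (Fin n) ℝ)
    (f : EuclideanSpace ℝ (Fin n) → ℝ) (z : EuclideanSpace ℝ (Fin n)) :
    EuclideanSpace ℝ (Fin n) :=
  WithLp.toLp 2 fun i => ∑ j, (G z)⁻¹ i j * partialD j f z

theorem fderiv_eq_sum_partialD (f : EuclideanSpace ℝ (Fin n) → ℝ) (z c : EuclideanSpace ℝ (Fin n)) :
    fderiv ℝ f z c = ∑ i, c i * partialD i f z := by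
  conv_lhs => rw [eq_sum_single c]
  simp [partialD]

theorem IsMetricOn.matForm_gradVec (h : IsMetricOn G S) {z : EuclideanSpace ℝ (Fin n)} (hz : z ∈ S)
    (f : EuclideanSpace ℝ (Fin n) → ℝ) (c : EuclideanSpace ℝ (Fin n)) :
    matForm (G z) (gradVec G f z) c = fderiv ℝ f z c := by
  rw [fderiv_eq_sum_partialD, matForm_apply, Finset.sum_comm]
  refine Finset.sum_congr rfl fun j _ => ?_
  simp only [gradVec, Finset.mul_sum, Finset.sum_mul]
  rw [Finset.sum_comm]
  have h2 : ∀ m, ∑ k, G z k j * (G z)⁻¹ k m = if j = m then 1 else 0 := by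
    intro m
    have := congrFun (congrFun (h.mul_inv hz) j) m
    rw [Matrix.mul_apply, Matrix.one_apply] at this
    rw [← this]
    exact Finset.sum_congr rfl fun k _ => by rw [h.symm z hz]
  calc ∑ m, ∑ k, G z k j * ((G z)⁻¹ k m * partialD m f z) * c j
      = ∑ m, c j * partialD m f z * ∑ k, G z k j * (G z)⁻¹ k m := by
        refine Finset.sum_congr rfl fun m _ => ?_
        rw [Finset.mul_sum]
        exact Finset.sum_congr rfl fun k _ => by ring
    _ = _ := by simp [h2]

theorem fderiv_gradVec_eq_sum (G : EuclideanSpace ℝ (Fin n) → Matrix (Fin n) (Fin n) ℝ)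
    (f w : EuclideanSpace ℝ (Fin n) → ℝ) (z : EuclideanSpace ℝ (Fin n)) :
    fderiv ℝ w z (gradVec G f z) = ∑ i, ∑ j, (G z)⁻¹ i j * partialD i w z * partialD j f z := by
  rw [fderiv_eq_sum_partialD]
  simp only [gradVec, Finset.sum_mul]
  exact Finset.sum_congr rfl fun i _ => Finset.sum_congr rfl fun j _ => by ring

theorem IsMetricOn.smooth_gradVec (h : IsMetricOn G S) (hS : IsOpen S)
    {f : EuclideanSpace ℝ (Fin n) → ℝ} (hf : ContDiffOn ℝ ∞ f S) :
    ContDiffOn ℝ ∞ (gradVec G f) S := by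
  rw [contDiffOn_euclidean]
  intro i
  simp only [gradVec]
  exact ContDiffOn.sum fun j _ => (h.smooth_inv i j).mul (contDiffOn_partialD hS hf j)

/-- The minimum m of the form at y over the unit sphere is positive, and m/2 remains a lower bound
as long as the form moves by less than m/2 in norm. -/
theorem IsMetricOn.coercive (h : IsMetricOn G S) (hS : IsOpen S) {y : EuclideanSpace ℝ (Fin n)}
    (hy : y ∈ S) : ∃ c > 0, ∀ᶠ z in 𝓝 y, ∀ a, c * ‖a‖ ^ 2 ≤ matForm (G z) a a := by
  have hc : ContinuousAt (fun z => matForm (G z)) y :=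
    h.smooth_matForm.continuousOn.continuousAt (hS.mem_nhds hy)
  obtain ⟨m, hm, hmb⟩ : ∃ m > 0, ∀ a : EuclideanSpace ℝ (Fin n), m * ‖a‖ ^ 2 ≤ matForm (G y) a a := by
    -- The sphere is empty when n = 0.
    rcases (Metric.sphere (0 : EuclideanSpace ℝ (Fin n)) 1).eq_empty_or_nonempty with he | hne
    · refine ⟨1, one_pos, fun a => ?_⟩
      by_cases ha : a = 0
      · simp [ha]
      · exfalso
        have : (‖a‖⁻¹ • a) ∈ Metric.sphere (0 : EuclideanSpace ℝ (Fin n)) 1 := by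
          rw [mem_sphere_zero_iff_norm, norm_smul, norm_inv, norm_norm,
            inv_mul_cancel₀ (norm_ne_zero_iff.mpr ha)]
        rw [he] at this
        exact this
    · obtain ⟨a₀, ha₀, hmin⟩ := (isCompact_sphere (0 : EuclideanSpace ℝ (Fin n)) 1).exists_isMinOn
        hne (f := fun a => matForm (G y) a a)
        (((matForm (G y)).continuous.clm_apply continuous_id).continuousOn)
      have ha₀' : a₀ ≠ 0 := by
        rintro rfl
        simp at ha₀
      refine ⟨matForm (G y) a₀ a₀, h.pos y hy a₀ ha₀', fun a => ?_⟩
      by_cases ha : a = 0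
      · simp [ha]
      · have hn := norm_ne_zero_iff.mpr ha
        have hmem : (‖a‖⁻¹ • a) ∈ Metric.sphere (0 : EuclideanSpace ℝ (Fin n)) 1 := by
          rw [mem_sphere_zero_iff_norm, norm_smul, norm_inv, norm_norm, inv_mul_cancel₀ hn]
        have h1 := hmin hmem
        simp only [mem_ofPred_eq, ContinuousLinearMap.map_smul, _root_.smul_apply, smul_eq_mul] at h1
        have h2 : matForm (G y) a a = ‖a‖ ^ 2 * (‖a‖⁻¹ * (‖a‖⁻¹ * matForm (G y) a a)) := by
          field_simp
        rw [h2, mul_comm]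
        gcongr
  refine ⟨m / 2, by positivity, ?_⟩
  have hev : ∀ᶠ z in 𝓝 y, ‖matForm (G z) - matForm (G y)‖ < m / 2 := by
    have h1 : Tendsto (fun z => ‖matForm (G z) - matForm (G y)‖) (𝓝 y) (𝓝 0) := by
      have := (hc.sub (continuousAt_const (y := matForm (G y)))).norm.tendsto
      simpa using this
    exact h1.eventually (gt_mem_nhds (by positivity))
  filter_upwards [hev] with z hz a
  have h1 : |(matForm (G z) - matForm (G y)) a a| ≤ ‖matForm (G z) - matForm (G y)‖ * ‖a‖ * ‖a‖ := by
    rw [← Real.norm_eq_abs]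
    exact ContinuousLinearMap.le_opNorm₂ _ _ _
  have h2 := (abs_le.mp h1).1
  simp only [_root_.sub_apply] at h2
  have h3 := hmb a
  have h4 : ‖matForm (G z) - matForm (G y)‖ * ‖a‖ * ‖a‖ ≤ m / 2 * ‖a‖ * ‖a‖ := by gcongr
  nlinarith

theorem IsMetricOn.conformal (h : IsMetricOn G S) {f : EuclideanSpace ℝ (Fin n) → ℝ}
    (hf : ContDiffOn ℝ ∞ f S) : IsMetricOn (fun z => Real.exp (2 * f z) • G z) S where
  smooth i j := by
    simp only [Matrix.smul_apply, smul_eq_mul]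
    exact ((contDiffOn_const.mul hf).exp).mul (h.smooth i j)
  symm z hz i j := by simp [h.symm z hz i j]
  pos z hz a ha := by
    rw [matForm_smul]
    exact mul_pos (Real.exp_pos _) (h.pos z hz a ha)

theorem IsMetricOn.ricciForm_pullback {G' : EuclideanSpace ℝ (Fin n) → Matrix (Fin n) (Fin n) ℝ}
    {S' : Set (EuclideanSpace ℝ (Fin n))} (h : IsMetricOn G S) (hS : IsOpen S)
    (h' : IsMetricOn G' S') (hS' : IsOpen S')
    {φ : EuclideanSpace ℝ (Fin n) → EuclideanSpace ℝ (Fin n)} (hφ : ContDiffOn ℝ ∞ φ S')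
    (hm : MapsTo φ S' S) (hb : ∀ z ∈ S', Function.Bijective (fderiv ℝ φ z))
    (hG : ∀ z ∈ S', ∀ b c, matForm (G' z) b c =
      matForm (G (φ z)) (fderiv ℝ φ z b) (fderiv ℝ φ z c))
    {y : EuclideanSpace ℝ (Fin n)} (hy : y ∈ S') (a b : EuclideanSpace ℝ (Fin n)) :
    ricciForm (chrMap G') y a b =
      ricciForm (chrMap G) (φ y) (fderiv ℝ φ y a) (fderiv ℝ φ y b) := by
  have hn : ∀ z ∈ S', S' ∈ 𝓝 z := fun z hz => hS'.mem_nhds hz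
  refine ConformalHuber.ricciForm_pullback ((hφ.contDiffAt (hn y hy)).of_le ENat.LEInfty.out)
    (((h.smooth_chrMap hS).contDiffAt (hS.mem_nhds (hm hy))).differentiableAt (by simp))
    (((h'.smooth_chrMap hS').contDiffAt (hn y hy)).differentiableAt (by simp)) ?_ (hb y hy) a b
  filter_upwards [hn y hy] with z hz
  refine IsChristoffelAt.pullback (g := fun z => matForm (G z)) (g' := fun z => matForm (G' z))
    ((hφ.contDiffAt (hn z hz)).of_le ENat.LEInfty.out)
    ((h.smooth_matForm.contDiffAt (hS.mem_nhds (hm hz))).differentiableAt (by simp)) ?_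
    ((h'.smooth_matForm.contDiffAt (hn z hz)).differentiableAt (by simp))
    (matForm_comm (h.symm _ (hm hz))) (h.nondegenerate (hm hz)) (hb z hz).2
    (h.isChristoffelAt hS (hm hz)) (h'.isChristoffelAt hS' hz)
  filter_upwards [hn z hz] with x hx using hG x hx

/-- The weak form of the conformal change of the Ricci curvature in coordinates. -/
theorem IsMetricOn.integral_conformal_ricci (hn : 3 ≤ n) (h : IsMetricOn G S) (hS : IsOpen S)
    {f w : EuclideanSpace ℝ (Fin n) → ℝ} (hf : ContDiffOn ℝ ∞ f S)
    (hw : ContDiff ℝ 1 w) (hwc : HasCompactSupport w) (hwS : tsupport w ⊆ S) :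
    Integrable (fun z => √(G z).det * fderiv ℝ f z (gradVec G f z) ^ (((n : ℝ) - 2) / 2) *
        fderiv ℝ w z (gradVec G f z)) ∧
    Integrable (fun z => √(G z).det * w z *
      fderiv ℝ f z (gradVec G f z) ^ (((n : ℝ) - 2) / 2 - 1) *
        (ricciForm (chrMap fun z => Real.exp (2 * f z) • G z) z (gradVec G f z) (gradVec G f z)
          - ricciForm (chrMap G) z (gradVec G f z) (gradVec G f z))) ∧
    ∫ z, √(G z).det * fderiv ℝ f z (gradVec G f z) ^ (((n : ℝ) - 2) / 2) *
        fderiv ℝ w z (gradVec G f z) =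
      ∫ z, √(G z).det * w z * fderiv ℝ f z (gradVec G f z) ^ (((n : ℝ) - 2) / 2 - 1) *
        (ricciForm (chrMap fun z => Real.exp (2 * f z) • G z) z (gradVec G f z) (gradVec G f z)
          - ricciForm (chrMap G) z (gradVec G f z) (gradVec G f z)) := by
  have h' := h.conformal hf
  have hrank : Module.finrank ℝ (EuclideanSpace ℝ (Fin n)) = n := finrank_euclideanSpace_fin
  have key := ConformalHuber.integral_conformal_ricci (volume : Measure (EuclideanSpace ℝ (Fin n)))
    (by rw [hrank]; exact hn) hS (g := fun z => matForm (G z))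
    (g' := fun z => matForm (Real.exp (2 * f z) • G z)) (u := f) (σ := fun z => √(G z).det) (w := w)
    (U := gradVec G f) (Γ := chrMap G) (Γ' := chrMap fun z => Real.exp (2 * f z) • G z)
    (h.smooth_matForm.of_le ENat.LEInfty.out) (hf.of_le ENat.LEInfty.out)
    (fun z _ => matForm_smul _ _) (fun z hz => matForm_comm (h.symm z hz))
    (fun y hy => h.coercive hS hy) (fun z hz => h.matForm_gradVec hz f)
    ((h.smooth_gradVec hS hf).of_le ENat.LEInfty.out)
    (fun z hz => ((h.smooth_chrMap hS).contDiffAt (hS.mem_nhds hz)).differentiableAt (by simp))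
    (fun z hz => ((h'.smooth_chrMap hS).contDiffAt (hS.mem_nhds hz)).differentiableAt (by simp))
    (fun z hz => h.isChristoffelAt hS hz) (fun z hz => h'.isChristoffelAt hS hz)
    (((contDiffOn_det h.smooth).sqrt fun z hz => (h.det_pos hz).ne').of_le
      ENat.LEInfty.out)
    (fun z hz d => h.fderiv_sqrt_det hS hz d) hw hwc hwS
  rw [hrank] at key
  -- The expressions g(∇f, ∇f) and df(∇f) are identified on S only. Off the support of w both
  -- integrands vanish.
  have hq : ∀ z ∈ S, matForm (G z) (gradVec G f z) (gradVec G f z) =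
      fderiv ℝ f z (gradVec G f z) := fun z hz => h.matForm_gradVec hz f _
  have e1 : (fun z => √(G z).det * matForm (G z) (gradVec G f z) (gradVec G f z) ^
      (((n : ℝ) - 2) / 2) * fderiv ℝ w z (gradVec G f z)) =
      fun z => √(G z).det * fderiv ℝ f z (gradVec G f z) ^ (((n : ℝ) - 2) / 2) *
        fderiv ℝ w z (gradVec G f z) := by
    funext z
    by_cases hz : z ∈ tsupport w
    · rw [hq z (hwS hz)]
    · rw [fderiv_of_notMem_tsupport ℝ hz]; simp
  have e2 : (fun z => √(G z).det * w z * matForm (G z) (gradVec G f z) (gradVec G f z) ^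
        (((n : ℝ) - 2) / 2 - 1) *
        (ricciForm (chrMap fun z => Real.exp (2 * f z) • G z) z (gradVec G f z) (gradVec G f z)
          - ricciForm (chrMap G) z (gradVec G f z) (gradVec G f z))) =
      fun z => √(G z).det * w z * fderiv ℝ f z (gradVec G f z) ^ (((n : ℝ) - 2) / 2 - 1) *
        (ricciForm (chrMap fun z => Real.exp (2 * f z) • G z) z (gradVec G f z) (gradVec G f z)
          - ricciForm (chrMap G) z (gradVec G f z) (gradVec G f z)) := by
    funext z
    by_cases hz : z ∈ tsupport w
    · rw [hq z (hwS hz)]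
    · rw [image_eq_zero_of_notMem_tsupport hz]; simp
  rw [e1, e2] at key
  exact key

end Coordinates

end ConformalHuber
end

noncomputable section
namespace ConformalHuber

/-! ### Transition maps and the metric in the preferred charts. -/

section Charts

variable {n : ℕ} {M : Type*} [TopologicalSpace M] [ChartedSpace (EuclideanSpace ℝ (Fin n)) M]

/-- The transition map from the preferred chart at `x'` to the one at `x`. -/
def transition (x' x : M) (y : EuclideanSpace ℝ (Fin n)) : EuclideanSpace ℝ (Fin n) :=
  extChartAt (𝓡 n) x ((extChartAt (𝓡 n) x').symm y)

/-- The part of the target of the preferred chart at `x` that lies over `U`. -/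
def chartDomain (x : M) (U : Set M) : Set (EuclideanSpace ℝ (Fin n)) :=
  (extChartAt (𝓡 n) x).target ∩ (extChartAt (𝓡 n) x).symm ⁻¹' U

theorem isOpen_chartDomain (x : M) {U : Set M} (hU : IsOpen U) :
    IsOpen (chartDomain (n := n) x U) :=
  (continuousOn_extChartAt_symm x).isOpen_inter_preimage (isOpen_extChartAt_target x) hU

theorem transition_mem {x' x : M} {y : EuclideanSpace ℝ (Fin n)}
    (hy : y ∈ chartDomain (n := n) x' (extChartAt (𝓡 n) x).source) :
    transition x' x y ∈ chartDomain (n := n) x (extChartAt (𝓡 n) x').source := by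
  refine ⟨(extChartAt (𝓡 n) x).map_source hy.2, ?_⟩
  rw [mem_preimage, transition, (extChartAt (𝓡 n) x).left_inv hy.2]
  exact (extChartAt (𝓡 n) x').map_target hy.1

theorem symm_transition {x' x : M} {y : EuclideanSpace ℝ (Fin n)}
    (hy : y ∈ chartDomain (n := n) x' (extChartAt (𝓡 n) x).source) :
    (extChartAt (𝓡 n) x).symm (transition x' x y) = (extChartAt (𝓡 n) x').symm y :=
  (extChartAt (𝓡 n) x).left_inv hy.2

theorem transition_transition {x' x : M} {y : EuclideanSpace ℝ (Fin n)}
    (hy : y ∈ chartDomain (n := n) x' (extChartAt (𝓡 n) x).source) :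
    transition x x' (transition x' x y) = y := by
  rw [transition, symm_transition hy, (extChartAt (𝓡 n) x').right_inv hy.1]

/-- All tangent spaces are by definition the same ℝⁿ, so vectors pass along an equality of base
points without a cast. -/
theorem baseMetric_congr [RiemannianBundle (fun x : M => TangentSpace (𝓡 n) x)] {p p' : M}
    (h : p = p') (v w : EuclideanSpace ℝ (Fin n)) :
    baseMetric n M p v w = baseMetric n M p' v w := by subst h; rfl

variable [IsManifold (𝓡 n) ∞ M]

theorem contDiffOn_transition (x' x : M) :
    ContDiffOn ℝ ∞ (transition x' x) (chartDomain (n := n) x' (extChartAt (𝓡 n) x).source) := by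
  have h := contDiffOn_ext_coord_change (I := 𝓡 n) (n := ∞) x x'
  refine h.mono ?_
  intro y hy
  exact hy

theorem differentiableAt_transition {x' x : M} {y : EuclideanSpace ℝ (Fin n)}
    (hy : y ∈ chartDomain (n := n) x' (extChartAt (𝓡 n) x).source) :
    DifferentiableAt ℝ (transition x' x) y :=
  ((contDiffOn_transition x' x).contDiffAt ((isOpen_chartDomain x'
    (isOpen_extChartAt_source x)).mem_nhds hy)).differentiableAt (by simp)

theorem fderiv_transition_comp {x' x : M} {y : EuclideanSpace ℝ (Fin n)}
    (hy : y ∈ chartDomain (n := n) x' (extChartAt (𝓡 n) x).source) (v : EuclideanSpace ℝ (Fin n)) :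
    fderiv ℝ (transition x x') (transition x' x y) (fderiv ℝ (transition x' x) y v) = v := by
  have h1 := (differentiableAt_transition (transition_mem hy)).hasFDerivAt.comp y
    (differentiableAt_transition hy).hasFDerivAt
  have h2 : HasFDerivAt (transition x x' ∘ transition x' x) (ContinuousLinearMap.id ℝ _) y := by
    refine (hasFDerivAt_id y).congr_of_eventuallyEq ?_
    filter_upwards [(isOpen_chartDomain x' (isOpen_extChartAt_source x)).mem_nhds hy] with z hz
    exact transition_transition hz
  exact congrArg (fun L => L v) (h1.unique h2)

theorem bijective_fderiv_transition {x' x : M} {y : EuclideanSpace ℝ (Fin n)}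
    (hy : y ∈ chartDomain (n := n) x' (extChartAt (𝓡 n) x).source) :
    Function.Bijective (fderiv ℝ (transition x' x) y) := by
  refine ⟨Function.LeftInverse.injective (fderiv_transition_comp hy), fun v => ?_⟩
  have h := fderiv_transition_comp (transition_mem hy) v
  rw [transition_transition hy] at h
  exact ⟨_, h⟩

theorem mdifferentiableAt_extChartAt_symm {x : M} {y : EuclideanSpace ℝ (Fin n)}
    (hy : y ∈ (extChartAt (𝓡 n) x).target) :
    MDifferentiableAt (𝓡 n) (𝓡 n) (extChartAt (𝓡 n) x).symm y :=
  ((contMDiffOn_extChartAt_symm (I := 𝓡 n) (n := ∞) x).contMDiffAt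
    ((isOpen_extChartAt_target x).mem_nhds hy)).mdifferentiableAt (by simp)

/-- The differential of the inverse of the preferred chart at `x`, with the tangent spaces of `M`
identified with `ℝⁿ` by the preferred charts. -/
def chartDeriv (x : M) (y : EuclideanSpace ℝ (Fin n)) :
    EuclideanSpace ℝ (Fin n) →L[ℝ] EuclideanSpace ℝ (Fin n) :=
  mfderiv (𝓡 n) (𝓡 n) (extChartAt (𝓡 n) x).symm y

theorem chartDeriv_transition {x' x : M} {y : EuclideanSpace ℝ (Fin n)}
    (hy : y ∈ chartDomain (n := n) x' (extChartAt (𝓡 n) x).source) (v : EuclideanSpace ℝ (Fin n)) :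
    chartDeriv x' y v = chartDeriv x (transition x' x y) (fderiv ℝ (transition x' x) y v) := by
  have h1 : HasMFDerivAt (𝓡 n) (𝓡 n) (extChartAt (𝓡 n) x).symm (transition x' x y)
      (mfderiv (𝓡 n) (𝓡 n) (extChartAt (𝓡 n) x).symm (transition x' x y)) :=
    (mdifferentiableAt_extChartAt_symm (transition_mem hy).1).hasMFDerivAt
  have h2 : HasMFDerivAt (𝓡 n) (𝓡 n) (transition x' x) y (fderiv ℝ (transition x' x) y) :=
    (differentiableAt_transition hy).hasFDerivAt.hasMFDerivAt
  have h3 := h1.comp y h2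
  have h4 : (extChartAt (𝓡 n) x').symm =ᶠ[𝓝 y] (extChartAt (𝓡 n) x).symm ∘ transition x' x := by
    filter_upwards [(isOpen_chartDomain x' (isOpen_extChartAt_source x)).mem_nhds hy] with z hz
    exact (symm_transition hz).symm
  have h5 := h3.congr_of_eventuallyEq h4
  exact congrArg (fun L : EuclideanSpace ℝ (Fin n) →L[ℝ] EuclideanSpace ℝ (Fin n) => L v) h5.mfderiv

theorem chartDeriv_injective {x : M} {y : EuclideanSpace ℝ (Fin n)}
    (hy : y ∈ (extChartAt (𝓡 n) x).target) : Function.Injective (chartDeriv x y) := by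
  have : IsManifold (𝓡 n) 1 M := IsManifold.of_le (n := ∞) ENat.LEInfty.out
  have h1 : HasMFDerivAt (𝓡 n) (𝓡 n) (extChartAt (𝓡 n) x).symm y
      (mfderiv (𝓡 n) (𝓡 n) (extChartAt (𝓡 n) x).symm y) :=
    (mdifferentiableAt_extChartAt_symm hy).hasMFDerivAt
  have hs : (extChartAt (𝓡 n) x).symm y ∈ (chartAt (EuclideanSpace ℝ (Fin n)) x).source := by
    rw [← extChartAt_source (𝓡 n)]; exact (extChartAt (𝓡 n) x).map_target hy
  have h2 := (mdifferentiableAt_extChartAt (I := 𝓡 n) hs).hasMFDerivAt.comp y h1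
  have h3 : HasMFDerivAt (𝓡 n) (𝓡 n) (extChartAt (𝓡 n) x ∘ (extChartAt (𝓡 n) x).symm) y
      (ContinuousLinearMap.id ℝ _) := by
    refine (hasMFDerivAt_id y).congr_of_eventuallyEq ?_
    filter_upwards [(isOpen_extChartAt_target x).mem_nhds hy] with z hz
    exact (extChartAt (𝓡 n) x).right_inv hz
  have h4 := hasMFDerivAt_unique h2 h3
  intro v w hvw
  have h5 : ∀ v : EuclideanSpace ℝ (Fin n), (mfderiv (𝓡 n) (𝓡 n) (extChartAt (𝓡 n) x)
      ((extChartAt (𝓡 n) x).symm y)) (chartDeriv x y v) = v := fun v =>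
    congrArg (fun L : EuclideanSpace ℝ (Fin n) →L[ℝ] EuclideanSpace ℝ (Fin n) => L v) h4
  rw [← h5 v, ← h5 w, hvw]

variable [RiemannianBundle (fun x : M => TangentSpace (𝓡 n) x)]

theorem matForm_metricMatrix (x : M) (y a b : EuclideanSpace ℝ (Fin n)) :
    matForm (metricMatrix (baseMetric n M) x y) a b =
      baseMetric n M ((extChartAt (𝓡 n) x).symm y) (chartDeriv x y a) (chartDeriv x y b) := by
  have hsum : ∀ a : EuclideanSpace ℝ (Fin n), (chartDeriv x y a : TangentSpace (𝓡 n)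
      ((extChartAt (𝓡 n) x).symm y)) = ∑ i, a i • coordVec x y i := by
    intro a
    have h1 : chartDeriv x y a =
        ∑ i, a i • chartDeriv x y (EuclideanSpace.single i (1 : ℝ)) := by
      conv_lhs => rw [eq_sum_single a]
      rw [map_sum]
      exact Finset.sum_congr rfl fun i _ => ContinuousLinearMap.map_smul _ _ _
    exact h1
  -- The vectors must be typed in the tangent space, where the inner product is the Riemannian one
  -- and not that of ℝⁿ.
  have key : ∀ v w : TangentSpace (𝓡 n) ((extChartAt (𝓡 n) x).symm y),
      v = ∑ i, a i • coordVec x y i → w = ∑ i, b i • coordVec x y i →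
      ∑ i, ∑ j, metricMatrix (baseMetric n M) x y i j * a i * b j =
        baseMetric n M ((extChartAt (𝓡 n) x).symm y) v w := by
    rintro v w rfl rfl
    rw [baseMetric, sum_inner]
    refine Finset.sum_congr rfl fun i _ => ?_
    rw [inner_sum]
    refine Finset.sum_congr rfl fun j _ => ?_
    rw [real_inner_smul_left, real_inner_smul_right]
    simp only [metricMatrix, baseMetric, Matrix.of_apply]
    ring
  rw [matForm_apply]
  exact key _ _ (hsum a) (hsum b)

theorem matForm_metricMatrix_transition {x' x : M} {y : EuclideanSpace ℝ (Fin n)}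
    (hy : y ∈ chartDomain (n := n) x' (extChartAt (𝓡 n) x).source)
    (a b : EuclideanSpace ℝ (Fin n)) :
    matForm (metricMatrix (baseMetric n M) x' y) a b =
      matForm (metricMatrix (baseMetric n M) x (transition x' x y))
        (fderiv ℝ (transition x' x) y a) (fderiv ℝ (transition x' x) y b) := by
  rw [matForm_metricMatrix, matForm_metricMatrix, chartDeriv_transition hy, chartDeriv_transition hy]
  exact baseMetric_congr (symm_transition hy).symm _ _

variable [IsContMDiffRiemannianBundle (𝓡 n) ∞ (EuclideanSpace ℝ (Fin n))
      (fun x : M => TangentSpace (𝓡 n) x)]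

/-- The coordinate fields are smooth sections, being the images of constant fields under the tangent
map of the inverse chart, and the inner product of the bundle is smooth. -/
theorem contDiffOn_metricMatrix (x : M) (i j : Fin n) :
    ContDiffOn ℝ ∞ (fun y => metricMatrix (baseMetric n M) x y i j) (extChartAt (𝓡 n) x).target := by
  rw [← contMDiffOn_iff_contDiffOn]
  have hsec : ∀ i, ContMDiffOn (𝓡 n) (𝓡 n).tangent ∞
      (fun y => (⟨(extChartAt (𝓡 n) x).symm y, coordVec x y i⟩ : TangentBundle (𝓡 n) M))
      (extChartAt (𝓡 n) x).target := by
    intro i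
    have h1 := (contMDiffOn_extChartAt_symm (I := 𝓡 n) (n := ∞) x).contMDiffOn_tangentMapWithin
      (m := ∞) (by simp) (isOpen_extChartAt_target x).uniqueMDiffOn
    have h2 : ContMDiff (𝓡 n) (𝓡 n).tangent ∞ (fun y : EuclideanSpace ℝ (Fin n) =>
        (⟨y, (EuclideanSpace.single i (1 : ℝ) : EuclideanSpace ℝ (Fin n))⟩ :
          TangentBundle (𝓡 n) (EuclideanSpace ℝ (Fin n)))) := by
      exact contMDiff_vectorSpace_iff_contDiff.mpr contDiff_const
    have h3 := h1.comp h2.contMDiffOn (s := (extChartAt (𝓡 n) x).target) (fun y hy => hy)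
    refine h3.congr fun y hy => ?_
    simp only [Function.comp, tangentMapWithin, coordVec]
    rw [mfderivWithin_of_isOpen (isOpen_extChartAt_target x) hy]
  exact ContMDiffOn.inner_bundle (hsec i) (hsec j)

theorem isMetricOn_metricMatrix (x : M) :
    IsMetricOn (metricMatrix (baseMetric n M) x) (extChartAt (𝓡 n) x).target where
  smooth := contDiffOn_metricMatrix x
  symm z _ i j := by
    simp only [metricMatrix, baseMetric, Matrix.of_apply]
    exact real_inner_comm _ _
  pos z hz a ha := by
    rw [matForm_metricMatrix]
    refine real_inner_self_pos.mpr ?_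
    intro h0
    apply ha
    apply chartDeriv_injective hz
    rw [map_zero]
    exact h0

end Charts
end ConformalHuber
end

noncomputable section
namespace ConformalHuber

/-! ### Gluing compatible measures. -/

section Gluing

/-- The supremum of a compatible family of measures restricts to each of its members. -/
theorem iSup_restrict_of_compatible {X ι : Type*} [MeasurableSpace X] (μ : ι → Measure X)
    (s : ι → Set X) (hs : ∀ i, MeasurableSet (s i)) (hsupp : ∀ i, (μ i).restrict (s i) = μ i)
    (hcomp : ∀ i j, (μ i).restrict (s j) = (μ j).restrict (s i)) (t : ℕ → ι)
    (ht : ⋃ k, s (t k) = univ) (i : ι) : (⨆ i, μ i).restrict (s i) = μ i := by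
  -- The space is cut into countably many disjoint pieces, each inside one of the sets. The sum of
  -- the local measures on the pieces is then an upper bound for the whole family, hence for its
  -- supremum, and by compatibility it restricts to `μ i` on `s i`.
  set d := disjointed fun k => s (t k) with hd
  have hdm : ∀ k, MeasurableSet (d k) := fun k => MeasurableSet.disjointed (fun k => hs (t k)) k
  have hdu : ⋃ k, d k = univ := by rw [hd, iUnion_disjointed, ht]
  have hdd : Pairwise (Function.onFun Disjoint d) := disjoint_disjointed _
  have hsub : ∀ k, d k ⊆ s (t k) := fun k => disjointed_subset _ k
  have hsum : ∀ ν : Measure X, Measure.sum (fun k => ν.restrict (d k)) = ν := by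
    intro ν
    rw [← Measure.restrict_iUnion hdd hdm, hdu, Measure.restrict_univ]
  have hrr : ∀ (ν : Measure X) k, (ν.restrict (s (t k))).restrict (d k) = ν.restrict (d k) := by
    intro ν k
    rw [Measure.restrict_restrict (hdm k), inter_eq_left.mpr (hsub k)]
  have hle : ∀ j, μ j ≤ Measure.sum fun k => (μ (t k)).restrict (d k) := by
    intro j
    conv_lhs => rw [← hsum (μ j)]
    refine Measure.le_iff.mpr fun A hA => ?_
    rw [Measure.sum_apply _ hA, Measure.sum_apply _ hA]
    refine ENNReal.tsum_le_tsum fun k => ?_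
    rw [← hrr (μ j) k, hcomp j (t k)]
    exact Measure.restrict_mono (subset_refl _) Measure.restrict_le_self A
  refine le_antisymm ?_ ?_
  · refine (Measure.restrict_mono (subset_refl _) (iSup_le hle)).trans (le_of_eq ?_)
    rw [Measure.restrict_sum _ (hs i)]
    conv_rhs => rw [← hsum (μ i)]
    congr 1
    funext k
    rw [Measure.restrict_comm (hs i), hcomp (t k) i, hrr]
  · conv_lhs => rw [← hsupp i]
    exact Measure.restrict_mono (subset_refl _) (le_iSup μ i)

end Gluing

/-! ### The Riemannian volume restricts to the chart volumes. -/

section Volume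

variable {n : ℕ} {M : Type*} [TopologicalSpace M] [ChartedSpace (EuclideanSpace ℝ (Fin n)) M]
  [MeasurableSpace M] [BorelSpace M]

/-- The volume measure of a metric on the domain of a preferred chart. -/
def chartVolume (g : MetricField n M) (U : Set M) (x : M) : Measure M :=
  Measure.map (extChartAt (𝓡 n) x).symm
    ((volume.restrict (chartDomain x U)).withDensity
      fun y => ENNReal.ofReal (Real.sqrt (metricMatrix g x y).det))

theorem measurableSet_chartDomain (x : M) {A : Set M} (hA : MeasurableSet A) :
    MeasurableSet (chartDomain (n := n) x A) := by
  have hT : MeasurableSet (extChartAt (𝓡 n) x).target := (isOpen_extChartAt_target x).measurableSet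
  have h1 : Measurable ((extChartAt (𝓡 n) x).target.domRestrict (extChartAt (𝓡 n) x).symm) :=
    (continuousOn_extChartAt_symm x).domRestrict.measurable
  have h2 := hT.subtype_image (h1 hA)
  convert h2 using 1
  ext y
  simp only [chartDomain, mem_inter_iff, mem_preimage, mem_image, Subtype.exists,
    domRestrict_apply, exists_and_right, exists_eq_right]
  tauto

theorem aemeasurable_extChartAt_symm (x : M) {A : Set M} (hA : MeasurableSet A) :
    AEMeasurable (extChartAt (𝓡 n) x).symm (volume.restrict (chartDomain (n := n) x A)) :=
  ((continuousOn_extChartAt_symm x).mono inter_subset_left).aemeasurable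
    (measurableSet_chartDomain x hA)

theorem aemeasurable_extChartAt_symm_withDensity (x : M) {A : Set M} (hA : MeasurableSet A)
    (ρ : EuclideanSpace ℝ (Fin n) → ℝ≥0∞) :
    AEMeasurable (extChartAt (𝓡 n) x).symm
      ((volume.restrict (chartDomain (n := n) x A)).withDensity ρ) :=
  (aemeasurable_extChartAt_symm x hA).mono_ac (withDensity_absolutelyContinuous _ _)

theorem chartVolume_apply (g : MetricField n M) {U A : Set M} (hU : MeasurableSet U)
    (hA : MeasurableSet A) (x : M) :
    chartVolume g U x A = ∫⁻ y in chartDomain x (A ∩ U),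
      ENNReal.ofReal (Real.sqrt (metricMatrix g x y).det) := by
  rw [chartVolume, Measure.map_apply_of_aemeasurable
    (aemeasurable_extChartAt_symm_withDensity x hU _) hA, withDensity_apply',
    Measure.restrict_restrict' (measurableSet_chartDomain x hU)]
  congr 2
  ext y
  simp only [chartDomain, mem_inter_iff, mem_preimage]
  tauto

/-- The density of the volume of `g` transforms as it should, over the open set `U`. -/
def HasVolumeDensity (g : MetricField n M) (U : Set M) : Prop :=
  ∀ x' x : M, ∀ y ∈ chartDomain (n := n) x' ((extChartAt (𝓡 n) x).source ∩ U),
    Real.sqrt (metricMatrix g x' y).det =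
      |(fderiv ℝ (transition x' x) y).det| * Real.sqrt (metricMatrix g x (transition x' x y)).det

variable [IsManifold (𝓡 n) ∞ M]

/-- The change of variables formula for the transition map, whose Jacobian is exactly the factor by
which the densities differ. -/
theorem chartVolume_apply_inter {g : MetricField n M} {U A : Set M} (hg : HasVolumeDensity g U)
    (hU : MeasurableSet U) (hA : MeasurableSet A) (x' x : M) :
    chartVolume g U x (A ∩ (extChartAt (𝓡 n) x').source) =
      chartVolume g U x' (A ∩ (extChartAt (𝓡 n) x).source) := by
  have hsx := (isOpen_extChartAt_source (I := 𝓡 n) x).measurableSet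
  have hsx' := (isOpen_extChartAt_source (I := 𝓡 n) x').measurableSet
  rw [chartVolume_apply g hU (hA.inter hsx'), chartVolume_apply g hU (hA.inter hsx)]
  have hsub : chartDomain (n := n) x' (A ∩ (extChartAt (𝓡 n) x).source ∩ U) ⊆
      chartDomain (n := n) x' (extChartAt (𝓡 n) x).source :=
    fun y hy => ⟨hy.1, hy.2.1.2⟩
  have himg : chartDomain (n := n) x (A ∩ (extChartAt (𝓡 n) x').source ∩ U) =
      transition x' x '' chartDomain (n := n) x' (A ∩ (extChartAt (𝓡 n) x).source ∩ U) := by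
    ext y
    constructor
    · intro hy
      have hy' : y ∈ chartDomain (n := n) x (extChartAt (𝓡 n) x').source := ⟨hy.1, hy.2.1.2⟩
      refine ⟨transition x x' y, ?_, transition_transition hy'⟩
      refine ⟨(transition_mem hy').1, ?_⟩
      rw [mem_preimage, symm_transition hy']
      exact ⟨⟨hy.2.1.1, (extChartAt (𝓡 n) x).map_target hy.1⟩, hy.2.2⟩
    · rintro ⟨z, hz, rfl⟩
      have hz' := hsub hz
      refine ⟨(transition_mem hz').1, ?_⟩
      rw [mem_preimage, symm_transition hz']
      exact ⟨⟨hz.2.1.1, (extChartAt (𝓡 n) x').map_target hz.1⟩, hz.2.2⟩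
  rw [himg, lintegral_image_eq_lintegral_abs_det_fderiv_mul volume
    (measurableSet_chartDomain x' ((hA.inter hsx).inter hU))
    (f' := fderiv ℝ (transition x' x))
    (fun y hy => (differentiableAt_transition (hsub hy)).hasFDerivAt.hasFDerivWithinAt)
    (fun a ha b hb hab => by
      rw [← transition_transition (hsub ha), hab, transition_transition (hsub hb)])]
  refine setLIntegral_congr_fun (measurableSet_chartDomain x' ((hA.inter hsx).inter hU)) ?_
  intro y hy
  simp only
  rw [hg x' x y ⟨hy.1, hy.2.1.2, hy.2.2⟩, ENNReal.ofReal_mul (abs_nonneg _)]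

theorem exists_seq_iUnion_source (n : ℕ) (M : Type*) [TopologicalSpace M]
    [ChartedSpace (EuclideanSpace ℝ (Fin n)) M] [CompactSpace M] [Nonempty M] :
    ∃ t : ℕ → M, ⋃ k, (extChartAt (𝓡 n) (t k)).source = univ := by
  obtain ⟨c, hc⟩ := isCompact_univ.elim_finite_subcover
    (fun x : M => (extChartAt (𝓡 n) x).source) (fun x => isOpen_extChartAt_source x)
    (fun x _ => mem_iUnion.mpr ⟨x, mem_extChartAt_source x⟩)
  have hne : (c : Set M).Nonempty := by
    obtain ⟨x⟩ := ‹Nonempty M›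
    have := hc (mem_univ x)
    simp only [mem_iUnion] at this
    obtain ⟨i, hi, -⟩ := this
    exact ⟨i, hi⟩
  obtain ⟨t, ht⟩ := c.countable_toSet.exists_eq_range hne
  refine ⟨t, eq_univ_of_forall fun x => ?_⟩
  have := hc (mem_univ x)
  simp only [mem_iUnion] at this ⊢
  obtain ⟨i, hi, hxi⟩ := this
  obtain ⟨k, rfl⟩ := (ht ▸ hi : i ∈ range t)
  exact ⟨k, hxi⟩

theorem riemVolume_restrict_source [CompactSpace M] {g : MetricField n M} {U : Set M}
    (hg : HasVolumeDensity g U) (hU : MeasurableSet U) (x : M) :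
    (riemVolume g U).restrict (extChartAt (𝓡 n) x).source = chartVolume g U x := by
  have hm : ∀ x : M, MeasurableSet (extChartAt (𝓡 n) x).source := fun x =>
    (isOpen_extChartAt_source (I := 𝓡 n) x).measurableSet
  have : Nonempty M := ⟨x⟩
  obtain ⟨t, ht⟩ := exists_seq_iUnion_source n M
  refine iSup_restrict_of_compatible (chartVolume g U) (fun x => (extChartAt (𝓡 n) x).source) hm
    (fun x => ?_) (fun x x' => ?_) t ht x
  · ext A hA
    rw [Measure.restrict_apply hA, chartVolume_apply g hU (hA.inter (hm x)),
      chartVolume_apply g hU hA]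
    congr 2
    ext y
    simp only [chartDomain, mem_inter_iff, mem_preimage]
    have : y ∈ (extChartAt (𝓡 n) x).target → (extChartAt (𝓡 n) x).symm y ∈
      (extChartAt (𝓡 n) x).source := (extChartAt (𝓡 n) x).map_target
    tauto
  · ext A hA
    rw [Measure.restrict_apply hA, Measure.restrict_apply hA]
    exact chartVolume_apply_inter hg hU hA x' x

theorem metricMatrix_conformal (u : M → ℝ) (g : MetricField n M) (x : M)
    (y : EuclideanSpace ℝ (Fin n)) :
    metricMatrix (conformal u g) x y =
      Real.exp (2 * u ((extChartAt (𝓡 n) x).symm y)) • metricMatrix g x y := rfl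

theorem sqrt_det_conformal (u : M → ℝ) (g : MetricField n M) (x : M)
    (y : EuclideanSpace ℝ (Fin n)) :
    √(metricMatrix (conformal u g) x y).det =
      Real.exp (n * u ((extChartAt (𝓡 n) x).symm y)) * √(metricMatrix g x y).det := by
  rw [metricMatrix_conformal, Matrix.det_smul, Fintype.card_fin, ← Real.exp_nat_mul,
    Real.sqrt_mul (Real.exp_pos _).le, ← Real.exp_half]
  congr 2
  ring

theorem HasVolumeDensity.conformal {g : MetricField n M} {U : Set M} (hg : HasVolumeDensity g U)
    (u : M → ℝ) : HasVolumeDensity (conformal u g) U := by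
  intro x' x y hy
  have hy' : y ∈ chartDomain (n := n) x' (extChartAt (𝓡 n) x).source := ⟨hy.1, hy.2.1⟩
  rw [sqrt_det_conformal, sqrt_det_conformal, hg x' x y hy, symm_transition hy']
  ring

end Volume

/-! ### The density of the background metric. -/

section BaseVolume

variable {n : ℕ} {M : Type*} [TopologicalSpace M] [ChartedSpace (EuclideanSpace ℝ (Fin n)) M]
  [IsManifold (𝓡 n) ∞ M] [RiemannianBundle (fun x : M => TangentSpace (𝓡 n) x)]

/-- With J the Jacobian matrix of the transition, the two matrices of the metric are related by G' =
Jᵀ G J. -/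
theorem det_metricMatrix_transition {x' x : M} {y : EuclideanSpace ℝ (Fin n)}
    (hy : y ∈ chartDomain (n := n) x' (extChartAt (𝓡 n) x).source) :
    (metricMatrix (baseMetric n M) x' y).det = (fderiv ℝ (transition x' x) y).det ^ 2 *
      (metricMatrix (baseMetric n M) x (transition x' x y)).det := by
  set b := (EuclideanSpace.basisFun (Fin n) ℝ).toBasis
  set J := LinearMap.toMatrix b b (fderiv ℝ (transition x' x) y) with hJ
  have hJe : ∀ k i, J k i = fderiv ℝ (transition x' x) y (EuclideanSpace.single i 1) k := by
    intro k i
    simp [hJ, b, LinearMap.toMatrix_apply]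
  have hmat : metricMatrix (baseMetric n M) x' y =
      J.transpose * metricMatrix (baseMetric n M) x (transition x' x y) * J := by
    ext i j
    rw [← matForm_single (metricMatrix (baseMetric n M) x' y) i j,
      matForm_metricMatrix_transition hy, matForm_apply, Matrix.mul_apply]
    simp only [Matrix.mul_apply, Matrix.transpose_apply, hJe, Finset.sum_mul]
    rw [Finset.sum_comm]
    exact Finset.sum_congr rfl fun k _ => Finset.sum_congr rfl fun l _ => by ring
  have hdet : J.det = (fderiv ℝ (transition x' x) y).det := by
    rw [hJ, LinearMap.det_toMatrix]
  rw [hmat, Matrix.det_mul, Matrix.det_mul, Matrix.det_transpose, hdet]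
  ring

theorem hasVolumeDensity_baseMetric (U : Set M) : HasVolumeDensity (baseMetric n M) U := by
  intro x' x y hy
  have hy' : y ∈ chartDomain (n := n) x' (extChartAt (𝓡 n) x).source := ⟨hy.1, hy.2.1⟩
  rw [det_metricMatrix_transition hy', Real.sqrt_mul (sq_nonneg _), Real.sqrt_sq_eq_abs]

end BaseVolume
end ConformalHuber
end

noncomputable section
namespace ConformalHuber

/-! ### Integration on M through charts; the volume of the conformal metric. -/

section BaseVolume

variable {n : ℕ} {M : Type*} [TopologicalSpace M] [ChartedSpace (EuclideanSpace ℝ (Fin n)) M]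
  [MeasurableSpace M] [BorelSpace M] [RiemannianBundle (fun x : M => TangentSpace (𝓡 n) x)]

/-- The Riemannian volume measure of the metric of `M`. -/
def baseVolume (n : ℕ) (M : Type*) [TopologicalSpace M] [MeasurableSpace M]
    [ChartedSpace (EuclideanSpace ℝ (Fin n)) M]
    [RiemannianBundle (fun x : M => TangentSpace (𝓡 n) x)] : Measure M :=
  riemVolume (baseMetric n M) univ

variable [IsManifold (𝓡 n) ∞ M] [IsContMDiffRiemannianBundle (𝓡 n) ∞ (EuclideanSpace ℝ (Fin n))
      (fun x : M => TangentSpace (𝓡 n) x)] [CompactSpace M]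

theorem aemeasurable_sqrt_det (x : M) :
    AEMeasurable (fun y => ENNReal.ofReal (√(metricMatrix (baseMetric n M) x y).det))
      (volume.restrict (extChartAt (𝓡 n) x).target) := by
  refine AEMeasurable.ennreal_ofReal (ContinuousOn.aemeasurable ?_
    (isOpen_extChartAt_target x).measurableSet)
  exact (contDiffOn_det (isMetricOn_metricMatrix x).smooth).continuousOn.sqrt

theorem baseVolume_restrict_source (x : M) :
    (baseVolume n M).restrict (extChartAt (𝓡 n) x).source =
      Measure.map (extChartAt (𝓡 n) x).symm
        ((volume.restrict (extChartAt (𝓡 n) x).target).withDensity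
          fun y => ENNReal.ofReal (√(metricMatrix (baseMetric n M) x y).det)) := by
  rw [baseVolume, riemVolume_restrict_source (hasVolumeDensity_baseMetric univ)
    MeasurableSet.univ x, chartVolume]
  simp [chartDomain]

theorem aemeasurable_symm_target (x : M) : AEMeasurable (extChartAt (𝓡 n) x).symm
    ((volume.restrict (extChartAt (𝓡 n) x).target).withDensity
      fun y => ENNReal.ofReal (√(metricMatrix (baseMetric n M) x y).det)) := by
  have := aemeasurable_extChartAt_symm_withDensity (n := n) x MeasurableSet.univ
    (fun y => ENNReal.ofReal (√(metricMatrix (baseMetric n M) x y).det))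
  simpa [chartDomain] using this

theorem setLIntegral_source_baseVolume (x : M) {F : M → ℝ≥0∞}
    (hF : AEMeasurable F ((baseVolume n M).restrict (extChartAt (𝓡 n) x).source)) :
    ∫⁻ p in (extChartAt (𝓡 n) x).source, F p ∂(baseVolume n M) =
      ∫⁻ y in (extChartAt (𝓡 n) x).target,
        ENNReal.ofReal (√(metricMatrix (baseMetric n M) x y).det) *
          F ((extChartAt (𝓡 n) x).symm y) := by
  rw [baseVolume_restrict_source] at hF ⊢
  exact (lintegral_map' hF (aemeasurable_symm_target x)).trans
    (lintegral_withDensity_eq_lintegral_mul₀' (aemeasurable_sqrt_det x)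
      (hF.comp_aemeasurable (aemeasurable_symm_target x)))

theorem integrableOn_source_baseVolume_iff (x : M) {F : M → ℝ}
    (hF : AEStronglyMeasurable F ((baseVolume n M).restrict (extChartAt (𝓡 n) x).source)) :
    IntegrableOn F (extChartAt (𝓡 n) x).source (baseVolume n M) ↔
      IntegrableOn (fun y => √(metricMatrix (baseMetric n M) x y).det *
        F ((extChartAt (𝓡 n) x).symm y)) (extChartAt (𝓡 n) x).target := by
  rw [IntegrableOn, baseVolume_restrict_source] at *
  rw [integrable_map_measure hF (aemeasurable_symm_target x),
    integrable_withDensity_iff_integrable_smul₀' (aemeasurable_sqrt_det x)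
      (Eventually.of_forall fun _ => ENNReal.ofReal_lt_top)]
  simp only [ENNReal.toReal_ofReal (Real.sqrt_nonneg _), smul_eq_mul]
  rfl

theorem setIntegral_source_baseVolume (x : M) {F : M → ℝ}
    (hF : AEStronglyMeasurable F ((baseVolume n M).restrict (extChartAt (𝓡 n) x).source)) :
    ∫ p in (extChartAt (𝓡 n) x).source, F p ∂(baseVolume n M) =
      ∫ y in (extChartAt (𝓡 n) x).target, √(metricMatrix (baseMetric n M) x y).det *
          F ((extChartAt (𝓡 n) x).symm y) := by
  rw [baseVolume_restrict_source] at hF ⊢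
  rw [integral_map (aemeasurable_symm_target x) hF,
    integral_withDensity_eq_integral_toReal_smul₀ (aemeasurable_sqrt_det x)
      (Eventually.of_forall fun _ => ENNReal.ofReal_lt_top)]
  simp only [ENNReal.toReal_ofReal (Real.sqrt_nonneg _), smul_eq_mul]

/-- Both measures are compared on each set of a countable cover by chart domains, where √det scales
by e^(nu). -/
theorem riemVolume_conformal {Ω : Set M} (hΩ : IsOpen Ω) {u : M → ℝ} (hu : ContinuousOn u Ω) :
    riemVolume (conformal u (baseMetric n M)) Ω =
      ((baseVolume n M).restrict Ω).withDensity fun p => ENNReal.ofReal (Real.exp (n * u p)) := by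
  rcases isEmpty_or_nonempty M with hM | hM
  · exact Subsingleton.elim _ _
  obtain ⟨t, ht⟩ := exists_seq_iUnion_source n M
  refine Measure.ext_of_iUnion_eq_univ ht fun k => ?_
  set x := t k
  have hsx := (isOpen_extChartAt_source (I := 𝓡 n) x).measurableSet
  rw [riemVolume_restrict_source ((hasVolumeDensity_baseMetric Ω).conformal u) hΩ.measurableSet]
  have hρ : AEMeasurable (fun p => ENNReal.ofReal (Real.exp (n * u p)))
      ((baseVolume n M).restrict Ω) :=
    (ContinuousOn.aemeasurable (continuousOn_const.mul hu).rexp hΩ.measurableSet).ennreal_ofReal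
  ext A hA
  rw [chartVolume_apply _ hΩ.measurableSet hA, Measure.restrict_apply hA,
    withDensity_apply _ (hA.inter hsx), Measure.restrict_restrict (hA.inter hsx)]
  have hAΩ : MeasurableSet (A ∩ Ω) := hA.inter hΩ.measurableSet
  have hset : A ∩ (extChartAt (𝓡 n) x).source ∩ Ω = (A ∩ Ω) ∩ (extChartAt (𝓡 n) x).source := by
    ext; simp only [mem_inter_iff]; tauto
  have hind : AEMeasurable ((A ∩ Ω).indicator fun p => ENNReal.ofReal (Real.exp (n * u p)))
      ((baseVolume n M).restrict (extChartAt (𝓡 n) x).source) := by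
    refine AEMeasurable.mono_measure ?_ Measure.restrict_le_self
    rw [aemeasurable_indicator_iff hAΩ]
    exact hρ.mono_set inter_subset_right
  rw [hset, ← Measure.restrict_restrict hAΩ, ← lintegral_indicator hAΩ,
    setLIntegral_source_baseVolume x hind,
    ← lintegral_indicator (measurableSet_chartDomain x hAΩ),
    ← lintegral_indicator (isOpen_extChartAt_target x).measurableSet]
  refine lintegral_congr fun y => ?_
  by_cases hy : y ∈ (extChartAt (𝓡 n) x).target
  · by_cases hy2 : (extChartAt (𝓡 n) x).symm y ∈ A ∩ Ω
    · rw [indicator_of_mem (show y ∈ chartDomain x (A ∩ Ω) from ⟨hy, hy2⟩), indicator_of_mem hy,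
        indicator_of_mem hy2, sqrt_det_conformal, ENNReal.ofReal_mul (Real.exp_pos _).le, mul_comm]
    · rw [indicator_of_notMem (fun h : y ∈ chartDomain x (A ∩ Ω) => hy2 h.2), indicator_of_mem hy,
        indicator_of_notMem hy2, mul_zero]
  · rw [indicator_of_notMem (fun h : y ∈ chartDomain x (A ∩ Ω) => hy h.1), indicator_of_notMem hy]

theorem riemVolume_baseMetric {Ω : Set M} (hΩ : IsOpen Ω) :
    riemVolume (baseMetric n M) Ω = (baseVolume n M).restrict Ω := by
  have h := riemVolume_conformal (n := n) hΩ (u := fun _ => (0 : ℝ)) continuousOn_const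
  have h0 : conformal (fun _ => (0 : ℝ)) (baseMetric n M) = baseMetric n M := by
    funext x v w; simp [conformal]
  rw [h0] at h
  simpa using h

/-- The density is bounded on a closed coordinate ball, so the measure is locally finite, and M is
compact. -/
theorem isFiniteMeasure_baseVolume : IsFiniteMeasure (baseVolume n M) := by
  have : IsLocallyFiniteMeasure (baseVolume n M) := by
    refine ⟨fun x => ?_⟩
    obtain ⟨r, hr, hrt⟩ := Metric.nhds_basis_closedBall.mem_iff.mp
      ((isOpen_extChartAt_target (I := 𝓡 n) x).mem_nhds (mem_extChartAt_target (I := 𝓡 n) x))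
    have hsx := (isOpen_extChartAt_source (I := 𝓡 n) x)
    set N := (extChartAt (𝓡 n) x).source ∩
      extChartAt (𝓡 n) x ⁻¹' Metric.ball (extChartAt (𝓡 n) x x) r with hN
    have hNo : IsOpen N := (continuousOn_extChartAt x).isOpen_inter_preimage hsx Metric.isOpen_ball
    refine ⟨N, hNo.mem_nhds ⟨mem_extChartAt_source x, Metric.mem_ball_self hr⟩, ?_⟩
    have h1 : baseVolume n M N = chartVolume (baseMetric n M) univ x N := by
      rw [← riemVolume_restrict_source (hasVolumeDensity_baseMetric univ) MeasurableSet.univ x,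
        Measure.restrict_apply hNo.measurableSet, inter_eq_left.mpr inter_subset_left]
      rfl
    rw [h1, chartVolume_apply _ MeasurableSet.univ hNo.measurableSet]
    have hsub : chartDomain (n := n) x (N ∩ univ) ⊆
        Metric.closedBall (extChartAt (𝓡 n) x x) r := by
      rintro y ⟨hy, ⟨-, hy2⟩, -⟩
      rw [mem_preimage, (extChartAt (𝓡 n) x).right_inv hy] at hy2
      exact Metric.ball_subset_closedBall hy2
    refine (lintegral_mono_set hsub).trans_lt ?_
    have hc : ContinuousOn (fun y => √(metricMatrix (baseMetric n M) x y).det)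
        (Metric.closedBall (extChartAt (𝓡 n) x x) r) :=
      ((contDiffOn_det (isMetricOn_metricMatrix x).smooth).continuousOn.sqrt).mono hrt
    have hi := hc.integrableOn_compact (μ := volume) (isCompact_closedBall _ _)
    exact hi.lintegral_lt_top
  exact CompactSpace.isFiniteMeasure

end BaseVolume
end ConformalHuber
end

noncomputable section
namespace ConformalHuber

/-! ### Inner products of gradients, independently of the chart. -/

section Pairing

variable {n : ℕ} {M : Type*} [TopologicalSpace M] [ChartedSpace (EuclideanSpace ℝ (Fin n)) M]
  [RiemannianBundle (fun x : M => TangentSpace (𝓡 n) x)]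

/-- The inner product `⟨∇u, ∇w⟩` for the metric of `M`. -/
def pairing (n : ℕ) {M : Type*} [TopologicalSpace M] [ChartedSpace (EuclideanSpace ℝ (Fin n)) M]
    [RiemannianBundle (fun x : M => TangentSpace (𝓡 n) x)] (u w : M → ℝ) (p : M) : ℝ :=
  fderiv ℝ (w ∘ (extChartAt (𝓡 n) p).symm) (extChartAt (𝓡 n) p p)
    (gradVec (metricMatrix (baseMetric n M) p) (u ∘ (extChartAt (𝓡 n) p).symm)
      (extChartAt (𝓡 n) p p))

theorem gradNorm_baseMetric (v : M → ℝ) (p : M) :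
    gradNorm (baseMetric n M) v p = √(pairing n v v p) := by
  rw [pairing, fderiv_gradVec_eq_sum]
  rfl

theorem comp_symm_eventuallyEq {u u' : M → ℝ} {p : M} (h : u =ᶠ[𝓝 p] u') :
    u ∘ (extChartAt (𝓡 n) p).symm =ᶠ[𝓝 (extChartAt (𝓡 n) p p)]
      u' ∘ (extChartAt (𝓡 n) p).symm := by
  have h2 : Tendsto (extChartAt (𝓡 n) p).symm (𝓝 (extChartAt (𝓡 n) p p)) (𝓝 p) := by
    have := continuousAt_extChartAt_symm (I := 𝓡 n) p
    rwa [ContinuousAt, extChartAt_to_inv] at this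
  exact h2.eventually h

theorem pairing_congr {u u' w w' : M → ℝ} {p : M} (hu : u =ᶠ[𝓝 p] u') (hw : w =ᶠ[𝓝 p] w') :
    pairing n u w p = pairing n u' w' p := by
  rw [pairing, pairing, (comp_symm_eventuallyEq hw).fderiv_eq]
  congr 1
  simp only [gradVec, partialD, (comp_symm_eventuallyEq (n := n) hu).fderiv_eq]

theorem gradNorm_congr {v v' : M → ℝ} {p : M} (h : v =ᶠ[𝓝 p] v') :
    gradNorm (baseMetric n M) v p = gradNorm (baseMetric n M) v' p := by
  rw [gradNorm_baseMetric, gradNorm_baseMetric, pairing_congr h h]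

theorem pairing_const (u : M → ℝ) (c : ℝ) (p : M) : pairing n u (fun _ => c) p = 0 := by
  have : ((fun _ => c) ∘ (extChartAt (𝓡 n) p).symm : EuclideanSpace ℝ (Fin n) → ℝ) =
    fun _ => c := rfl
  rw [pairing, this, fderiv_const_apply]
  rfl

theorem gradNorm_eq_zero_of_eventuallyEq_const {v : M → ℝ} {c : ℝ} {p : M}
    (h : v =ᶠ[𝓝 p] fun _ => c) : gradNorm (baseMetric n M) v p = 0 := by
  rw [gradNorm_congr h, gradNorm_baseMetric, pairing_const, Real.sqrt_zero]

variable [IsManifold (𝓡 n) ∞ M]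

theorem differentiableAt_comp_symm {w : M → ℝ} {x : M} {y : EuclideanSpace ℝ (Fin n)}
    (hy : y ∈ (extChartAt (𝓡 n) x).target)
    (hw : MDifferentiableAt (𝓡 n) 𝓘(ℝ, ℝ) w ((extChartAt (𝓡 n) x).symm y)) :
    DifferentiableAt ℝ (w ∘ (extChartAt (𝓡 n) x).symm) y := by
  rw [← mdifferentiableAt_iff_differentiableAt]
  exact hw.comp y (mdifferentiableAt_extChartAt_symm hy)

theorem differentiableAt_comp_symm_self {w : M → ℝ} {p : M}
    (hw : MDifferentiableAt (𝓡 n) 𝓘(ℝ, ℝ) w p) :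
    DifferentiableAt ℝ (w ∘ (extChartAt (𝓡 n) p).symm) (extChartAt (𝓡 n) p p) :=
  differentiableAt_comp_symm (mem_extChartAt_target p) (by rwa [extChartAt_to_inv])

theorem contDiffOn_comp_symm {w : M → ℝ} {k : WithTop ℕ∞} (hk : k ≤ (∞ : WithTop ℕ∞)) {Ω : Set M}
    (hw : ContMDiffOn (𝓡 n) 𝓘(ℝ, ℝ) k w Ω) (x : M) :
    ContDiffOn ℝ k (w ∘ (extChartAt (𝓡 n) x).symm) (chartDomain x Ω) := by
  rw [← contMDiffOn_iff_contDiffOn]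
  exact hw.comp (((contMDiffOn_extChartAt_symm (I := 𝓡 n) (n := ∞) x).of_le hk).mono
    inter_subset_left) inter_subset_right

theorem fderiv_comp_symm_transition {w : M → ℝ} {x' x : M} {y : EuclideanSpace ℝ (Fin n)}
    (hy : y ∈ chartDomain (n := n) x' (extChartAt (𝓡 n) x).source)
    (hw : MDifferentiableAt (𝓡 n) 𝓘(ℝ, ℝ) w ((extChartAt (𝓡 n) x').symm y))
    (c : EuclideanSpace ℝ (Fin n)) :
    fderiv ℝ (w ∘ (extChartAt (𝓡 n) x').symm) y c =
      fderiv ℝ (w ∘ (extChartAt (𝓡 n) x).symm) (transition x' x y)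
        (fderiv ℝ (transition x' x) y c) := by
  have h1 : w ∘ (extChartAt (𝓡 n) x').symm =ᶠ[𝓝 y]
      (w ∘ (extChartAt (𝓡 n) x).symm) ∘ transition x' x := by
    filter_upwards [(isOpen_chartDomain x' (isOpen_extChartAt_source x)).mem_nhds hy] with z hz
    simp only [Function.comp, symm_transition hz]
  have hw' : DifferentiableAt ℝ (w ∘ (extChartAt (𝓡 n) x).symm) (transition x' x y) :=
    differentiableAt_comp_symm (transition_mem hy).1 (by rwa [symm_transition hy])
  rw [h1.fderiv_eq, fderiv_comp y hw' (differentiableAt_transition hy)]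
  rfl

variable [IsContMDiffRiemannianBundle (𝓡 n) ∞ (EuclideanSpace ℝ (Fin n))
      (fun x : M => TangentSpace (𝓡 n) x)]

/-- The difference of the two vectors is orthogonal to every image under the differential of the
transition. That differential is onto, so the difference is orthogonal to itself and is zero by
positivity. -/
theorem gradVec_transition {u : M → ℝ} {x' x : M} {y : EuclideanSpace ℝ (Fin n)}
    (hy : y ∈ chartDomain (n := n) x' (extChartAt (𝓡 n) x).source)
    (hu : MDifferentiableAt (𝓡 n) 𝓘(ℝ, ℝ) u ((extChartAt (𝓡 n) x').symm y)) :
    fderiv ℝ (transition x' x) y (gradVec (metricMatrix (baseMetric n M) x')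
        (u ∘ (extChartAt (𝓡 n) x').symm) y) =
      gradVec (metricMatrix (baseMetric n M) x) (u ∘ (extChartAt (𝓡 n) x).symm)
        (transition x' x y) := by
  have hx := isMetricOn_metricMatrix (n := n) x
  have hx' := isMetricOn_metricMatrix (n := n) x'
  rw [← sub_eq_zero]
  by_contra hne
  have hpos := hx.pos _ (transition_mem hy).1 _ hne
  obtain ⟨c, hc⟩ := (bijective_fderiv_transition hy).2
    (fderiv ℝ (transition x' x) y (gradVec (metricMatrix (baseMetric n M) x')
        (u ∘ (extChartAt (𝓡 n) x').symm) y) -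
      gradVec (metricMatrix (baseMetric n M) x) (u ∘ (extChartAt (𝓡 n) x).symm)
        (transition x' x y))
  have key : matForm (metricMatrix (baseMetric n M) x (transition x' x y))
      (fderiv ℝ (transition x' x) y (gradVec (metricMatrix (baseMetric n M) x')
        (u ∘ (extChartAt (𝓡 n) x').symm) y) -
      gradVec (metricMatrix (baseMetric n M) x) (u ∘ (extChartAt (𝓡 n) x).symm)
        (transition x' x y)) (fderiv ℝ (transition x' x) y c) = 0 := by
    rw [ContinuousLinearMap.map_sub, _root_.sub_apply, ← matForm_metricMatrix_transition hy,
      hx'.matForm_gradVec hy.1, hx.matForm_gradVec (transition_mem hy).1,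
      fderiv_comp_symm_transition hy hu, sub_self]
  rw [hc] at key
  exact hpos.ne' key

/-- The inner product of gradients, computed in any preferred chart. -/
theorem pairing_eq_chart {u w : M → ℝ} {x p : M} (hp : p ∈ (extChartAt (𝓡 n) x).source)
    (hu : MDifferentiableAt (𝓡 n) 𝓘(ℝ, ℝ) u p) (hw : MDifferentiableAt (𝓡 n) 𝓘(ℝ, ℝ) w p) :
    pairing n u w p = fderiv ℝ (w ∘ (extChartAt (𝓡 n) x).symm) (extChartAt (𝓡 n) x p)
      (gradVec (metricMatrix (baseMetric n M) x) (u ∘ (extChartAt (𝓡 n) x).symm)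
        (extChartAt (𝓡 n) x p)) := by
  have hy : extChartAt (𝓡 n) p p ∈ chartDomain (n := n) p (extChartAt (𝓡 n) x).source := by
    refine ⟨mem_extChartAt_target p, ?_⟩
    rwa [mem_preimage, extChartAt_to_inv]
  have ht : transition p x (extChartAt (𝓡 n) p p) = extChartAt (𝓡 n) x p := by
    rw [transition, extChartAt_to_inv]
  rw [pairing, fderiv_comp_symm_transition hy (by rwa [extChartAt_to_inv]),
    gradVec_transition hy (by rwa [extChartAt_to_inv]), ht]

theorem pairing_self_nonneg (u : M → ℝ) (p : M) : 0 ≤ pairing n u u p := by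
  have hx := isMetricOn_metricMatrix (n := n) p
  rw [pairing, ← hx.matForm_gradVec (mem_extChartAt_target p)]
  by_cases h : gradVec (metricMatrix (baseMetric n M) p) (u ∘ (extChartAt (𝓡 n) p).symm)
      (extChartAt (𝓡 n) p p) = 0
  · rw [h]; simp
  · exact (hx.pos _ (mem_extChartAt_target p) _ h).le

theorem gradNorm_sq (u : M → ℝ) (p : M) :
    gradNorm (baseMetric n M) u p ^ 2 = pairing n u u p := by
  rw [gradNorm_baseMetric, Real.sq_sqrt (pairing_self_nonneg u p)]

/-- The definition uses the chart centred at the point itself, which changes with the point.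
Continuity becomes visible only after passing to one fixed chart nearby. -/
theorem continuousOn_pairing {Ω : Set M} (hΩ : IsOpen Ω) {u w : M → ℝ}
    (hu : ContMDiffOn (𝓡 n) 𝓘(ℝ, ℝ) ∞ u Ω) (hw : ContMDiffOn (𝓡 n) 𝓘(ℝ, ℝ) 1 w Ω) :
    ContinuousOn (pairing n u w) Ω := by
  intro p hp
  refine ContinuousAt.continuousWithinAt ?_
  have hpd : extChartAt (𝓡 n) p p ∈ chartDomain (n := n) p Ω :=
    ⟨mem_extChartAt_target p, by rwa [mem_preimage, extChartAt_to_inv]⟩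
  have hd := isOpen_chartDomain (n := n) p hΩ
  have hG := ((isMetricOn_metricMatrix (n := n) p).mono inter_subset_left :
    IsMetricOn _ (chartDomain (n := n) p Ω))
  have h1 : ContinuousAt (fun y => fderiv ℝ (w ∘ (extChartAt (𝓡 n) p).symm) y
      (gradVec (metricMatrix (baseMetric n M) p) (u ∘ (extChartAt (𝓡 n) p).symm) y))
      (extChartAt (𝓡 n) p p) := by
    refine ContinuousAt.clm_apply ?_ ?_
    · exact ((contDiffOn_comp_symm ENat.LEInfty.out hw p).continuousOn_fderiv_of_isOpen hd
        le_rfl).continuousAt (hd.mem_nhds hpd)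
    · exact (hG.smooth_gradVec hd (contDiffOn_comp_symm le_rfl hu p)).continuousOn.continuousAt
        (hd.mem_nhds hpd)
  have h2 := ContinuousAt.comp (f := extChartAt (𝓡 n) p) h1 (continuousAt_extChartAt (I := 𝓡 n) p)
  refine h2.congr ?_
  filter_upwards [(isOpen_extChartAt_source (I := 𝓡 n) p).mem_nhds (mem_extChartAt_source p),
    hΩ.mem_nhds hp] with q hq hqΩ
  refine (pairing_eq_chart hq ?_ ?_).symm
  · exact (hu.contMDiffAt (hΩ.mem_nhds hqΩ)).mdifferentiableAt (by simp)
  · exact (hw.contMDiffAt (hΩ.mem_nhds hqΩ)).mdifferentiableAt (by simp)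

theorem continuousOn_gradNorm {Ω : Set M} (hΩ : IsOpen Ω) {u : M → ℝ}
    (hu : ContMDiffOn (𝓡 n) 𝓘(ℝ, ℝ) ∞ u Ω) : ContinuousOn (gradNorm (baseMetric n M) u) Ω := by
  have h := (continuousOn_pairing hΩ hu (hu.of_le ENat.LEInfty.out)).sqrt
  exact h.congr fun p _ => gradNorm_baseMetric u p

theorem pairing_sum {ι : Type*} (s : Finset ι) (u : M → ℝ) (w : ι → M → ℝ) {p : M}
    (hw : ∀ i ∈ s, MDifferentiableAt (𝓡 n) 𝓘(ℝ, ℝ) (w i) p) :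
    pairing n u (fun q => ∑ i ∈ s, w i q) p = ∑ i ∈ s, pairing n u (w i) p := by
  have h1 : (fun q => ∑ i ∈ s, w i q) ∘ (extChartAt (𝓡 n) p).symm =
      fun y => ∑ i ∈ s, (w i ∘ (extChartAt (𝓡 n) p).symm) y := rfl
  simp only [pairing]
  rw [h1, fderiv_fun_sum fun i hi => differentiableAt_comp_symm_self (hw i hi), _root_.sum_apply]

theorem pairing_comp {u w : M → ℝ} {p : M} (hw : MDifferentiableAt (𝓡 n) 𝓘(ℝ, ℝ) w p) {θ : ℝ → ℝ} {θ' : ℝ} (hθ : HasDerivAt θ θ' (w p)) :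
    pairing n u (fun q => θ (w q)) p = θ' * pairing n u w p := by
  have h1 := (differentiableAt_comp_symm_self hw).hasFDerivAt
  have h2 : HasDerivAt θ θ' ((w ∘ (extChartAt (𝓡 n) p).symm) (extChartAt (𝓡 n) p p)) := by
    rwa [Function.comp, extChartAt_to_inv]
  have h3 := h2.comp_hasFDerivAt _ h1
  have h4 : (fun q => θ (w q)) ∘ (extChartAt (𝓡 n) p).symm =
    θ ∘ (w ∘ (extChartAt (𝓡 n) p).symm) := rfl
  rw [pairing, h4, h3.fderiv]
  rfl

theorem gradNorm_comp {u : M → ℝ} {p : M} (hu : MDifferentiableAt (𝓡 n) 𝓘(ℝ, ℝ) u p)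
    {θ : ℝ → ℝ} {θ' : ℝ} (hθ : HasDerivAt θ θ' (u p)) :
    gradNorm (baseMetric n M) (fun q => θ (u q)) p = |θ'| * gradNorm (baseMetric n M) u p := by
  have hx := isMetricOn_metricMatrix (n := n) p
  have h1 := (differentiableAt_comp_symm_self hu).hasFDerivAt
  have h2 : HasDerivAt θ θ' ((u ∘ (extChartAt (𝓡 n) p).symm) (extChartAt (𝓡 n) p p)) := by
    rwa [Function.comp, extChartAt_to_inv]
  have h3 := h2.comp_hasFDerivAt _ h1
  have h4 : (fun q => θ (u q)) ∘ (extChartAt (𝓡 n) p).symm =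
    θ ∘ (u ∘ (extChartAt (𝓡 n) p).symm) := rfl
  have hp : ∀ i, partialD i ((fun q => θ (u q)) ∘ (extChartAt (𝓡 n) p).symm)
      (extChartAt (𝓡 n) p p) =
      θ' * partialD i (u ∘ (extChartAt (𝓡 n) p).symm) (extChartAt (𝓡 n) p p) := by
    intro i
    rw [partialD, h4, h3.fderiv]
    rfl
  simp only [gradNorm, hp]
  rw [← Real.sqrt_sq_eq_abs, ← Real.sqrt_mul (sq_nonneg _)]
  congr 1
  rw [Finset.mul_sum]
  refine Finset.sum_congr rfl fun i _ => ?_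
  rw [Finset.mul_sum]
  exact Finset.sum_congr rfl fun j _ => by ring

theorem gradNorm_conformal (u v : M → ℝ) (p : M) :
    gradNorm (conformal u (baseMetric n M)) v p =
      Real.exp (-u p) * gradNorm (baseMetric n M) v p := by
  have hx := isMetricOn_metricMatrix (n := n) p
  have h1 : metricMatrix (conformal u (baseMetric n M)) p (extChartAt (𝓡 n) p p) =
      Real.exp (2 * u p) • metricMatrix (baseMetric n M) p (extChartAt (𝓡 n) p p) := by
    have h0 : metricMatrix (conformal u (baseMetric n M)) p (extChartAt (𝓡 n) p p) =
      Real.exp (2 * u ((extChartAt (𝓡 n) p).symm (extChartAt (𝓡 n) p p))) •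
        metricMatrix (baseMetric n M) p (extChartAt (𝓡 n) p p) := rfl
    rw [h0, extChartAt_to_inv]
  have h2 : (metricMatrix (conformal u (baseMetric n M)) p (extChartAt (𝓡 n) p p))⁻¹ =
      Real.exp (-u p) ^ 2 • (metricMatrix (baseMetric n M) p (extChartAt (𝓡 n) p p))⁻¹ := by
    rw [h1]
    refine Matrix.inv_eq_right_inv ?_
    rw [Matrix.smul_mul, Matrix.mul_smul, smul_smul, hx.mul_inv (mem_extChartAt_target p),
      ← Real.exp_nat_mul, ← Real.exp_add]
    simp
  simp only [gradNorm, h2]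
  conv_rhs => rw [← Real.sqrt_sq (Real.exp_pos (-u p)).le]
  rw [← Real.sqrt_mul (sq_nonneg _)]
  congr 1
  rw [Finset.mul_sum]
  refine Finset.sum_congr rfl fun i _ => ?_
  rw [Finset.mul_sum]
  exact Finset.sum_congr rfl fun j _ => by rw [Matrix.smul_apply, smul_eq_mul]; ring

theorem gradNorm_nonneg (g : MetricField n M) (v : M → ℝ) (p : M) : 0 ≤ gradNorm g v p :=
  Real.sqrt_nonneg _

end Pairing
end ConformalHuber
end

noncomputable section
namespace ConformalHuber

/-! ### Bounds for the Ricci form by the metric. -/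

section RicciBounds

variable {n : ℕ}

theorem sum_mul_mul_le (A : Matrix (Fin n) (Fin n) ℝ) (a : EuclideanSpace ℝ (Fin n)) :
    |∑ i, ∑ j, A i j * a i * a j| ≤ (∑ i, ∑ j, |A i j|) * ‖a‖ ^ 2 := by
  refine (Finset.abs_sum_le_sum_abs _ _).trans ?_
  rw [Finset.sum_mul]
  refine Finset.sum_le_sum fun i _ => (Finset.abs_sum_le_sum_abs _ _).trans ?_
  rw [Finset.sum_mul]
  refine Finset.sum_le_sum fun j _ => ?_
  rw [abs_mul, abs_mul, mul_assoc, sq]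
  have h := fun i => PiLp.norm_apply_le a i
  simp only [Real.norm_eq_abs] at h
  gcongr <;> exact h _

/-- Locally the Ricci form is at most B ‖a‖² by continuity of its components, while c ‖a‖² ≤ g(a, a)
by coercivity, so B / c works. Compactness makes the constant uniform. -/
theorem IsMetricOn.exists_ricciForm_le {G : EuclideanSpace ℝ (Fin n) → Matrix (Fin n) (Fin n) ℝ}
    {S K : Set (EuclideanSpace ℝ (Fin n))} (h : IsMetricOn G S) (hS : IsOpen S)
    (hK : IsCompact K) (hKS : K ⊆ S) :
    ∃ C, 0 ≤ C ∧ ∀ y ∈ K, ∀ a, |ricciForm (chrMap G) y a a| ≤ C * matForm (G y) a a := by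
  have hp : ∀ y ∈ S, ∀ a, 0 ≤ matForm (G y) a a := by
    intro y hy a
    by_cases ha : a = 0
    · simp [ha]
    · exact (h.pos y hy a ha).le
  -- The compactness induction runs over sets that need not lie in S, hence the membership is
  -- carried along.
  suffices H : ∃ C, 0 ≤ C ∧ ∀ y ∈ K, y ∈ S → ∀ a,
      |ricciForm (chrMap G) y a a| ≤ C * matForm (G y) a a by
    obtain ⟨C, hC, H⟩ := H
    exact ⟨C, hC, fun y hy => H y hy (hKS hy)⟩
  refine hK.induction_on (p := fun K => ∃ C, 0 ≤ C ∧ ∀ y ∈ K, y ∈ S → ∀ a,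
      |ricciForm (chrMap G) y a a| ≤ C * matForm (G y) a a) ?_ ?_ ?_ ?_
  · exact ⟨0, le_rfl, by simp⟩
  · rintro s t hst ⟨C, hC, H⟩
    exact ⟨C, hC, fun y hy => H y (hst hy)⟩
  · rintro s t ⟨C, hC, H⟩ ⟨C', hC', H'⟩
    refine ⟨max C C', le_max_of_le_left hC, fun y hy hyS a => ?_⟩
    rcases hy with hy | hy
    · exact (H y hy hyS a).trans (mul_le_mul_of_nonneg_right (le_max_left _ _) (hp y hyS a))
    · exact (H' y hy hyS a).trans (mul_le_mul_of_nonneg_right (le_max_right _ _) (hp y hyS a))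
  · intro y hy
    obtain ⟨c, hc, hcoer⟩ := h.coercive hS (hKS hy)
    have hcont : ContinuousAt (fun z => ∑ i, ∑ j, |ricciMat G z i j|) y := by
      refine ContinuousOn.continuousAt (s := S) ?_ (hS.mem_nhds (hKS hy))
      exact continuousOn_finsetSum _ fun i _ => continuousOn_finsetSum _ fun j _ =>
        (continuousOn_ricciMat h hS i j).abs
    set B := ∑ i, ∑ j, |ricciMat G y i j| + 1
    have hB : ∀ᶠ z in 𝓝 y, ∑ i, ∑ j, |ricciMat G z i j| < B :=
      hcont.eventually_lt continuousAt_const (lt_add_one _)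
    have hB0 : 0 ≤ B := by positivity
    refine ⟨_, mem_nhdsWithin_of_mem_nhds (hcoer.and hB), B / c, by positivity, ?_⟩
    rintro z ⟨hz1, hz2⟩ hzS a
    rw [← h.sum_ricciMat hS hzS]
    refine (sum_mul_mul_le (fun i j => ricciMat G z i j) a).trans ?_
    calc _ ≤ B * ‖a‖ ^ 2 := by gcongr
      _ = B / c * (c * ‖a‖ ^ 2) := by field_simp
      _ ≤ _ := by gcongr; exact hz1 a

variable {M : Type*} [TopologicalSpace M] [ChartedSpace (EuclideanSpace ℝ (Fin n)) M]

/-- For unit vectors this is the definition of the lowest Ricci curvature; both sides are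
homogeneous of degree two, which gives the other nonzero vectors. -/
theorem neg_ricciNeg_mul_le {g : MetricField n M} {p : M} {S : Set (EuclideanSpace ℝ (Fin n))}
    (hS : IsOpen S) (hp : extChartAt (𝓡 n) p p ∈ S) (h : IsMetricOn (metricMatrix g p) S)
    (a : EuclideanSpace ℝ (Fin n)) :
    -(ricciNeg g p * matForm (metricMatrix g p (extChartAt (𝓡 n) p p)) a a) ≤
      ricciForm (chrMap (metricMatrix g p)) (extChartAt (𝓡 n) p p) a a := by
  set y := extChartAt (𝓡 n) p p with hy
  obtain ⟨C, hC, hCb⟩ := h.exists_ricciForm_le hS (isCompact_singleton (x := y)) (by simpa using hp)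
  have hric : ∀ ξ : EuclideanSpace ℝ (Fin n), ∑ i, ∑ j, ricci g p i j * ξ i * ξ j =
      ricciForm (chrMap (metricMatrix g p)) y ξ ξ := fun ξ => h.sum_ricciMat hS hp ξ
  -- Without a lower bound the real infimum would take the default value 0 and carry no information.
  have hbdd : BddBelow {r : ℝ | ∃ ξ : Fin n → ℝ,
      ∑ i, ∑ j, metricMatrix g p (extChartAt (𝓡 n) p p) i j * ξ i * ξ j = 1 ∧
      r = ∑ i, ∑ j, ricci g p i j * ξ i * ξ j} := by
    refine ⟨-C, ?_⟩
    rintro r ⟨ξ, h1, rfl⟩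
    have h2 := hCb y rfl (WithLp.toLp 2 ξ)
    have h3 : matForm (metricMatrix g p y) (WithLp.toLp 2 ξ) (WithLp.toLp 2 ξ) = 1 := by
      rw [matForm_apply]; exact h1
    rw [← hric, h3, mul_one] at h2
    exact (abs_le.mp h2).1
  have hlow : ∀ ξ : EuclideanSpace ℝ (Fin n), matForm (metricMatrix g p y) ξ ξ = 1 →
      -ricciNeg g p ≤ ricciForm (chrMap (metricMatrix g p)) y ξ ξ := by
    intro ξ hξ
    have h1 : lowestRicci g p ≤ ricciForm (chrMap (metricMatrix g p)) y ξ ξ := by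
      rw [← hric]
      refine csInf_le hbdd ⟨ξ, ?_, rfl⟩
      rw [matForm_apply] at hξ
      exact hξ
    have h2 : -lowestRicci g p ≤ ricciNeg g p := le_max_right _ _
    linarith
  by_cases ha : a = 0
  · subst ha
    rw [← hric]
    simp
  have hpos := h.pos y hp a ha
  set t := matForm (metricMatrix g p y) a a with ht
  have hs : √t ≠ 0 := (Real.sqrt_pos.mpr hpos).ne'
  have h1 := hlow ((√t)⁻¹ • a) (by
    rw [ContinuousLinearMap.map_smul, ContinuousLinearMap.map_smul, _root_.smul_apply, ← ht,
      smul_eq_mul, smul_eq_mul]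
    field_simp
    exact (Real.sq_sqrt hpos.le).symm)
  have h2 : ricciForm (chrMap (metricMatrix g p)) y ((√t)⁻¹ • a) ((√t)⁻¹ • a) =
      t⁻¹ * ricciForm (chrMap (metricMatrix g p)) y a a := by
    rw [← hric, ← hric, Finset.mul_sum]
    refine Finset.sum_congr rfl fun i _ => ?_
    rw [Finset.mul_sum]
    refine Finset.sum_congr rfl fun j _ => ?_
    have : t⁻¹ = (√t)⁻¹ * (√t)⁻¹ := by rw [← mul_inv, Real.mul_self_sqrt hpos.le]
    rw [this]
    simp only [PiLp.smul_apply, smul_eq_mul]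
    ring
  rw [h2] at h1
  have h3 := mul_le_mul_of_nonneg_left h1 hpos.le
  rw [mul_inv_cancel_left₀ hpos.ne'] at h3
  linarith

variable [IsManifold (𝓡 n) ∞ M] [RiemannianBundle (fun x : M => TangentSpace (𝓡 n) x)]
  [IsContMDiffRiemannianBundle (𝓡 n) ∞ (EuclideanSpace ℝ (Fin n))
      (fun x : M => TangentSpace (𝓡 n) x)]

theorem isMetricOn_conformal {Ω : Set M} {u : M → ℝ} (hu : ContMDiffOn (𝓡 n) 𝓘(ℝ, ℝ) ∞ u Ω)
    (x : M) : IsMetricOn (metricMatrix (conformal u (baseMetric n M)) x) (chartDomain x Ω) :=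
  ((isMetricOn_metricMatrix x).mono inter_subset_left).conformal (contDiffOn_comp_symm le_rfl hu x)

/-- The lower bound for the Ricci curvature of the conformal metric, in any preferred chart. -/
theorem neg_ricciNeg_mul_le_chart {Ω : Set M} (hΩ : IsOpen Ω) {u : M → ℝ}
    (hu : ContMDiffOn (𝓡 n) 𝓘(ℝ, ℝ) ∞ u Ω) {x p : M} (hp : p ∈ (extChartAt (𝓡 n) x).source)
    (hpΩ : p ∈ Ω) (a : EuclideanSpace ℝ (Fin n)) :
    -(ricciNeg (conformal u (baseMetric n M)) p *
        matForm (metricMatrix (conformal u (baseMetric n M)) x (extChartAt (𝓡 n) x p)) a a) ≤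
      ricciForm (chrMap (metricMatrix (conformal u (baseMetric n M)) x))
        (extChartAt (𝓡 n) x p) a a := by
  set g := conformal u (baseMetric n M) with hg
  have hsx := isOpen_extChartAt_source (I := 𝓡 n) x
  set S' := chartDomain (n := n) p ((extChartAt (𝓡 n) x).source ∩ Ω) with hS'
  have hS'o : IsOpen S' := isOpen_chartDomain p (hsx.inter hΩ)
  have hsub : S' ⊆ chartDomain (n := n) p (extChartAt (𝓡 n) x).source := fun y hy => ⟨hy.1, hy.2.1⟩
  have hpS : extChartAt (𝓡 n) p p ∈ S' := by
    refine ⟨mem_extChartAt_target p, ?_⟩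
    rw [mem_preimage, extChartAt_to_inv]
    exact ⟨hp, hpΩ⟩
  have hM' : IsMetricOn (metricMatrix g p) S' :=
    (isMetricOn_conformal hu p).mono fun y hy => ⟨hy.1, hy.2.2⟩
  have hM := isMetricOn_conformal (n := n) hu x
  have hlaw : ∀ z ∈ S', ∀ b c, matForm (metricMatrix g p z) b c =
      matForm (metricMatrix g x (transition p x z)) (fderiv ℝ (transition p x) z b)
        (fderiv ℝ (transition p x) z c) := by
    intro z hz b c
    have e1 : metricMatrix g p z = Real.exp (2 * u ((extChartAt (𝓡 n) p).symm z)) •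
      metricMatrix (baseMetric n M) p z := rfl
    have e2 : metricMatrix g x (transition p x z) =
      Real.exp (2 * u ((extChartAt (𝓡 n) x).symm (transition p x z))) •
      metricMatrix (baseMetric n M) x (transition p x z) := rfl
    rw [e1, e2, symm_transition (hsub hz), matForm_smul, matForm_smul]
    simp only [_root_.smul_apply]
    rw [matForm_metricMatrix_transition (hsub hz)]
  have ht : transition p x (extChartAt (𝓡 n) p p) = extChartAt (𝓡 n) x p := by
    rw [transition, extChartAt_to_inv]
  -- `ricciNeg` is defined in the chart centred at p. The bound is applied there to the preimage b
  -- of a, and the tensor law carries it to the chart at x.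
  obtain ⟨b, hb⟩ := (bijective_fderiv_transition (hsub hpS)).2 a
  have h1 := neg_ricciNeg_mul_le hS'o hpS hM' b
  rw [hlaw _ hpS, hM.ricciForm_pullback (isOpen_chartDomain x hΩ) hM' hS'o
    ((contDiffOn_transition p x).mono hsub) ?_ (fun z hz => bijective_fderiv_transition (hsub hz))
    hlaw hpS, hb, ht] at h1
  · exact h1
  · intro z hz
    refine ⟨(transition_mem (hsub hz)).1, ?_⟩
    rw [mem_preimage, symm_transition (hsub hz)]
    exact hz.2.2

end RicciBounds
end ConformalHuber
end

noncomputable section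
namespace ConformalHuber

theorem ofReal_integral_le_lintegral_ofReal {X : Type*} [MeasurableSpace X] {μ : Measure X}
    {f : X → ℝ} (hf : Integrable f μ) :
    ENNReal.ofReal (∫ x, f x ∂μ) ≤ ∫⁻ x, ENNReal.ofReal (f x) ∂μ := by
  rw [integral_eq_lintegral_pos_part_sub_lintegral_neg_part hf]
  refine (ENNReal.ofReal_le_ofReal (sub_le_self _ ENNReal.toReal_nonneg)).trans ?_
  exact ENNReal.ofReal_toReal_le

/-! ### The weak differential inequality for test functions supported in one chart. -/

section ChartInequality

variable {n : ℕ} {M : Type*} [TopologicalSpace M] [ChartedSpace (EuclideanSpace ℝ (Fin n)) M]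
  [IsManifold (𝓡 n) ∞ M] [RiemannianBundle (fun x : M => TangentSpace (𝓡 n) x)]

/-- A function supported in the source of a preferred chart, read in the chart. -/
def chartExtend {n : ℕ} {M : Type*} [TopologicalSpace M]
    [ChartedSpace (EuclideanSpace ℝ (Fin n)) M] (x : M) (W : M → ℝ) : EuclideanSpace ℝ (Fin n) → ℝ :=
  (extChartAt (𝓡 n) x).target.indicator (W ∘ (extChartAt (𝓡 n) x).symm)

theorem chartExtend_eventuallyEq {x : M} {W : M → ℝ} {y : EuclideanSpace ℝ (Fin n)}
    (hy : y ∈ (extChartAt (𝓡 n) x).target) :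
    chartExtend x W =ᶠ[𝓝 y] W ∘ (extChartAt (𝓡 n) x).symm := by
  filter_upwards [(isOpen_extChartAt_target x).mem_nhds hy] with z hz
  exact indicator_of_mem hz _

variable [CompactSpace M] [T2Space M]

theorem tsupport_chartExtend_subset {x : M} {W : M → ℝ}
    (hW : tsupport W ⊆ (extChartAt (𝓡 n) x).source) :
    tsupport (chartExtend (n := n) x W) ⊆ extChartAt (𝓡 n) x '' tsupport W := by
  have hc : IsCompact (extChartAt (𝓡 n) x '' tsupport W) :=
    ((isClosed_tsupport W).isCompact).image_of_continuousOn ((continuousOn_extChartAt x).mono hW)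
  refine closure_minimal ?_ hc.isClosed
  intro y hy
  have hyt : y ∈ (extChartAt (𝓡 n) x).target := by
    by_contra h
    exact hy (indicator_of_notMem h _)
  rw [Function.mem_support, chartExtend, indicator_of_mem hyt] at hy
  exact ⟨(extChartAt (𝓡 n) x).symm y, subset_tsupport _ hy, (extChartAt (𝓡 n) x).right_inv hyt⟩

theorem hasCompactSupport_chartExtend {x : M} {W : M → ℝ}
    (hW : tsupport W ⊆ (extChartAt (𝓡 n) x).source) :
    HasCompactSupport (chartExtend (n := n) x W) := by
  have hc : IsCompact (extChartAt (𝓡 n) x '' tsupport W) :=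
    ((isClosed_tsupport W).isCompact).image_of_continuousOn ((continuousOn_extChartAt x).mono hW)
  exact hc.of_isClosed_subset (isClosed_tsupport _) (tsupport_chartExtend_subset hW)

theorem contDiff_chartExtend {x : M} {W : M → ℝ} {k : WithTop ℕ∞} (hk : k ≤ (∞ : WithTop ℕ∞))
    (hWk : ContMDiff (𝓡 n) 𝓘(ℝ, ℝ) k W) (hW : tsupport W ⊆ (extChartAt (𝓡 n) x).source) :
    ContDiff ℝ k (chartExtend (n := n) x W) := by
  refine contDiff_of_contDiffOn_of_tsupport_subset (isOpen_extChartAt_target (I := 𝓡 n) x) ?_ ?_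
  · have h := contDiffOn_comp_symm hk (contMDiffOn_univ.mpr hWk) x
    refine (h.mono (t := (extChartAt (𝓡 n) x).target) fun y hy => ⟨hy, mem_univ _⟩).congr ?_
    exact fun y hy => indicator_of_mem hy _
  · refine (tsupport_chartExtend_subset hW).trans ?_
    rintro _ ⟨p, hp, rfl⟩
    exact (extChartAt (𝓡 n) x).map_source (hW hp)

variable [MeasurableSpace M] [BorelSpace M]
  [IsContMDiffRiemannianBundle (𝓡 n) ∞ (EuclideanSpace ℝ (Fin n))
      (fun x : M => TangentSpace (𝓡 n) x)]

theorem pairing_eq_zero_of_notMem_tsupport (u : M → ℝ) {W : M → ℝ} {p : M} (hp : p ∉ tsupport W) :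
    pairing n u W p = 0 := by
  have h : W =ᶠ[𝓝 p] fun _ => 0 := by
    filter_upwards [(isClosed_tsupport W).isOpen_compl.mem_nhds hp] with q hq
    exact image_eq_zero_of_notMem_tsupport hq
  rw [pairing_congr (EventuallyEq.refl _ u) h, pairing_const]

theorem gradNorm_pow_eq_rpow (hn : 3 ≤ n) (u : M → ℝ) (p : M) :
    gradNorm (baseMetric n M) u p ^ (n - 2) = pairing n u u p ^ (((n : ℝ) - 2) / 2) := by
  rw [gradNorm_baseMetric, Real.sqrt_eq_rpow, ← Real.rpow_natCast,
    ← Real.rpow_mul (pairing_self_nonneg u p), Nat.cast_sub (by omega)]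
  congr 1
  push_cast
  ring

/-- The integral inequality for a test function supported in a chart. -/
theorem integral_pairing_chart (hn : 3 ≤ n) {Ω : Set M} (hΩ : IsOpen Ω) {u : M → ℝ}
    (hu : ContMDiffOn (𝓡 n) 𝓘(ℝ, ℝ) ∞ u Ω) {x : M} {C : ℝ}
    {W : M → ℝ} (hW : ContMDiff (𝓡 n) 𝓘(ℝ, ℝ) 1 W) (hW0 : ∀ p, 0 ≤ W p)
    (hWx : tsupport W ⊆ (extChartAt (𝓡 n) x).source) (hWΩ : tsupport W ⊆ Ω)
    (hC : ∀ p ∈ tsupport W, ∀ a,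
      ricciForm (chrMap (metricMatrix (baseMetric n M) x)) (extChartAt (𝓡 n) x p) a a ≤
        C * matForm (metricMatrix (baseMetric n M) x (extChartAt (𝓡 n) x p)) a a)
    (hmeas : AEMeasurable (fun p => ricciNeg (conformal u (baseMetric n M)) p *
      gradNorm (baseMetric n M) u p ^ (n - 2) * Real.exp (2 * u p))
      ((baseVolume n M).restrict Ω)) :
    Integrable (fun p => gradNorm (baseMetric n M) u p ^ (n - 2) * pairing n u W p)
      (baseVolume n M) ∧
    ENNReal.ofReal (-∫ p, gradNorm (baseMetric n M) u p ^ (n - 2) * pairing n u W p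
      ∂(baseVolume n M)) ≤
    ∫⁻ p, ENNReal.ofReal (W p * (ricciNeg (conformal u (baseMetric n M)) p *
      gradNorm (baseMetric n M) u p ^ (n - 2) * Real.exp (2 * u p) +
        C * gradNorm (baseMetric n M) u p ^ (n - 2))) ∂(baseVolume n M) := by
  set ν := baseVolume n M
  set G := metricMatrix (baseMetric n M) x with hGdef
  set f := u ∘ (extChartAt (𝓡 n) x).symm with hf
  set w := chartExtend (n := n) x W with hw
  set F : M → ℝ := fun p => gradNorm (baseMetric n M) u p ^ (n - 2) * pairing n u W p with hF
  set T := (extChartAt (𝓡 n) x).target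
  set s := (extChartAt (𝓡 n) x).source
  set S := chartDomain (n := n) x Ω with hSdef
  have hT : IsOpen T := isOpen_extChartAt_target x
  have hs : IsOpen s := isOpen_extChartAt_source x
  have hGT : IsMetricOn G T := isMetricOn_metricMatrix x
  have hGS : IsMetricOn G S := hGT.mono inter_subset_left
  have hS : IsOpen S := isOpen_chartDomain x hΩ
  have hwS : tsupport w ⊆ S := by
    refine (tsupport_chartExtend_subset hWx).trans ?_
    rintro _ ⟨p, hp, rfl⟩
    refine ⟨(extChartAt (𝓡 n) x).map_source (hWx hp), ?_⟩
    rw [mem_preimage, (extChartAt (𝓡 n) x).left_inv (hWx hp)]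
    exact hWΩ hp
  obtain ⟨hI1, hI2, hI⟩ := hGS.integral_conformal_ricci (f := f) (w := w) hn hS
    (contDiffOn_comp_symm le_rfl hu x)
    (contDiff_chartExtend ENat.LEInfty.out hW hWx) (hasCompactSupport_chartExtend hWx) hwS
  have hF0 : ∀ p, p ∉ tsupport W → F p = 0 := by
    intro p hp
    simp only [hF, pairing_eq_zero_of_notMem_tsupport u hp, mul_zero]
  have hud : ∀ p ∈ Ω, MDifferentiableAt (𝓡 n) 𝓘(ℝ, ℝ) u p := fun p hp =>
    (hu.contMDiffAt (hΩ.mem_nhds hp)).mdifferentiableAt (by simp)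
  have hWd : ∀ p, MDifferentiableAt (𝓡 n) 𝓘(ℝ, ℝ) W p := fun p =>
    hW.contMDiffAt.mdifferentiableAt (by simp)
  have hgc : ContinuousOn (fun p => gradNorm (baseMetric n M) u p ^ (n - 2)) Ω :=
    (continuousOn_gradNorm hΩ hu).pow _
  have hFm : AEStronglyMeasurable F ν := by
    have h1 : Ω.indicator F = F := by
      refine indicator_eq_self.mpr fun p hp => ?_
      by_contra h
      exact hp (hF0 p fun h' => h (hWΩ h'))
    rw [← h1, aestronglyMeasurable_indicator_iff hΩ.measurableSet]
    refine ContinuousOn.aestronglyMeasurable (hgc.mul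
      (continuousOn_pairing hΩ hu hW.contMDiffOn)) hΩ.measurableSet
  have hq : ∀ y ∈ S, fderiv ℝ f y (gradVec G f y) =
      pairing n u u ((extChartAt (𝓡 n) x).symm y) := by
    intro y hy
    rw [pairing_eq_chart ((extChartAt (𝓡 n) x).map_target hy.1) (hud _ hy.2) (hud _ hy.2),
      (extChartAt (𝓡 n) x).right_inv hy.1]
  have hchart : ∀ y ∈ T, √(G y).det * F ((extChartAt (𝓡 n) x).symm y) =
      √(G y).det * fderiv ℝ f y (gradVec G f y) ^ (((n : ℝ) - 2) / 2) *
        fderiv ℝ w y (gradVec G f y) := by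
    intro y hy
    have hyinv := (extChartAt (𝓡 n) x).right_inv hy
    by_cases hyw : (extChartAt (𝓡 n) x).symm y ∈ tsupport W
    · have hyS : y ∈ S := ⟨hy, hWΩ hyw⟩
      simp only [hF]
      rw [gradNorm_pow_eq_rpow hn, ← hq y hyS,
        pairing_eq_chart (hWx hyw) (hud _ hyS.2) (hWd _), hyinv,
        (chartExtend_eventuallyEq hy).fderiv_eq, mul_assoc]
    · rw [hF0 _ hyw, fderiv_of_notMem_tsupport ℝ (f := w) (x := y)]
      · simp
      · intro h
        obtain ⟨p, hp, rfl⟩ := tsupport_chartExtend_subset hWx h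
        rw [(extChartAt (𝓡 n) x).left_inv (hWx hp)] at hyw
        exact hyw hp
  have hoff : ∀ y, y ∉ T → √(G y).det * fderiv ℝ f y (gradVec G f y) ^ (((n : ℝ) - 2) / 2) *
        fderiv ℝ w y (gradVec G f y) = 0 := by
    intro y hy
    rw [fderiv_of_notMem_tsupport ℝ fun h => hy (hwS h).1]
    simp
  have hint : IntegrableOn F s ν := by
    rw [integrableOn_source_baseVolume_iff x hFm.restrict]
    exact hI1.integrableOn.congr_fun (fun y hy => (hchart y hy).symm) hT.measurableSet
  have hsupp : Function.support F ⊆ s := by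
    intro p hp
    by_contra h
    exact hp (hF0 p fun h' => h (hWx h'))
  refine ⟨(integrableOn_iff_integrable_of_support_subset hsupp).mp hint, ?_⟩
  have hval : ∫ p, F p ∂ν = ∫ z, √(G z).det * w z *
      fderiv ℝ f z (gradVec G f z) ^ (((n : ℝ) - 2) / 2 - 1) *
        (ricciForm (chrMap fun z => Real.exp (2 * f z) • G z) z (gradVec G f z) (gradVec G f z)
          - ricciForm (chrMap G) z (gradVec G f z) (gradVec G f z)) := by
    rw [← hI, ← setIntegral_eq_integral_of_forall_compl_eq_zero (s := s)
      (fun p hp => by by_contra h; exact hp (hsupp h)),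
      setIntegral_source_baseVolume x hFm.restrict,
      ← setIntegral_eq_integral_of_forall_compl_eq_zero (s := T) hoff]
    exact setIntegral_congr_fun hT.measurableSet hchart
  rw [hval, ← integral_neg]
  -- From here the curvature side is a lower integral with values in [0, ∞], so no integrability of
  -- Ric⁻ has to be known.
  refine (ofReal_integral_le_lintegral_ofReal hI2.neg).trans ?_
  set B : M → ℝ≥0∞ := fun p => ENNReal.ofReal (W p * (ricciNeg (conformal u (baseMetric n M)) p *
      gradNorm (baseMetric n M) u p ^ (n - 2) * Real.exp (2 * u p) +
        C * gradNorm (baseMetric n M) u p ^ (n - 2))) with hB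
  have hBm : AEMeasurable B ν := by
    have h1 : Ω.indicator B = B := by
      refine indicator_eq_self.mpr fun p hp => ?_
      by_contra h
      refine hp ?_
      simp only [hB, image_eq_zero_of_notMem_tsupport fun h' => h (hWΩ h'), zero_mul,
        ENNReal.ofReal_zero]
    rw [← h1, aemeasurable_indicator_iff hΩ.measurableSet]
    refine AEMeasurable.ennreal_ofReal (AEMeasurable.mul ?_ (hmeas.add ?_))
    · exact hW.continuous.aemeasurable
    · exact (continuousOn_const.mul hgc).aemeasurable hΩ.measurableSet
  refine le_trans ?_ (setLIntegral_le_lintegral s B)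
  rw [setLIntegral_source_baseVolume x hBm.restrict, ← lintegral_indicator hT.measurableSet]
  refine lintegral_mono fun y => ?_
  rw [Pi.neg_apply]
  by_cases hyw : y ∈ tsupport w
  swap
  · simp [image_eq_zero_of_notMem_tsupport hyw]
  have hyS := hwS hyw
  have hyT : y ∈ T := hyS.1
  rw [indicator_of_mem hyT]
  have hww : w y = W ((extChartAt (𝓡 n) x).symm y) := indicator_of_mem hyT _
  simp only [hB]
  rw [← ENNReal.ofReal_mul (Real.sqrt_nonneg _)]
  refine ENNReal.ofReal_le_ofReal ?_
  set p := (extChartAt (𝓡 n) x).symm y with hp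
  have hps : p ∈ s := (extChartAt (𝓡 n) x).map_target hyT
  have hpy : extChartAt (𝓡 n) x p = y := (extChartAt (𝓡 n) x).right_inv hyT
  have hpW : p ∈ tsupport W := by
    obtain ⟨p', hp', h⟩ := tsupport_chartExtend_subset hWx hyw
    rwa [hp, ← h, (extChartAt (𝓡 n) x).left_inv (hWx hp')]
  set U := gradVec G f y with hU
  have hGU : matForm (G y) U U = pairing n u u p := by
    rw [hGT.matForm_gradVec hyT, ← hq y hyS]
  have h1 := neg_ricciNeg_mul_le_chart hΩ hu hps hyS.2 U
  have h2 := hC p hpW U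
  rw [hpy] at h1 h2
  have e1 : matForm (metricMatrix (conformal u (baseMetric n M)) x y) U U =
      Real.exp (2 * u p) * pairing n u u p := by
    have : metricMatrix (conformal u (baseMetric n M)) x y = Real.exp (2 * u p) • G y := rfl
    rw [this, matForm_smul, _root_.smul_apply, _root_.smul_apply, hGU, smul_eq_mul]
  rw [e1] at h1
  rw [hGU] at h2
  have h3 : ricciForm (chrMap (metricMatrix (conformal u (baseMetric n M)) x)) y U U =
    ricciForm (chrMap fun z => Real.exp (2 * f z) • G z) y U U := rfl
  rw [h3] at h1
  rw [gradNorm_pow_eq_rpow hn, hww, hq y hyS]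
  have hW0p := hW0 p
  have hq0 := pairing_self_nonneg (n := n) u p
  set Q := pairing n u u p with hQ
  set D := ricciForm (chrMap fun z => Real.exp (2 * f z) • G z) y U U - ricciForm (chrMap G) y U U
    with hD
  set ρ := ricciNeg (conformal u (baseMetric n M)) p with hρ
  -- The conformal Ricci form is at least −ρ times g(U, U) = e^(2u) Q, and the background one is at
  -- most C Q.
  have h4 : -D ≤ (ρ * Real.exp (2 * u p) + C) * Q := by
    rw [hD]; linarith
  have hn' : (3 : ℝ) ≤ n := by exact_mod_cast hn
  -- True also at Q = 0, because the exponent (n − 2)/2 is positive.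
  have h5 : Q ^ (((n : ℝ) - 2) / 2 - 1) * Q = Q ^ (((n : ℝ) - 2) / 2) := by
    rcases hq0.eq_or_lt with h0 | h0
    · rw [← h0, mul_zero, Real.zero_rpow (by linarith)]
    · nth_rewrite 2 [← Real.rpow_one Q]
      rw [← Real.rpow_add h0]
      congr 1; ring
  have h6 : 0 ≤ √(G y).det * W p * Q ^ (((n : ℝ) - 2) / 2 - 1) := by positivity
  calc -(√(G y).det * W p * Q ^ (((n : ℝ) - 2) / 2 - 1) * D)
      = √(G y).det * W p * Q ^ (((n : ℝ) - 2) / 2 - 1) * (-D) := by ring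
    _ ≤ √(G y).det * W p * Q ^ (((n : ℝ) - 2) / 2 - 1) * ((ρ * Real.exp (2 * u p) + C) * Q) := by
        gcongr
    _ = √(G y).det * (W p * (ρ * (Q ^ (((n : ℝ) - 2) / 2 - 1) * Q) * Real.exp (2 * u p) +
          C * (Q ^ (((n : ℝ) - 2) / 2 - 1) * Q))) := by ring
    _ = _ := by rw [h5]

end ChartInequality
end ConformalHuber
end

noncomputable section
namespace ConformalHuber

theorem ofReal_sum_le {ι : Type*} (s : Finset ι) (f : ι → ℝ) :
    ENNReal.ofReal (∑ i ∈ s, f i) ≤ ∑ i ∈ s, ENNReal.ofReal (f i) := by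
  classical
  induction s using Finset.induction_on with
  | empty => simp
  | insert i s hi ih =>
    rw [Finset.sum_insert hi, Finset.sum_insert hi]
    exact ENNReal.ofReal_add_le.trans (by gcongr)

/-- Superadditivity of the lower integral needs no measurability and is the direction used in
summing the local inequalities. -/
theorem sum_lintegral_le_lintegral_sum {X ι : Type*} [MeasurableSpace X] (μ : Measure X)
    (s : Finset ι) (f : ι → X → ℝ≥0∞) :
    ∑ i ∈ s, ∫⁻ x, f i x ∂μ ≤ ∫⁻ x, ∑ i ∈ s, f i x ∂μ := by
  classical
  induction s using Finset.induction_on with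
  | empty => simp
  | insert i s hi ih =>
    simp only [Finset.sum_insert hi]
    exact (add_le_add_right ih _).trans (le_lintegral_add _ _)

/-! ### The weak differential inequality on Ω. -/

section Global

variable {n : ℕ} {M : Type*} [TopologicalSpace M] [ChartedSpace (EuclideanSpace ℝ (Fin n)) M]
  [IsManifold (𝓡 n) ∞ M] [RiemannianBundle (fun x : M => TangentSpace (𝓡 n) x)]
  [CompactSpace M] [T2Space M] [MeasurableSpace M] [BorelSpace M]
  [IsContMDiffRiemannianBundle (𝓡 n) ∞ (EuclideanSpace ℝ (Fin n))
      (fun x : M => TangentSpace (𝓡 n) x)]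

/-- The integral inequality for an arbitrary test function supported in `Ω`. -/
theorem exists_integral_pairing_le (hn : 3 ≤ n) {Ω : Set M} (hΩ : IsOpen Ω) {u : M → ℝ}
    (hu : ContMDiffOn (𝓡 n) 𝓘(ℝ, ℝ) ∞ u Ω)
    (hmeas : AEMeasurable (fun p => ricciNeg (conformal u (baseMetric n M)) p *
      gradNorm (baseMetric n M) u p ^ (n - 2) * Real.exp (2 * u p))
      ((baseVolume n M).restrict Ω)) :
    ∃ C : ℝ, 0 ≤ C ∧ ∀ W : M → ℝ, ContMDiff (𝓡 n) 𝓘(ℝ, ℝ) 1 W → (∀ p, 0 ≤ W p) →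
      tsupport W ⊆ Ω →
      Integrable (fun p => gradNorm (baseMetric n M) u p ^ (n - 2) * pairing n u W p)
        (baseVolume n M) ∧
      ENNReal.ofReal (-∫ p, gradNorm (baseMetric n M) u p ^ (n - 2) * pairing n u W p
        ∂(baseVolume n M)) ≤
      ∫⁻ p, ENNReal.ofReal (W p * (ricciNeg (conformal u (baseMetric n M)) p *
        gradNorm (baseMetric n M) u p ^ (n - 2) * Real.exp (2 * u p) +
          C * gradNorm (baseMetric n M) u p ^ (n - 2))) ∂(baseVolume n M) := by
  obtain ⟨c, hc⟩ := isCompact_univ.elim_finite_subcover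
    (fun x : M => (extChartAt (𝓡 n) x).source) (fun x => isOpen_extChartAt_source x)
    (fun x _ => mem_iUnion.mpr ⟨x, mem_extChartAt_source x⟩)
  obtain ⟨ρ, hρ⟩ := SmoothPartitionOfUnity.exists_isSubordinate (𝓡 n) (isClosed_univ (X := M))
    (fun x : c => (extChartAt (𝓡 n) (x : M)).source) (fun x => isOpen_extChartAt_source _)
    (by
      intro p hp
      have := hc hp
      simp only [mem_iUnion] at this ⊢
      obtain ⟨i, hi, hpi⟩ := this
      exact ⟨⟨i, hi⟩, hpi⟩)
  have hex : ∀ i : c, ∃ C, 0 ≤ C ∧ ∀ y ∈ extChartAt (𝓡 n) (i : M) '' tsupport (ρ i), ∀ a,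
      |ricciForm (chrMap (metricMatrix (baseMetric n M) (i : M))) y a a| ≤
        C * matForm (metricMatrix (baseMetric n M) (i : M) y) a a := by
    intro i
    refine (isMetricOn_metricMatrix (i : M)).exists_ricciForm_le (isOpen_extChartAt_target _) ?_ ?_
    · exact ((isClosed_tsupport _).isCompact).image_of_continuousOn
        ((continuousOn_extChartAt _).mono (hρ i))
    · rintro _ ⟨p, hp, rfl⟩
      exact (extChartAt (𝓡 n) (i : M)).map_source (hρ i hp)
  choose C hC0 hC using hex
  -- The sum dominates every local constant, so one C serves in all charts and does not depend on W.
  refine ⟨∑ i, C i, Finset.sum_nonneg fun i _ => hC0 i, fun W hW hW0 hWΩ => ?_⟩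
  have hsum1 : ∀ p, ∑ i, ρ i p = 1 := by
    intro p
    rw [← finsum_eq_sum_of_fintype]
    exact ρ.sum_eq_one (mem_univ p)
  have hWi : ∀ i, ContMDiff (𝓡 n) 𝓘(ℝ, ℝ) 1 fun p => ρ i p * W p := fun i =>
    ((ρ i).contMDiff.of_le ENat.LEInfty.out).mul hW
  have hWi0 : ∀ i p, 0 ≤ ρ i p * W p := fun i p => mul_nonneg (ρ.nonneg i p) (hW0 p)
  have hts1 : ∀ i, tsupport (fun p => ρ i p * W p) ⊆ tsupport (ρ i) := fun i =>
    tsupport_mul_subset_left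
  have hts2 : ∀ i, tsupport (fun p => ρ i p * W p) ⊆ tsupport W := fun i =>
    tsupport_mul_subset_right
  have key := fun i : c => integral_pairing_chart hn hΩ hu (x := (i : M)) (C := ∑ i, C i) (hWi i)
    (hWi0 i) ((hts1 i).trans (hρ i)) ((hts2 i).trans hWΩ) (by
      intro p hp a
      have hpt := hts1 i hp
      have h1 := (le_abs_self _).trans (hC i _ ⟨p, hpt, rfl⟩ a)
      refine h1.trans (mul_le_mul_of_nonneg_right
        (Finset.single_le_sum (fun i _ => hC0 i) (Finset.mem_univ i)) ?_)
      by_cases ha : a = 0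
      · simp [ha]
      · exact ((isMetricOn_metricMatrix (i : M)).pos _
          ((extChartAt (𝓡 n) (i : M)).map_source (hρ i hpt)) a ha).le) hmeas
  -- The left side is linear in W, so the gradients of the partition functions cancel in the sum and
  -- need no estimate.
  have hpair : ∀ p, gradNorm (baseMetric n M) u p ^ (n - 2) * pairing n u W p =
      ∑ i, gradNorm (baseMetric n M) u p ^ (n - 2) * pairing n u (fun p => ρ i p * W p) p := by
    intro p
    rw [← Finset.mul_sum, ← pairing_sum]
    · congr 2
      funext q
      rw [← Finset.sum_mul, hsum1, one_mul]
    · exact fun i _ => (hWi i).contMDiffAt.mdifferentiableAt (by simp)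
  simp only [hpair]
  refine ⟨integrable_finsetSum _ fun i _ => (key i).1, ?_⟩
  rw [integral_finsetSum _ fun i _ => (key i).1, ← Finset.sum_neg_distrib]
  refine (ofReal_sum_le _ _).trans ((Finset.sum_le_sum fun i _ => (key i).2).trans
    ((sum_lintegral_le_lintegral_sum _ _ _).trans (le_of_eq (lintegral_congr fun p => ?_))))
  have hB : 0 ≤ ricciNeg (conformal u (baseMetric n M)) p *
        gradNorm (baseMetric n M) u p ^ (n - 2) * Real.exp (2 * u p) +
          (∑ i, C i) * gradNorm (baseMetric n M) u p ^ (n - 2) := by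
    have h1 : 0 ≤ ricciNeg (conformal u (baseMetric n M)) p := le_max_left _ _
    have h2 := gradNorm_nonneg (baseMetric n M) u p
    have h3 : 0 ≤ ∑ i, C i := Finset.sum_nonneg fun i _ => hC0 i
    positivity
  rw [← ENNReal.ofReal_sum_of_nonneg fun i _ => mul_nonneg (hWi0 i p) hB, ← Finset.sum_mul,
    ← Finset.sum_mul, hsum1, one_mul]

end Global
end ConformalHuber
end

noncomputable section
namespace ConformalHuber

/-! ### The truncated cube and Young's inequality. -/

section RealLemmas

/-- The power three makes the test function C¹ and puts a factor 3 in front of the energy, enough to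
absorb two terms with constant one each. -/
theorem hasDerivAt_max_zero_cube (s : ℝ) :
    HasDerivAt (fun s : ℝ => max s 0 ^ 3) (3 * max s 0 ^ 2) s := by
  rcases lt_trichotomy s 0 with h | h | h
  · have h1 : (fun s : ℝ => max s 0 ^ 3) =ᶠ[𝓝 s] fun _ => 0 := by
      filter_upwards [Iio_mem_nhds h] with t ht
      rw [max_eq_right (le_of_lt ht)]; norm_num
    rw [max_eq_right h.le]
    simpa using (hasDerivAt_const s (0 : ℝ)).congr_of_eventuallyEq h1
  · subst h
    have h1 : (fun s : ℝ => max s 0 ^ 3) =O[𝓝 0] fun s : ℝ => s ^ 3 := by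
      refine Asymptotics.IsBigO.of_bound 1 (Eventually.of_forall fun t => ?_)
      rw [norm_pow, norm_pow, one_mul]
      gcongr
      rw [Real.norm_eq_abs, Real.norm_eq_abs, abs_of_nonneg (le_max_right _ _)]
      exact max_le (le_abs_self t) (abs_nonneg t)
    have h2 : (fun s : ℝ => s ^ 3) =o[𝓝 0] fun s : ℝ => s := by
      simpa using Asymptotics.isLittleO_pow_id (𝕜 := ℝ) (n := 3) (by norm_num)
    rw [hasDerivAt_iff_isLittleO]
    simpa using h1.trans_isLittleO h2
  · have h1 : (fun s : ℝ => max s 0 ^ 3) =ᶠ[𝓝 s] fun t => t ^ 3 := by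
      filter_upwards [Ioi_mem_nhds h] with t ht
      rw [max_eq_left (le_of_lt ht)]
    rw [max_eq_left h.le]
    simpa using (hasDerivAt_pow 3 s).congr_of_eventuallyEq h1

theorem hasDerivAt_cutoff (T t : ℝ) :
    HasDerivAt (fun t : ℝ => max (T - t) 0 ^ 3) (-(3 * max (T - t) 0 ^ 2)) t := by
  have h := (hasDerivAt_max_zero_cube (T - t)).comp t ((hasDerivAt_id t).const_sub T)
  simpa [Function.comp_def] using h

theorem contDiff_cutoff (T : ℝ) : ContDiff ℝ 1 fun t : ℝ => max (T - t) 0 ^ 3 := by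
  rw [contDiff_one_iff_deriv]
  refine ⟨fun t => (hasDerivAt_cutoff T t).differentiableAt, ?_⟩
  have : deriv (fun t : ℝ => max (T - t) 0 ^ 3) = fun t => -(3 * max (T - t) 0 ^ 2) :=
    funext fun t => (hasDerivAt_cutoff T t).deriv
  rw [this]
  fun_prop

/-- A crude form of Young's inequality with exponents n/(n−2) and n/2: compare b with a². If b ≤ a²
the product is at most aⁿ, otherwise at most b^(n/2). -/
theorem pow_mul_le_add_rpow {n : ℕ} (hn : 2 ≤ n) {a b : ℝ} (ha : 0 ≤ a) (hb : 0 ≤ b) :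
    a ^ (n - 2) * b ≤ a ^ n + b ^ ((n : ℝ) / 2) := by
  have h2 : a ^ n = a ^ (n - 2) * a ^ 2 := by rw [← pow_add]; congr 1; omega
  have hr : 0 ≤ b ^ ((n : ℝ) / 2) := Real.rpow_nonneg hb _
  have hp : 0 ≤ a ^ n := pow_nonneg ha n
  rcases le_total b (a ^ 2) with h | h
  · have : a ^ (n - 2) * b ≤ a ^ n := by rw [h2]; gcongr
    linarith
  · have h3 : a ≤ √b := Real.le_sqrt_of_sq_le h
    have h4 : b ^ ((n : ℝ) / 2) = √b ^ n := by
      rw [Real.sqrt_eq_rpow, ← Real.rpow_natCast, ← Real.rpow_mul hb]; congr 1; ring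
    have h5 : √b ^ n = √b ^ (n - 2) * b := by
      rw [← Real.sq_sqrt hb, Real.sqrt_sq (Real.sqrt_nonneg b), ← pow_add]; congr 1; omega
    have : a ^ (n - 2) * b ≤ b ^ ((n : ℝ) / 2) := by rw [h4, h5]; gcongr
    linarith

/-- The elementary inequality that absorbs a lower-order term. -/
theorem cube_mul_pow_mul_le {n : ℕ} (hn : 2 ≤ n) {a b s L : ℝ} (ha : 0 ≤ a) (hb : 0 ≤ b)
    (hs : 0 ≤ s) (hsL : s ≤ L) :
    s ^ 3 * (a ^ (n - 2) * b) ≤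
      s ^ 2 * a ^ n + L ^ (2 + (n : ℝ) / 2) * b ^ ((n : ℝ) / 2) := by
  -- One factor s is grouped with b, so that s² remains in front of aⁿ.
  have h1 := pow_mul_le_add_rpow hn ha (mul_nonneg hs hb)
  have hL : 0 ≤ L := hs.trans hsL
  have h2 : s ^ 2 * (s * b) ^ ((n : ℝ) / 2) ≤ L ^ (2 + (n : ℝ) / 2) * b ^ ((n : ℝ) / 2) := by
    have hn0 : 0 < (n : ℝ) / 2 := by positivity
    rw [Real.mul_rpow hs hb, Real.rpow_add_of_nonneg hL (by norm_num) hn0.le, Real.rpow_two,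
      ← mul_assoc]
    have : s ^ ((n : ℝ) / 2) ≤ L ^ ((n : ℝ) / 2) := Real.rpow_le_rpow hs hsL hn0.le
    gcongr
  calc s ^ 3 * (a ^ (n - 2) * b) = s ^ 2 * (a ^ (n - 2) * (s * b)) := by ring
    _ ≤ s ^ 2 * (a ^ n + (s * b) ^ ((n : ℝ) / 2)) := by gcongr
    _ = s ^ 2 * a ^ n + s ^ 2 * (s * b) ^ ((n : ℝ) / 2) := by ring
    _ ≤ _ := by linarith

end RealLemmas

/-! ### Compactness of the sublevel sets. -/

section Sublevel

variable {X : Type*} [TopologicalSpace X] [CompactSpace X] {Ω : Set X} {u : X → ℝ}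

/-- A limit point outside Ω would lie on the frontier, where u tends to infinity. The sublevel sets
are therefore compact subsets of Ω. -/
theorem isClosed_sublevel (hΩ : IsOpen Ω) (hu : ContinuousOn u Ω)
    (hlim : ∀ z ∈ frontier Ω, Tendsto u (𝓝[Ω] z) atTop) (T : ℝ) :
    IsClosed {p | p ∈ Ω ∧ u p ≤ T} := by
  refine isClosed_of_closure_subset fun p hp => ?_
  have hne : (𝓝[{p | p ∈ Ω ∧ u p ≤ T}] p).NeBot := mem_closure_iff_nhdsWithin_neBot.mp hp
  have hle : 𝓝[{p | p ∈ Ω ∧ u p ≤ T}] p ≤ 𝓝[Ω] p := nhdsWithin_mono _ fun q hq => hq.1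
  have hpc : p ∈ closure Ω := closure_mono (fun q hq => hq.1) hp
  have hpΩ : p ∈ Ω := by
    by_contra hpn
    have hf : p ∈ frontier Ω := by rw [hΩ.frontier_eq]; exact ⟨hpc, hpn⟩
    have h1 := ((hlim p hf).mono_left hle).eventually (eventually_gt_atTop T)
    obtain ⟨q, hq1, hq2⟩ := (h1.and self_mem_nhdsWithin).exists
    exact absurd hq2.2 (not_le.mpr hq1)
  refine ⟨hpΩ, ?_⟩
  have h1 : Tendsto u (𝓝[{p | p ∈ Ω ∧ u p ≤ T}] p) (𝓝 (u p)) := (hu p hpΩ).mono_left hle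
  exact le_of_tendsto h1 (eventually_mem_nhdsWithin.mono fun q hq => hq.2)

theorem exists_lower_bound (hΩ : IsOpen Ω) (hne : Ω.Nonempty) (hu : ContinuousOn u Ω)
    (hlim : ∀ z ∈ frontier Ω, Tendsto u (𝓝[Ω] z) atTop) : ∃ b, ∀ p ∈ Ω, b ≤ u p := by
  obtain ⟨p0, hp0⟩ := hne
  have hc := (isClosed_sublevel hΩ hu hlim (u p0)).isCompact
  obtain ⟨q, hq, hmin⟩ := hc.exists_isMinOn ⟨p0, hp0, le_rfl⟩ (hu.mono fun q hq => hq.1)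
  refine ⟨u q, fun p hp => ?_⟩
  rcases le_total (u p) (u p0) with h | h
  · exact hmin ⟨hp, h⟩
  · exact hq.2.trans h

end Sublevel
end ConformalHuber
end

noncomputable section
namespace ConformalHuber

/-! ### Growth of the n-energy of u on sublevel sets. -/

section Energy

variable {n : ℕ} {M : Type*} [TopologicalSpace M] [ChartedSpace (EuclideanSpace ℝ (Fin n)) M]
  [IsManifold (𝓡 n) ∞ M] [RiemannianBundle (fun x : M => TangentSpace (𝓡 n) x)]
  [CompactSpace M] [T2Space M] [MeasurableSpace M] [BorelSpace M]
  [IsContMDiffRiemannianBundle (𝓡 n) ∞ (EuclideanSpace ℝ (Fin n))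
      (fun x : M => TangentSpace (𝓡 n) x)]

/-- Either integrability hypothesis bounds the curvature term in the integral inequality. -/
theorem exists_curvature_bound (hn : 3 ≤ n) {Ω : Set M} (hΩ : IsOpen Ω) {u : M → ℝ}
    (hu : ContMDiffOn (𝓡 n) 𝓘(ℝ, ℝ) ∞ u Ω)
    (hRic : MemLp (ricciNeg (conformal u (baseMetric n M))) ((n : ℝ≥0∞) / 2)
        (riemVolume (conformal u (baseMetric n M)) Ω) ∨
      Integrable (fun x => ricciNeg (conformal u (baseMetric n M)) x *
            gradNorm (baseMetric n M) u x ^ (n - 2) * Real.exp (2 * u x))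
        (riemVolume (baseMetric n M) Ω)) :
    AEMeasurable (fun p => ricciNeg (conformal u (baseMetric n M)) p *
      gradNorm (baseMetric n M) u p ^ (n - 2) * Real.exp (2 * u p))
      ((baseVolume n M).restrict Ω) ∧
    ∃ k : M → ℝ≥0∞, ∫⁻ p in Ω, k p ∂(baseVolume n M) ≠ ⊤ ∧
      ∀ p s L, 0 ≤ s → s ≤ L → 1 ≤ L →
        ENNReal.ofReal (s ^ 3 * (ricciNeg (conformal u (baseMetric n M)) p *
          gradNorm (baseMetric n M) u p ^ (n - 2) * Real.exp (2 * u p))) ≤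
        ENNReal.ofReal (s ^ 2 * gradNorm (baseMetric n M) u p ^ n) +
          ENNReal.ofReal (L ^ (2 + (n : ℝ) / 2)) * k p := by
  have hr0 : ∀ p, 0 ≤ ricciNeg (conformal u (baseMetric n M)) p := fun p => le_max_left _ _
  have hg0 := fun p => gradNorm_nonneg (baseMetric n M) u p
  have hgc : ContinuousOn (fun p => gradNorm (baseMetric n M) u p ^ (n - 2)) Ω :=
    (continuousOn_gradNorm hΩ hu).pow _
  have huc : ContinuousOn u Ω := hu.continuousOn
  have hn' : (3 : ℝ) ≤ n := by exact_mod_cast hn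
  rcases hRic with h | h
  · rw [riemVolume_conformal hΩ huc] at h
    have hρ : AEMeasurable (fun p => ENNReal.ofReal (Real.exp (n * u p)))
        ((baseVolume n M).restrict Ω) :=
      (ContinuousOn.aemeasurable (continuousOn_const.mul huc).rexp hΩ.measurableSet).ennreal_ofReal
    -- The density e^(nu) is strictly positive, so null sets of the conformal volume are null for
    -- the background volume on Ω.
    have hrm : AEMeasurable (ricciNeg (conformal u (baseMetric n M)))
        ((baseVolume n M).restrict Ω) :=
      h.1.aemeasurable.mono_ac (withDensity_absolutelyContinuous' hρ
        (Eventually.of_forall fun p => by simp [Real.exp_pos]))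
    refine ⟨(hrm.mul (hgc.aemeasurable hΩ.measurableSet)).mul
      (ContinuousOn.aemeasurable (continuousOn_const.mul huc).rexp hΩ.measurableSet), ?_⟩
    have hp0 : ((n : ℝ≥0∞) / 2) ≠ 0 := by simp; omega
    have hpt : ((n : ℝ≥0∞) / 2) ≠ ⊤ := by simp [ENNReal.div_eq_top]
    have hpr : ((n : ℝ≥0∞) / 2).toReal = (n : ℝ) / 2 := by simp [ENNReal.toReal_div]
    have hfin := (eLpNorm_lt_top_iff_lintegral_rpow_enorm_lt_top hp0 hpt).mp h.2
    rw [hpr, lintegral_withDensity_eq_lintegral_mul₀ hρ (by fun_prop)] at hfin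
    -- This is (Ric⁻ e^(2u))^(n/2), whose background integral is the n/2-norm of Ric⁻ for g raised
    -- to the power n/2.
    refine ⟨fun p => ENNReal.ofReal (Real.exp (n * u p)) *
      ‖ricciNeg (conformal u (baseMetric n M)) p‖ₑ ^ ((n : ℝ) / 2), hfin.ne, ?_⟩
    intro p s L hs hsL hL
    have key := cube_mul_pow_mul_le (n := n) (by omega) (hg0 p)
      (mul_nonneg (hr0 p) (Real.exp_pos (2 * u p)).le) hs hsL
    have e1 : s ^ 3 * (ricciNeg (conformal u (baseMetric n M)) p *
          gradNorm (baseMetric n M) u p ^ (n - 2) * Real.exp (2 * u p)) =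
        s ^ 3 * (gradNorm (baseMetric n M) u p ^ (n - 2) *
          (ricciNeg (conformal u (baseMetric n M)) p * Real.exp (2 * u p))) := by ring
    have e2 : (ricciNeg (conformal u (baseMetric n M)) p * Real.exp (2 * u p)) ^ ((n : ℝ) / 2) =
        Real.exp (n * u p) * ricciNeg (conformal u (baseMetric n M)) p ^ ((n : ℝ) / 2) := by
      rw [Real.mul_rpow (hr0 p) (Real.exp_pos _).le, ← Real.exp_mul, mul_comm]
      congr 2; ring
    rw [e1]
    refine (ENNReal.ofReal_le_ofReal key).trans (ENNReal.ofReal_add_le.trans ?_)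
    gcongr
    beta_reduce
    rw [ENNReal.ofReal_mul (Real.rpow_nonneg (by linarith) _), e2,
      ENNReal.ofReal_mul (Real.exp_pos _).le, Real.enorm_of_nonneg (hr0 p),
      ENNReal.ofReal_rpow_of_nonneg (hr0 p) (by positivity)]
  · rw [riemVolume_baseMetric hΩ] at h
    refine ⟨h.1.aemeasurable, fun p => ENNReal.ofReal (ricciNeg (conformal u (baseMetric n M)) p *
            gradNorm (baseMetric n M) u p ^ (n - 2) * Real.exp (2 * u p)),
      h.lintegral_lt_top.ne, ?_⟩
    intro p s L hs hsL hL
    refine le_add_left ?_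
    have h0 : 0 ≤ ricciNeg (conformal u (baseMetric n M)) p *
            gradNorm (baseMetric n M) u p ^ (n - 2) * Real.exp (2 * u p) :=
      mul_nonneg (mul_nonneg (hr0 p) (pow_nonneg (hg0 p) _)) (Real.exp_pos _).le
    rw [← ENNReal.ofReal_mul (Real.rpow_nonneg (by linarith) _)]
    refine ENNReal.ofReal_le_ofReal (mul_le_mul_of_nonneg_right ?_ h0)
    -- Under the second hypothesis nothing has to be absorbed; the power 2 + n/2 ≥ 3 is only there
    -- to match the first case.
    calc s ^ 3 ≤ L ^ 3 := by gcongr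
      _ = L ^ (3 : ℝ) := by norm_cast
      _ ≤ _ := Real.rpow_le_rpow_of_exponent_le hL (by linarith)

/-- The growth of the energy of `u` over its sublevel sets. -/
theorem exists_energy_bound (hn : 3 ≤ n) {Ω : Set M} (hΩ : IsOpen Ω) (hne : Ω.Nonempty) {u : M → ℝ}
    (hu : ContMDiffOn (𝓡 n) 𝓘(ℝ, ℝ) ∞ u Ω)
    (hlim : ∀ z ∈ frontier Ω, Tendsto u (𝓝[Ω] z) atTop)
    (hRic : MemLp (ricciNeg (conformal u (baseMetric n M))) ((n : ℝ≥0∞) / 2)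
        (riemVolume (conformal u (baseMetric n M)) Ω) ∨
      Integrable (fun x => ricciNeg (conformal u (baseMetric n M)) x *
            gradNorm (baseMetric n M) u x ^ (n - 2) * Real.exp (2 * u x))
        (riemVolume (baseMetric n M) Ω)) :
    ∃ (b : ℝ) (K : ℝ≥0∞), K ≠ ⊤ ∧ (∀ p ∈ Ω, b ≤ u p) ∧ ∀ L, 1 ≤ L →
      ∫⁻ p in {p | p ∈ Ω ∧ u p ≤ b + L}, ENNReal.ofReal (gradNorm (baseMetric n M) u p ^ n)
        ∂(baseVolume n M) ≤ ENNReal.ofReal (L ^ ((n : ℝ) / 2)) * K := by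
  have := isFiniteMeasure_baseVolume (n := n) (M := M)
  obtain ⟨b, hb⟩ := exists_lower_bound hΩ hne hu.continuousOn hlim
  obtain ⟨hmeas, k, hk, hkb⟩ := exists_curvature_bound hn hΩ hu hRic
  obtain ⟨C, hC, hineq⟩ := exists_integral_pairing_le hn hΩ hu hmeas
  set ν := baseVolume n M with hν
  set a : M → ℝ := gradNorm (baseMetric n M) u with ha
  have ha0 : ∀ p, 0 ≤ a p := fun p => gradNorm_nonneg (baseMetric n M) u p
  have hac : ContinuousOn a Ω := continuousOn_gradNorm hΩ hu
  have huc : ContinuousOn u Ω := hu.continuousOn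
  set k2 : ℝ≥0∞ := ∫⁻ p in Ω, (k p + ENNReal.ofReal (C ^ ((n : ℝ) / 2))) ∂ν with hk2
  have hk2t : k2 ≠ ⊤ := by
    rw [hk2, lintegral_add_right _ measurable_const]
    refine ENNReal.add_ne_top.mpr ⟨hk, ?_⟩
    rw [lintegral_const]
    exact ENNReal.mul_ne_top ENNReal.ofReal_ne_top (measure_ne_top _ _)
  have key : ∀ L, 1 ≤ L → ∫⁻ p in Ω, ENNReal.ofReal (max (b + L - u p) 0 ^ 2 * a p ^ n) ∂ν ≤
      ENNReal.ofReal (L ^ (2 + (n : ℝ) / 2)) * k2 := by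
    intro L hL
    set T := b + L with hT
    -- The extension by zero is C¹ on all of M because its support lies in a sublevel set, which is
    -- closed in M and contained in Ω.
    set W : M → ℝ := Ω.indicator fun p => max (T - u p) 0 ^ 3 with hW
    have hWcl := isClosed_sublevel hΩ huc hlim T
    have hWs : tsupport W ⊆ {p | p ∈ Ω ∧ u p ≤ T} := by
      refine closure_minimal (fun p hp => ?_) hWcl
      have hpΩ : p ∈ Ω := by
        by_contra h; exact hp (indicator_of_notMem h _)
      refine ⟨hpΩ, ?_⟩
      by_contra h
      refine hp ?_
      simp only [hW]
      rw [indicator_of_mem hpΩ, max_eq_right (by linarith)]; norm_num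
    have hWΩ : tsupport W ⊆ Ω := hWs.trans fun p hp => hp.1
    have hW0 : ∀ p, 0 ≤ W p := fun p =>
      indicator_nonneg (fun p _ => pow_nonneg (le_max_right _ _) 3) p
    have hWΩeq : ∀ p ∈ Ω, W =ᶠ[𝓝 p] fun p => max (T - u p) 0 ^ 3 := by
      intro p hp
      filter_upwards [hΩ.mem_nhds hp] with q hq
      exact indicator_of_mem hq _
    have hWc : ContMDiff (𝓡 n) 𝓘(ℝ, ℝ) 1 W := by
      intro p
      by_cases hp : p ∈ Ω
      · have h1 : ContMDiffAt (𝓡 n) 𝓘(ℝ, ℝ) 1 (fun p => max (T - u p) 0 ^ 3) p :=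
          (contDiff_cutoff T).contMDiff.contMDiffAt.comp p
            ((hu.contMDiffAt (hΩ.mem_nhds hp)).of_le ENat.LEInfty.out)
        exact h1.congr_of_eventuallyEq (hWΩeq p hp)
      · have h1 : W =ᶠ[𝓝 p] fun _ => 0 := by
          filter_upwards [(isClosed_tsupport W).isOpen_compl.mem_nhds fun h => hp (hWΩ h)] with q hq
          exact image_eq_zero_of_notMem_tsupport hq
        exact contMDiffAt_const.congr_of_eventuallyEq h1
    obtain ⟨hint, hle⟩ := hineq W hWc hW0 hWΩ
    have hud : ∀ p ∈ Ω, MDifferentiableAt (𝓡 n) 𝓘(ℝ, ℝ) u p := fun p hp =>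
      (hu.contMDiffAt (hΩ.mem_nhds hp)).mdifferentiableAt (by simp)
    have hpow : ∀ p, a p ^ n = a p ^ (n - 2) * a p ^ 2 := fun p => by
      rw [← pow_add]; congr 1; omega
    have hpair : ∀ p ∈ Ω, a p ^ (n - 2) * pairing n u W p =
        -(3 * (max (T - u p) 0 ^ 2 * a p ^ n)) := by
      intro p hp
      rw [pairing_congr (EventuallyEq.refl _ u) (hWΩeq p hp),
        pairing_comp (hud p hp) (hasDerivAt_cutoff T (u p)), ← gradNorm_sq, hpow]
      ring
    have hpair0 : ∀ p, p ∉ Ω → a p ^ (n - 2) * pairing n u W p = 0 := fun p hp => by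
      rw [pairing_eq_zero_of_notMem_tsupport u fun h => hp (hWΩ h), mul_zero]
    set A := ∫⁻ p in Ω, ENNReal.ofReal (max (T - u p) 0 ^ 2 * a p ^ n) ∂ν with hA
    have hf0 : ∀ p, 0 ≤ max (T - u p) 0 ^ 2 * a p ^ n := fun p =>
      mul_nonneg (sq_nonneg _) (pow_nonneg (ha0 p) n)
    have hAint : IntegrableOn (fun p => 3 * (max (T - u p) 0 ^ 2 * a p ^ n)) Ω ν := by
      refine (hint.neg.integrableOn (s := Ω)).congr_fun (fun p hp => ?_) hΩ.measurableSet
      rw [Pi.neg_apply, hpair p hp, neg_neg]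
    have hleft : ENNReal.ofReal (-∫ p, a p ^ (n - 2) * pairing n u W p ∂ν) = 3 * A := by
      rw [← integral_neg, ← setIntegral_eq_integral_of_forall_compl_eq_zero (s := Ω)
        (fun p hp => by rw [hpair0 p hp, neg_zero]),
        setIntegral_congr_fun hΩ.measurableSet (fun p hp => by
          show -(a p ^ (n - 2) * pairing n u W p) = 3 * (max (T - u p) 0 ^ 2 * a p ^ n)
          rw [hpair p hp, neg_neg]),
        ofReal_integral_eq_lintegral_ofReal hAint
          (Eventually.of_forall fun p => mul_nonneg (by norm_num) (hf0 p)), hA,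
        ← lintegral_const_mul' _ _ (by norm_num)]
      refine lintegral_congr fun p => ?_
      rw [ENNReal.ofReal_mul (by norm_num)]
      norm_num
    -- Finiteness comes from the integrability of the pairing term, and is what permits subtracting
    -- 2A below.
    have hAt : A ≠ ⊤ := by
      have h1 : 3 * A ≠ ⊤ := by rw [← hleft]; exact ENNReal.ofReal_ne_top
      intro h
      rw [h] at h1
      exact h1 (ENNReal.mul_top (by norm_num))
    rw [hleft] at hle
    -- The curvature term and the term with C each cost one copy of A. One of the three copies
    -- remains.
    have hright : 3 * A ≤ 2 * A + ENNReal.ofReal (L ^ (2 + (n : ℝ) / 2)) * k2 := by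
      refine hle.trans ?_
      have hsup : ∫⁻ p, ENNReal.ofReal (W p * (ricciNeg (conformal u (baseMetric n M)) p *
          a p ^ (n - 2) * Real.exp (2 * u p) + C * a p ^ (n - 2))) ∂ν =
          ∫⁻ p in Ω, ENNReal.ofReal (W p * (ricciNeg (conformal u (baseMetric n M)) p *
          a p ^ (n - 2) * Real.exp (2 * u p) + C * a p ^ (n - 2))) ∂ν := by
        rw [← lintegral_indicator hΩ.measurableSet]
        refine lintegral_congr fun p => ?_
        by_cases hp : p ∈ Ω
        · rw [indicator_of_mem hp]
        · rw [indicator_of_notMem hp, show W p = 0 from indicator_of_notMem hp _, zero_mul,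
            ENNReal.ofReal_zero]
      rw [hsup]
      have hpt : ∀ p ∈ Ω, ENNReal.ofReal (W p * (ricciNeg (conformal u (baseMetric n M)) p *
          a p ^ (n - 2) * Real.exp (2 * u p) + C * a p ^ (n - 2))) ≤
          2 * ENNReal.ofReal (max (T - u p) 0 ^ 2 * a p ^ n) +
          ENNReal.ofReal (L ^ (2 + (n : ℝ) / 2)) *
            (k p + ENNReal.ofReal (C ^ ((n : ℝ) / 2))) := by
        intro p hp
        have hs0 : 0 ≤ max (T - u p) 0 := le_max_right _ _
        have hsL : max (T - u p) 0 ≤ L := max_le (by have := hb p hp; linarith) (by linarith)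
        have h1 := hkb p _ L hs0 hsL hL
        have h2 := ENNReal.ofReal_le_ofReal
          (cube_mul_pow_mul_le (n := n) (by omega) (ha0 p) hC hs0 hsL)
        rw [show W p = max (T - u p) 0 ^ 3 from indicator_of_mem hp _, mul_add]
        refine ENNReal.ofReal_add_le.trans ?_
        rw [mul_comm C]
        refine (add_le_add h1 (h2.trans ENNReal.ofReal_add_le)).trans (le_of_eq ?_)
        rw [ENNReal.ofReal_mul (p := L ^ (2 + (n : ℝ) / 2))
          (Real.rpow_nonneg (by linarith) _)]
        ring
      refine (setLIntegral_mono' hΩ.measurableSet hpt).trans (le_of_eq ?_)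
      rw [lintegral_add_left', lintegral_const_mul' _ _ (by norm_num),
        lintegral_const_mul' _ _ ENNReal.ofReal_ne_top]
      refine AEMeasurable.const_mul (AEMeasurable.ennreal_ofReal
        (ContinuousOn.aemeasurable ?_ hΩ.measurableSet)) _
      have hcm : Continuous fun t : ℝ => max (T - t) 0 ^ 2 := by fun_prop
      exact (hcm.comp_continuousOn huc).mul (hac.pow n)
    have h3 : (3 : ℝ≥0∞) * A = 2 * A + A := by ring
    rw [h3] at hright
    exact (ENNReal.add_le_add_iff_left (ENNReal.mul_ne_top (by norm_num) hAt)).mp hright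
  refine ⟨b, ENNReal.ofReal (2 ^ (2 + (n : ℝ) / 2)) * k2,
    ENNReal.mul_ne_top ENNReal.ofReal_ne_top hk2t, hb, fun L hL => ?_⟩
  have hL0 : 0 < L := by linarith
  -- At twice the height, the weight (b + 2L − u)² is at least L² where u ≤ b + L. Dividing (2L)^(2
  -- + n/2) by L² leaves the power n/2.
  have h1 := key (2 * L) (by linarith)
  have h2 : ENNReal.ofReal (L ^ 2) * ∫⁻ p in {p | p ∈ Ω ∧ u p ≤ b + L}, ENNReal.ofReal (a p ^ n) ∂ν
      ≤ ∫⁻ p in Ω, ENNReal.ofReal (max (b + 2 * L - u p) 0 ^ 2 * a p ^ n) ∂ν := by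
    rw [← lintegral_const_mul' _ _ ENNReal.ofReal_ne_top]
    have hcl := isClosed_sublevel hΩ huc hlim (b + L)
    refine (setLIntegral_mono' hcl.measurableSet fun p hp => ?_).trans
      (lintegral_mono_set fun p hp => hp.1)
    rw [← ENNReal.ofReal_mul (sq_nonneg _)]
    refine ENNReal.ofReal_le_ofReal (mul_le_mul_of_nonneg_right ?_ (pow_nonneg (ha0 p) n))
    refine pow_le_pow_left₀ hL0.le (le_max_of_le_left ?_) 2
    have := hp.2
    linarith
  have h3 := h2.trans h1
  have e : ENNReal.ofReal ((2 * L) ^ (2 + (n : ℝ) / 2)) * k2 = ENNReal.ofReal (L ^ 2) *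
      (ENNReal.ofReal (L ^ ((n : ℝ) / 2)) * (ENNReal.ofReal (2 ^ (2 + (n : ℝ) / 2)) * k2)) := by
    rw [Real.mul_rpow (by norm_num) hL0.le, Real.rpow_add hL0 2, Real.rpow_two,
      ENNReal.ofReal_mul (by positivity), ENNReal.ofReal_mul (sq_nonneg _)]
    ring
  rw [e] at h3
  refine (ENNReal.mul_le_mul_iff_right ?_ ENNReal.ofReal_ne_top).mp h3
  simpa using hL0.ne'

end Energy
end ConformalHuber
end

noncomputable section
namespace ConformalHuber

theorem exists_abs_deriv_smoothTransition_le :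
    ∃ D : ℝ, 0 ≤ D ∧ ∀ t, |deriv Real.smoothTransition t| ≤ D := by
  have hc : Continuous (deriv Real.smoothTransition) :=
    (Real.smoothTransition.contDiff (n := 1)).continuous_deriv le_rfl
  obtain ⟨D, hD⟩ := isCompact_Icc.exists_bound_of_continuousOn (s := Icc (0 : ℝ) 1)
    hc.continuousOn
  refine ⟨D, (norm_nonneg _).trans (hD 0 ⟨le_rfl, zero_le_one⟩), fun t => ?_⟩
  have h0 : 0 ≤ D := (norm_nonneg _).trans (hD 0 ⟨le_rfl, zero_le_one⟩)
  rcases lt_or_ge t 0 with h | h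
  · have : Real.smoothTransition =ᶠ[𝓝 t] fun _ => 0 := by
      filter_upwards [Iio_mem_nhds h] with s hs
      exact Real.smoothTransition.zero_of_nonpos (le_of_lt hs)
    rw [this.deriv_eq]; simpa using h0
  rcases lt_or_ge 1 t with h' | h'
  · have : Real.smoothTransition =ᶠ[𝓝 t] fun _ => 1 := by
      filter_upwards [Ioi_mem_nhds h'] with s hs
      exact Real.smoothTransition.one_of_one_le (le_of_lt hs)
    rw [this.deriv_eq]; simpa using h0
  · exact hD t ⟨h, h'⟩

/-! ### Cutoffs of small n-energy. -/

section Cutoffs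

variable {n : ℕ} {M : Type*} [TopologicalSpace M] [ChartedSpace (EuclideanSpace ℝ (Fin n)) M]
  [IsManifold (𝓡 n) ∞ M] [RiemannianBundle (fun x : M => TangentSpace (𝓡 n) x)]
  [CompactSpace M] [T2Space M] [MeasurableSpace M] [BorelSpace M]
  [IsContMDiffRiemannianBundle (𝓡 n) ∞ (EuclideanSpace ℝ (Fin n))
      (fun x : M => TangentSpace (𝓡 n) x)]

/-- Cutoff functions of small energy that vanish where `u ≤ s` and equal one near `M \ Ω`. -/
theorem exists_cutoff (hn : 3 ≤ n) {Ω : Set M} (hΩ : IsOpen Ω) (hne : Ω.Nonempty) {u : M → ℝ}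
    (hu : ContMDiffOn (𝓡 n) 𝓘(ℝ, ℝ) ∞ u Ω)
    (hlim : ∀ z ∈ frontier Ω, Tendsto u (𝓝[Ω] z) atTop)
    (hRic : MemLp (ricciNeg (conformal u (baseMetric n M))) ((n : ℝ≥0∞) / 2)
        (riemVolume (conformal u (baseMetric n M)) Ω) ∨
      Integrable (fun x => ricciNeg (conformal u (baseMetric n M)) x *
            gradNorm (baseMetric n M) u x ^ (n - 2) * Real.exp (2 * u x))
        (riemVolume (baseMetric n M) Ω)) (s : ℝ) {ε : ℝ≥0∞} (hε : 0 < ε) :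
    ∃ v : M → ℝ, ContMDiff (𝓡 n) 𝓘(ℝ, ℝ) ∞ v ∧ (∀ p ∈ Ω, u p ≤ s → v p = 0) ∧
      (∀ p, p ∉ Ω → v =ᶠ[𝓝 p] fun _ => 1) ∧
      ∫⁻ p, ENNReal.ofReal (gradNorm (baseMetric n M) v p ^ n) ∂(baseVolume n M) < ε := by
  obtain ⟨b, K, hK, hb, hen⟩ := exists_energy_bound hn hΩ hne hu hlim hRic
  obtain ⟨D, hD0, hD⟩ := exists_abs_deriv_smoothTransition_le
  have huc : ContinuousOn u Ω := hu.continuousOn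
  have hn0 : 0 < (n : ℝ) / 2 := by positivity
  have hlimL : Tendsto (fun L : ℝ => ENNReal.ofReal (D ^ n * 2 ^ ((n : ℝ) / 2) *
      L ^ (-((n : ℝ) / 2))) * K) atTop (𝓝 0) := by
    have h1 := (tendsto_rpow_neg_atTop hn0).const_mul (D ^ n * 2 ^ ((n : ℝ) / 2))
    have h2 := ENNReal.Tendsto.mul_const (ENNReal.tendsto_ofReal h1) (Or.inr hK)
    simpa using h2
  -- The bounds on L give 1 ≤ s + L − b ≤ 2L, so that the energy estimate applies at level s + L
  -- with right side at most (2L)^(n/2) K. The factor (D/L)ⁿ from the slope then leaves a multiple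
  -- of L^(−n/2).
  obtain ⟨L, hLε, hL1, hL2, hL3⟩ := ((hlimL.eventually (gt_mem_nhds hε)).and
    ((eventually_gt_atTop 0).and ((eventually_ge_atTop (s - b)).and
      (eventually_ge_atTop (1 + b - s))))).exists
  set θ : ℝ → ℝ := fun t => Real.smoothTransition ((t - s) / L) with hθ
  have hθc : ContDiff ℝ ∞ θ :=
    Real.smoothTransition.contDiff.comp ((contDiff_id.sub contDiff_const).div_const L)
  have hθd : ∀ t, HasDerivAt θ (deriv Real.smoothTransition ((t - s) / L) * (1 / L)) t := by
    intro t
    have h1 : HasDerivAt (fun t : ℝ => (t - s) / L) (1 / L) t :=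
      ((hasDerivAt_id t).sub_const s).div_const L
    exact ((Real.smoothTransition.contDiff (n := 1)).differentiable (by simp)
      ((t - s) / L)).hasDerivAt.comp t h1
  classical
  set v : M → ℝ := fun p => if p ∈ Ω then θ (u p) else 1 with hv
  have hcl := isClosed_sublevel hΩ huc hlim (s + L)
  have hv1 : ∀ p, ¬ (p ∈ Ω ∧ u p ≤ s + L) → v =ᶠ[𝓝 p] fun _ => 1 := by
    intro p hp
    filter_upwards [hcl.isOpen_compl.mem_nhds hp] with q hq
    by_cases hqΩ : q ∈ Ω
    · have : s + L < u q := by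
        by_contra h
        exact hq ⟨hqΩ, not_lt.mp h⟩
      simp only [hv, if_pos hqΩ, hθ]
      refine Real.smoothTransition.one_of_one_le ?_
      rw [le_div_iff₀ hL1]; linarith
    · simp only [hv, if_neg hqΩ]
  have hvΩ : ∀ p ∈ Ω, v =ᶠ[𝓝 p] fun q => θ (u q) := by
    intro p hp
    filter_upwards [hΩ.mem_nhds hp] with q hq
    simp only [hv, if_pos hq]
  refine ⟨v, ?_, ?_, fun p hp => hv1 p fun h => hp h.1, ?_⟩
  · intro p
    by_cases hp : p ∈ Ω
    · have h1 : ContMDiffAt (𝓡 n) 𝓘(ℝ, ℝ) ∞ (fun q => θ (u q)) p :=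
        hθc.contMDiff.contMDiffAt.comp p (hu.contMDiffAt (hΩ.mem_nhds hp))
      exact h1.congr_of_eventuallyEq (hvΩ p hp)
    · exact contMDiffAt_const.congr_of_eventuallyEq (hv1 p fun h => hp h.1)
  · intro p hp hps
    simp only [hv, if_pos hp, hθ]
    exact Real.smoothTransition.zero_of_nonpos
      (div_nonpos_of_nonpos_of_nonneg (by linarith) hL1.le)
  · refine lt_of_le_of_lt ?_ hLε
    set E := {p | p ∈ Ω ∧ u p ≤ s + L} with hE
    have hpt : ∀ p, ENNReal.ofReal (gradNorm (baseMetric n M) v p ^ n) ≤ E.indicator (fun p =>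
        ENNReal.ofReal ((D / L) ^ n) *
          ENNReal.ofReal (gradNorm (baseMetric n M) u p ^ n)) p := by
      intro p
      by_cases hp : p ∈ E
      · rw [indicator_of_mem hp, gradNorm_congr (hvΩ p hp.1),
          gradNorm_comp ((hu.contMDiffAt (hΩ.mem_nhds hp.1)).mdifferentiableAt (by simp))
            (hθd (u p)), mul_pow, ← ENNReal.ofReal_mul (by positivity)]
        refine ENNReal.ofReal_le_ofReal (mul_le_mul_of_nonneg_right ?_
          (pow_nonneg (gradNorm_nonneg _ _ _) n))
        refine pow_le_pow_left₀ (abs_nonneg _) ?_ n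
        rw [abs_mul, abs_of_pos (one_div_pos.mpr hL1), mul_one_div]
        exact div_le_div_of_nonneg_right (hD _) hL1.le
      · rw [gradNorm_eq_zero_of_eventuallyEq_const (hv1 p hp), zero_pow (by omega),
          ENNReal.ofReal_zero]
        exact zero_le
    refine (lintegral_mono hpt).trans ?_
    rw [lintegral_indicator hcl.measurableSet, lintegral_const_mul' _ _ ENNReal.ofReal_ne_top]
    have h1 := hen (s + L - b) (by linarith)
    have h2 : b + (s + L - b) = s + L := by ring
    rw [h2] at h1
    refine (mul_le_mul_right h1 _).trans ?_
    rw [← mul_assoc, ← ENNReal.ofReal_mul (by positivity)]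
    refine mul_le_mul_left (ENNReal.ofReal_le_ofReal ?_) _
    have h3 : (s + L - b) ^ ((n : ℝ) / 2) ≤ (2 * L) ^ ((n : ℝ) / 2) :=
      Real.rpow_le_rpow (by linarith) (by linarith) hn0.le
    calc (D / L) ^ n * (s + L - b) ^ ((n : ℝ) / 2) ≤ (D / L) ^ n * (2 * L) ^ ((n : ℝ) / 2) := by
          gcongr
      _ = D ^ n * 2 ^ ((n : ℝ) / 2) * (L ^ ((n : ℝ) / 2) * (L ^ n)⁻¹) := by
          rw [Real.mul_rpow (by norm_num) hL1.le, div_pow]; ring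
      _ = _ := by
          congr 1
          rw [← Real.rpow_natCast, ← Real.rpow_neg hL1.le, ← Real.rpow_add hL1]
          congr 1; ring

end Cutoffs
end ConformalHuber
end

noncomputable section
namespace ConformalHuber

/-! ### Energy needed to pass from one at a point to zero on a set of positive measure. -/

section Euclidean

variable {E : Type*} [NormedAddCommGroup E] [NormedSpace ℝ E] [FiniteDimensional ℝ E]
  [MeasurableSpace E] [BorelSpace E] (μ : Measure E) [μ.IsAddHaarMeasure]

theorem setLIntegral_ball_homothety (a : E) (R : ℝ) {τ : ℝ} (hτ : 0 < τ) {g : E → ℝ≥0∞}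
    (hg : Measurable g) :
    ∫⁻ x in Metric.ball a R, g (a + τ • (x - a)) ∂μ =
      ENNReal.ofReal (τ ^ Module.finrank ℝ E)⁻¹ * ∫⁻ z in Metric.ball a (τ * R), g z ∂μ := by
  set H : E → ℝ≥0∞ := (Metric.ball (0 : E) (τ * R)).indicator fun y => g (a + y) with hH
  have hHm : Measurable H := (hg.comp (measurable_const_add a)).indicator measurableSet_ball
  have h1 : ∫⁻ x in Metric.ball a R, g (a + τ • (x - a)) ∂μ = ∫⁻ x, H (τ • (x - a)) ∂μ := by
    rw [← lintegral_indicator measurableSet_ball]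
    refine lintegral_congr fun x => ?_
    have hiff : x ∈ Metric.ball a R ↔ τ • (x - a) ∈ Metric.ball (0 : E) (τ * R) := by
      rw [Metric.mem_ball, mem_ball_zero_iff, norm_smul, Real.norm_of_nonneg hτ.le,
        mul_lt_mul_iff_right₀ hτ, dist_eq_norm]
    by_cases hx : x ∈ Metric.ball a R
    · rw [indicator_of_mem hx, hH, indicator_of_mem (hiff.mp hx)]
    · rw [indicator_of_notMem hx, hH, indicator_of_notMem fun h => hx (hiff.mpr h)]
  have h2 : ∫⁻ z in Metric.ball a (τ * R), g z ∂μ = ∫⁻ x, H (x - a) ∂μ := by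
    rw [← lintegral_indicator measurableSet_ball]
    refine lintegral_congr fun x => ?_
    have hiff : x ∈ Metric.ball a (τ * R) ↔ x - a ∈ Metric.ball (0 : E) (τ * R) := by
      rw [Metric.mem_ball, mem_ball_zero_iff, dist_eq_norm]
    by_cases hx : x ∈ Metric.ball a (τ * R)
    · rw [indicator_of_mem hx, hH, indicator_of_mem (hiff.mp hx), add_sub_cancel]
    · rw [indicator_of_notMem hx, hH, indicator_of_notMem fun h => hx (hiff.mpr h)]
  rw [h1, h2, lintegral_sub_right_eq_self (fun y => H (τ • y)) a, lintegral_sub_right_eq_self,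
    ← lintegral_map hHm (measurable_const_smul τ), Measure.map_addHaar_smul μ hτ.ne',
    lintegral_smul_measure, abs_of_nonneg (by positivity), smul_eq_mul]

theorem enorm_sub_le_lintegral_fderiv {V : E → ℝ} {a x : E} {R : ℝ}
    (hV : ContDiffOn ℝ 1 V (Metric.ball a R)) (hx : x ∈ Metric.ball a R) :
    ‖V x - V a‖ₑ ≤ ENNReal.ofReal R *
      ∫⁻ τ in Ioc (0 : ℝ) 1, ‖fderiv ℝ V (a + τ • (x - a))‖ₑ := by
  have hseg : ∀ τ ∈ Icc (0 : ℝ) 1, a + τ • (x - a) ∈ Metric.ball a R := by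
    intro τ hτ
    rw [Metric.mem_ball, dist_eq_norm] at *
    rw [add_sub_cancel_left, norm_smul, Real.norm_of_nonneg hτ.1]
    exact (mul_le_of_le_one_left (norm_nonneg _) hτ.2).trans_lt hx
  have hline : ContDiff ℝ 1 fun τ : ℝ => a + τ • (x - a) := by fun_prop
  have h1 := enorm_sub_le_lintegral_deriv_of_contDiffOn_Icc
    (f := fun τ : ℝ => V (a + τ • (x - a))) (hV.comp hline.contDiffOn hseg) zero_le_one
  simp only [one_smul, add_sub_cancel, zero_smul, add_zero] at h1
  refine h1.trans ?_
  rw [← lintegral_const_mul' _ _ ENNReal.ofReal_ne_top, setLIntegral_congr Ioc_ae_eq_Icc]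
  refine setLIntegral_mono' measurableSet_Icc fun τ hτ => ?_
  have hVd : DifferentiableAt ℝ V (a + τ • (x - a)) :=
    (hV.contDiffAt (Metric.isOpen_ball.mem_nhds (hseg τ hτ))).differentiableAt (by simp)
  have hd : HasDerivAt (fun τ : ℝ => a + τ • (x - a)) (x - a) τ := by
    simpa using ((hasDerivAt_id τ).smul_const (x - a)).const_add a
  have hderiv : deriv (fun τ : ℝ => V (a + τ • (x - a))) τ =
      fderiv ℝ V (a + τ • (x - a)) (x - a) := (hVd.hasFDerivAt.comp_hasDerivAt τ hd).deriv
  rw [hderiv, mul_comm]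
  refine (ContinuousLinearMap.le_opENorm _ _).trans ?_
  gcongr
  rw [← ofReal_norm]
  refine ENNReal.ofReal_le_ofReal ?_
  rw [← dist_eq_norm]
  exact (Metric.mem_ball.mp hx).le

/-- For x in U the derivative of V along the segment from a to x accounts for a drop of 1. Integrate
over x, exchange the integrals, and substitute z = a + τ(x − a). -/
theorem measure_zero_set_le {V : E → ℝ} {a : E} {R : ℝ} (hV : ContDiffOn ℝ 1 V (Metric.ball a R))
    (hVa : V a = 1) {U : Set E} (hU : MeasurableSet U) (hUR : U ⊆ Metric.ball a R)
    (hVU : ∀ x ∈ U, V x = 0) :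
    μ U ≤ ENNReal.ofReal R * ∫⁻ τ in Ioc (0 : ℝ) 1, ENNReal.ofReal (τ ^ Module.finrank ℝ E)⁻¹ *
      ∫⁻ z in Metric.ball a (τ * R), ‖fderiv ℝ V z‖ₑ ∂μ := by
  have hgm : Measurable fun z => ‖fderiv ℝ V z‖ₑ := (measurable_fderiv ℝ V).enorm
  have hm : Measurable fun p : E × ℝ => ‖fderiv ℝ V (a + p.2 • (p.1 - a))‖ₑ :=
    hgm.comp (by fun_prop : Continuous fun p : E × ℝ => a + p.2 • (p.1 - a)).measurable
  calc μ U = ∫⁻ _ in U, 1 ∂μ := (setLIntegral_one U).symm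
    _ ≤ ∫⁻ x in U, ENNReal.ofReal R *
        (∫⁻ τ in Ioc (0 : ℝ) 1, ‖fderiv ℝ V (a + τ • (x - a))‖ₑ) ∂μ := by
      refine setLIntegral_mono' hU fun x hx => ?_
      have := enorm_sub_le_lintegral_fderiv hV (hUR hx)
      rw [hVa, hVU x hx] at this
      simpa using this
    _ ≤ ∫⁻ x in Metric.ball a R, ENNReal.ofReal R *
        (∫⁻ τ in Ioc (0 : ℝ) 1, ‖fderiv ℝ V (a + τ • (x - a))‖ₑ) ∂μ := lintegral_mono_set hUR
    _ = _ := by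
      rw [lintegral_const_mul' _ _ ENNReal.ofReal_ne_top,
        lintegral_lintegral_swap hm.aemeasurable]
      congr 1
      refine setLIntegral_congr_fun measurableSet_Ioc fun τ hτ => ?_
      exact setLIntegral_ball_homothety μ a R hτ.1 hgm

/-- A function that is one at `a` and vanishes on a set of measure at least `m` in the ball of
radius `R` has much energy in some ball centred at `a`. -/
theorem exists_lt_setLIntegral_ball (hN : 2 ≤ Module.finrank ℝ E) {s R : ℝ} (hs : 0 < s)
    (hR : 0 < R) {m : ℝ≥0∞} (hm : 0 < m) :
    ∃ δ : ℝ, 0 < δ ∧ ∀ (a : E) (V : E → ℝ) (U : Set E), ContDiffOn ℝ 1 V (Metric.ball a R) →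
      V a = 1 → MeasurableSet U → U ⊆ Metric.ball a R → (∀ x ∈ U, V x = 0) → m ≤ μ U →
      ∃ r, 0 < r ∧ r ≤ R ∧ ENNReal.ofReal (δ * r ^ s) <
        ∫⁻ z in Metric.ball a r, ‖fderiv ℝ V z‖ₑ ^ Module.finrank ℝ E ∂μ := by
  set N := Module.finrank ℝ E with hNdef
  have hN1 : (1 : ℝ) < N := by exact_mod_cast hN
  have hN0 : (0 : ℝ) < N := by linarith
  have : Nontrivial E := Module.nontrivial_of_finrank_pos (R := ℝ) (by omega)
  have hconj := Real.HolderConjugate.conjExponent hN1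
  set q := Real.conjExponent (N : ℝ) with hq
  have hq1 : 1 / q = 1 - 1 / N := by
    have := hconj.inv_add_inv_eq_one
    rw [one_div, one_div]; linarith
  set β := (μ (Metric.ball (0 : E) 1)).toReal with hβ
  have hβe : μ (Metric.ball (0 : E) 1) = ENNReal.ofReal β :=
    (ENNReal.ofReal_toReal measure_ball_lt_top.ne).symm
  have hβ0 : 0 ≤ β := ENNReal.toReal_nonneg
  set κ : ℝ := R * (R ^ (s / N) * R ^ ((N : ℝ) - 1) * β ^ (1 / q)) with hκ
  have hκ0 : 0 ≤ κ := by positivity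
  -- Finite because s > 0; this is where a positive power r^s, rather than a mere constant, is
  -- required of the energies.
  set c : ℝ≥0∞ := ∫⁻ τ in Ioc (0 : ℝ) 1, ENNReal.ofReal (τ ^ (s / N - 1)) with hc
  have hct : c ≠ ⊤ := by
    have h1 : IntervalIntegrable (fun x : ℝ => x ^ (s / N - 1)) volume 0 1 :=
      intervalIntegral.intervalIntegrable_rpow' (by have := div_pos hs hN0; linarith)
    rw [intervalIntegrable_iff_integrableOn_Ioc_of_le zero_le_one] at h1
    exact h1.lintegral_lt_top.ne
  have hlim : Tendsto (fun δ : ℝ => ENNReal.ofReal (κ * δ ^ (1 / (N : ℝ))) * c) (𝓝[>] 0) (𝓝 0) := by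
    have h1 : Tendsto (fun δ : ℝ => κ * δ ^ (1 / (N : ℝ))) (𝓝[>] 0) (𝓝 (κ * 0 ^ (1 / (N : ℝ)))) :=
      ((Real.continuousAt_rpow_const 0 (1 / (N : ℝ)) (Or.inr (by positivity))).tendsto.const_mul
        κ).mono_left nhdsWithin_le_nhds
    rw [Real.zero_rpow (by positivity), mul_zero] at h1
    simpa using ENNReal.Tendsto.mul_const (ENNReal.tendsto_ofReal h1) (Or.inr hct)
  -- If every ball of radius r ≤ R about a had energy at most δ r^s, Hölder's inequality would give
  -- μ(U) ≤ κ δ^(1/N) c. The number δ is chosen so that this is less than m.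
  obtain ⟨δ, hδm, hδ⟩ := ((hlim.eventually (gt_mem_nhds hm)).and self_mem_nhdsWithin).exists
  have hδ0 : 0 < δ := hδ
  refine ⟨δ, hδ0, fun a V U hV hVa hU hUR hVU hmU => ?_⟩
  by_contra! hcon
  refine absurd (lt_of_le_of_lt (measure_zero_set_le μ hV hVa hU hUR hVU) ?_) (not_lt.mpr hmU)
  refine lt_of_le_of_lt ?_ hδm
  have hgm : Measurable fun z => ‖fderiv ℝ V z‖ₑ := (measurable_fderiv ℝ V).enorm
  have hinner : ∀ τ ∈ Ioc (0 : ℝ) 1, ENNReal.ofReal (τ ^ N)⁻¹ *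
      ∫⁻ z in Metric.ball a (τ * R), ‖fderiv ℝ V z‖ₑ ∂μ ≤
      ENNReal.ofReal (R ^ (s / N) * R ^ ((N : ℝ) - 1) * β ^ (1 / q) * δ ^ (1 / (N : ℝ))) *
        ENNReal.ofReal (τ ^ (s / N - 1)) := by
    intro τ hτ
    have hτ0 : 0 < τ := hτ.1
    set r := τ * R with hr
    have hr0 : 0 < r := mul_pos hτ0 hR
    have hrR : r ≤ R := mul_le_of_le_one_left hR.le hτ.2
    have h1 := ENNReal.lintegral_mul_le_Lp_mul_Lq (μ.restrict (Metric.ball a r)) hconj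
      hgm.aemeasurable (g := fun _ => 1) aemeasurable_const
    simp only [Pi.mul_apply, mul_one, ENNReal.one_rpow, ENNReal.rpow_natCast,
      setLIntegral_one] at h1
    have h2 := hcon r hr0 hrR
    have h3 : μ (Metric.ball a r) = ENNReal.ofReal (r ^ N * β) := by
      rw [Measure.addHaar_ball μ a hr0.le, hβe, ENNReal.ofReal_mul (by positivity)]
    rw [h3] at h1
    have h4 : ∫⁻ z in Metric.ball a r, ‖fderiv ℝ V z‖ₑ ∂μ ≤
        ENNReal.ofReal ((δ * r ^ s) ^ (1 / (N : ℝ)) * (r ^ N * β) ^ (1 / q)) := by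
      refine h1.trans ?_
      have hqn : 0 ≤ 1 / q := by rw [one_div]; exact hconj.symm.inv_nonneg
      rw [ENNReal.ofReal_mul (p := (δ * r ^ s) ^ (1 / (N : ℝ))) (by positivity),
        ← ENNReal.ofReal_rpow_of_nonneg (by positivity) (by positivity),
        ← ENNReal.ofReal_rpow_of_nonneg (by positivity) hqn]
      gcongr
    refine (mul_le_mul_right h4 _).trans (le_of_eq ?_)
    rw [← ENNReal.ofReal_mul (by positivity), ← ENNReal.ofReal_mul (by positivity)]
    congr 1
    have e1 : (δ * r ^ s) ^ (1 / (N : ℝ)) = δ ^ (1 / (N : ℝ)) * (τ ^ (s / N) * R ^ (s / N)) := by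
      rw [Real.mul_rpow hδ0.le (by positivity), ← Real.rpow_mul hr0.le, mul_one_div, hr,
        Real.mul_rpow hτ0.le hR.le]
    have e2 : (r ^ N * β) ^ (1 / q) =
        τ ^ ((N : ℝ) - 1) * R ^ ((N : ℝ) - 1) * β ^ (1 / q) := by
      rw [Real.mul_rpow (by positivity) hβ0, ← Real.rpow_natCast, ← Real.rpow_mul hr0.le]
      have : (N : ℝ) * (1 / q) = (N : ℝ) - 1 := by rw [hq1]; field_simp
      rw [this, hr, Real.mul_rpow hτ0.le hR.le]
    have e3 : (τ ^ N)⁻¹ * (τ ^ (s / N) * τ ^ ((N : ℝ) - 1)) = τ ^ (s / N - 1) := by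
      rw [← Real.rpow_natCast, ← Real.rpow_neg hτ0.le, ← Real.rpow_add hτ0, ← Real.rpow_add hτ0]
      congr 1; ring
    rw [e1, e2, ← e3]
    ring
  calc ENNReal.ofReal R * ∫⁻ τ in Ioc (0 : ℝ) 1, ENNReal.ofReal (τ ^ N)⁻¹ *
      ∫⁻ z in Metric.ball a (τ * R), ‖fderiv ℝ V z‖ₑ ∂μ
      ≤ ENNReal.ofReal R * ∫⁻ τ in Ioc (0 : ℝ) 1,
        ENNReal.ofReal (R ^ (s / N) * R ^ ((N : ℝ) - 1) * β ^ (1 / q) * δ ^ (1 / (N : ℝ))) *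
        ENNReal.ofReal (τ ^ (s / N - 1)) := by
        exact mul_le_mul_right (setLIntegral_mono' measurableSet_Ioc hinner) _
    _ = ENNReal.ofReal (κ * δ ^ (1 / (N : ℝ))) * c := by
        rw [lintegral_const_mul' _ _ ENNReal.ofReal_ne_top, ← mul_assoc,
          ← ENNReal.ofReal_mul hR.le, hκ]
        congr 2; ring

end Euclidean
end ConformalHuber
end

noncomputable section
namespace ConformalHuber

/-! ### A Vitali covering estimate for Hausdorff measure. -/

section Covering

variable {E : Type*} [NormedAddCommGroup E] [NormedSpace ℝ E] [FiniteDimensional ℝ E]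
  [MeasurableSpace E] [BorelSpace E] (μ : Measure E)

theorem ediam_closedBall_le (a : E) (r : ℝ) :
    Metric.ediam (Metric.closedBall a r) ≤ ENNReal.ofReal (2 * r) := by
  refine Metric.ediam_le fun x hx y hy => ?_
  rw [edist_dist]
  refine ENNReal.ofReal_le_ofReal ?_
  have h1 := dist_triangle_right x y a
  rw [Metric.mem_closedBall] at hx hy
  linarith

/-- A set each point of which is the centre of a ball carrying a mass at least `δ r ^ s` of
measures of arbitrarily small total mass is null for the `s`-dimensional Hausdorff measure. -/
theorem hausdorffMeasure_eq_zero_of_forall_exists {A : Set E} {s δ R : ℝ} (hs : 0 < s) (hδ : 0 < δ)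
    (h : ∀ η : ℝ, 0 < η → ∃ g : E → ℝ≥0∞, ∫⁻ x, g x ∂μ ≤ ENNReal.ofReal η ∧ ∀ a ∈ A, ∃ r, 0 < r ∧
      r ≤ R ∧ ENNReal.ofReal (δ * r ^ s) ≤ ∫⁻ x in Metric.ball a r, g x ∂μ) :
    Measure.hausdorffMeasure s A = 0 := by
  have hη : ∀ k : ℕ, 0 < 1 / ((k : ℝ) + 1) := fun k => by positivity
  have hηlim : Tendsto (fun k : ℕ => 1 / ((k : ℝ) + 1)) atTop (𝓝 0) :=
    tendsto_one_div_add_atTop_nhds_zero_nat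
  choose g hg hA using fun k : ℕ => h _ (hη k)
  choose! r hr0 hrR hr using hA
  -- Disjointness lets the masses δ r^s add up to at most the total mass 1/(k + 1), while the
  -- five-fold balls, of diameter at most 10 r, still cover A.
  have hvit := fun k => Vitali.exists_disjoint_subfamily_covering_enlargement_closedBall A
    (fun a => a) (r k) R (hrR k) 5 (by norm_num)
  choose t htA htd htc using hvit
  have hcount : ∀ k, (t k).Countable := by
    intro k
    refine (htd k).countable_of_nonempty_interior fun a ha => ?_
    exact ⟨a, Metric.ball_subset_interior_closedBall (Metric.mem_ball_self (hr0 k a (htA k ha)))⟩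
  have : ∀ k, Countable (t k) := fun k => (hcount k).to_subtype
  -- From δ r^s ≤ 1/(k + 1): the covers become uniformly fine, as Hausdorff measure demands.
  have hsmall : ∀ k, ∀ a ∈ A, r k a ≤ (1 / ((k : ℝ) + 1) / δ) ^ (1 / s) := by
    intro k a ha
    have h1 := (hr k a ha).trans ((setLIntegral_le_lintegral _ _).trans (hg k))
    rw [ENNReal.ofReal_le_ofReal_iff (hη k).le] at h1
    have h2 : r k a ^ s ≤ 1 / ((k : ℝ) + 1) / δ := by rw [le_div_iff₀ hδ]; linarith
    calc r k a = (r k a ^ s) ^ (1 / s) := by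
          rw [← Real.rpow_mul (hr0 k a ha).le, mul_one_div, div_self hs.ne', Real.rpow_one]
      _ ≤ _ := Real.rpow_le_rpow (Real.rpow_nonneg (hr0 k a ha).le _) h2 (by positivity)
  have hle := Measure.hausdorffMeasure_le_liminf_tsum (ι := fun k => t k) s A (l := atTop)
    (fun k : ℕ => ENNReal.ofReal (10 * (1 / ((k : ℝ) + 1) / δ) ^ (1 / s))) (by
      have h1 : Tendsto (fun k : ℕ => (1 / ((k : ℝ) + 1) / δ) ^ (1 / s)) atTop (𝓝 0) := by
        have h2 := (hηlim.div_const δ).rpow_const (p := 1 / s) (Or.inr (by positivity))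
        rwa [zero_div, Real.zero_rpow (by positivity)] at h2
      simpa using ENNReal.tendsto_ofReal (h1.const_mul 10))
    (fun k i => Metric.closedBall (i : E) (5 * r k i))
    (Eventually.of_forall fun k i => by
      have hi := htA k i.2
      refine (ediam_closedBall_le _ _).trans
        (ENNReal.ofReal_le_ofReal ?_)
      have := hsmall k i hi
      linarith)
    (Eventually.of_forall fun k a ha => by
      obtain ⟨b, hb, hab⟩ := htc k a ha
      exact mem_iUnion.mpr ⟨⟨b, hb⟩, hab (Metric.mem_closedBall_self (hr0 k a ha).le)⟩)
  have hsum : ∀ k, ∑' i : t k, Metric.ediam (Metric.closedBall (i : E) (5 * r k i)) ^ s ≤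
      ENNReal.ofReal (10 ^ s / δ) * ENNReal.ofReal (1 / ((k : ℝ) + 1)) := by
    intro k
    calc ∑' i : t k, Metric.ediam (Metric.closedBall (i : E) (5 * r k i)) ^ s
        ≤ ∑' i : t k, ENNReal.ofReal (10 ^ s / δ) *
          ∫⁻ x in Metric.ball (i : E) (r k i), g k x ∂μ := by
          refine ENNReal.tsum_le_tsum fun i => ?_
          have hi := htA k i.2
          have hri := hr0 k i hi
          refine le_trans ?_ (mul_le_mul_right (hr k i hi) _)
          refine (ENNReal.rpow_le_rpow (ediam_closedBall_le _ _) hs.le).trans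
            (le_of_eq ?_)
          rw [ENNReal.ofReal_rpow_of_nonneg (by linarith) hs.le,
            ← ENNReal.ofReal_mul (by positivity)]
          congr 1
          rw [← mul_assoc, Real.mul_rpow (by norm_num) hri.le]
          field_simp
          norm_num
      _ = ENNReal.ofReal (10 ^ s / δ) *
          ∫⁻ x in ⋃ i : t k, Metric.ball (i : E) (r k i), g k x ∂μ := by
          rw [ENNReal.tsum_mul_left, lintegral_iUnion (fun i => measurableSet_ball)]
          intro i j hij
          exact ((htd k) i.2 j.2 fun h => hij (Subtype.ext h)).mono Metric.ball_subset_closedBall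
            Metric.ball_subset_closedBall
      _ ≤ _ := mul_le_mul_right ((setLIntegral_le_lintegral _ _).trans (hg k)) _
  refine le_antisymm (hle.trans ((liminf_le_liminf (Eventually.of_forall hsum)).trans
    (le_of_eq ?_))) zero_le
  refine Tendsto.liminf_eq ?_
  have h2 := ENNReal.Tendsto.const_mul (ENNReal.tendsto_ofReal hηlim)
    (Or.inr (ENNReal.ofReal_ne_top (r := 10 ^ s / δ)))
  simpa using h2

end Covering
end ConformalHuber
end

noncomputable section
namespace ConformalHuber

/-- Cauchy–Schwarz for the metric, dV(c)² ≤ g(c, c) |∇V|², compared with the Euclidean norm of c. -/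
theorem IsMetricOn.norm_fderiv_sq_le {n : ℕ}
    {G : EuclideanSpace ℝ (Fin n) → Matrix (Fin n) (Fin n) ℝ}
    {S : Set (EuclideanSpace ℝ (Fin n))} (h : IsMetricOn G S) {y : EuclideanSpace ℝ (Fin n)}
    (hy : y ∈ S) (V : EuclideanSpace ℝ (Fin n) → ℝ) :
    ‖fderiv ℝ V y‖ ≤ √‖matForm (G y)‖ * √(fderiv ℝ V y (gradVec G V y)) := by
  refine ContinuousLinearMap.opNorm_le_bound _ (by positivity) fun c => ?_
  set Q := fderiv ℝ V y (gradVec G V y) with hQ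
  have hQG : matForm (G y) (gradVec G V y) (gradVec G V y) = Q := h.matForm_gradVec hy V _
  have hGc := h.matForm_gradVec hy V c
  have hGc' : matForm (G y) c (gradVec G V y) = fderiv ℝ V y c := by
    rw [matForm_comm (h.symm y hy), hGc]
  set γ := matForm (G y) c c with hγ
  set D := fderiv ℝ V y c with hD
  have hnn : ∀ a, 0 ≤ matForm (G y) a a := by
    intro a
    by_cases ha : a = 0
    · simp [ha]
    · exact (h.pos y hy a ha).le
  have hQ0 : 0 ≤ Q := by rw [← hQG]; exact hnn _
  have hCS : D ^ 2 ≤ γ * Q := by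
    by_cases hc : c = 0
    · have : D = 0 := by rw [hD, hc, map_zero]
      rw [this]
      have := mul_nonneg (hnn c) hQ0
      simpa using this
    have hγ0 : 0 < γ := h.pos y hy c hc
    -- The component of the gradient orthogonal to c, scaled by γ = g(c, c) to avoid a division.
    have h1 := hnn (γ • gradVec G V y - D • c)
    simp only [ContinuousLinearMap.map_sub, ContinuousLinearMap.map_smul, _root_.sub_apply,
      _root_.smul_apply, smul_eq_mul, hQG, hGc, hGc', ← hγ] at h1
    have h2 : 0 ≤ γ * (γ * Q - D ^ 2) := by nlinarith
    have h3 := nonneg_of_mul_nonneg_right h2 hγ0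
    linarith
  have hγn : γ ≤ ‖matForm (G y)‖ * ‖c‖ ^ 2 := by
    refine (le_abs_self _).trans ?_
    have := (matForm (G y)).le_opNorm₂ c c
    rw [Real.norm_eq_abs] at this
    rw [sq, ← mul_assoc]
    exact this
  have h4 : D ^ 2 ≤ (√‖matForm (G y)‖ * √Q * ‖c‖) ^ 2 := by
    rw [mul_pow, mul_pow, Real.sq_sqrt (norm_nonneg _), Real.sq_sqrt hQ0]
    calc D ^ 2 ≤ γ * Q := hCS
      _ ≤ ‖matForm (G y)‖ * ‖c‖ ^ 2 * Q := by gcongr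
      _ = _ := by ring
  rw [Real.norm_eq_abs]
  exact abs_le_of_sq_le_sq h4 (by positivity)

/-! ### The complement of Ω has dimension zero in charts around points of its closure. -/

section ChartDimension

variable {n : ℕ} {M : Type*} [TopologicalSpace M] [ChartedSpace (EuclideanSpace ℝ (Fin n)) M]
  [IsManifold (𝓡 n) ∞ M] [RiemannianBundle (fun x : M => TangentSpace (𝓡 n) x)]
  [CompactSpace M] [MeasurableSpace M] [BorelSpace M]
  [IsContMDiffRiemannianBundle (𝓡 n) ∞ (EuclideanSpace ℝ (Fin n))
      (fun x : M => TangentSpace (𝓡 n) x)]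

/-- The Euclidean energy in a compact part of a chart is controlled by the Riemannian energy. -/
theorem exists_setLIntegral_fderiv_le (x : M) {K : Set (EuclideanSpace ℝ (Fin n))}
    (hK : IsCompact K) (hKt : K ⊆ (extChartAt (𝓡 n) x).target) :
    ∃ C : ℝ, 0 < C ∧ ∀ v : M → ℝ, ContMDiff (𝓡 n) 𝓘(ℝ, ℝ) ∞ v →
      ∫⁻ y in K, ‖fderiv ℝ (v ∘ (extChartAt (𝓡 n) x).symm) y‖ₑ ^ n ≤
        ENNReal.ofReal C *
          ∫⁻ p, ENNReal.ofReal (gradNorm (baseMetric n M) v p ^ n) ∂(baseVolume n M) := by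
  set G := metricMatrix (baseMetric n M) x with hGdef
  have hG : IsMetricOn G (extChartAt (𝓡 n) x).target := isMetricOn_metricMatrix x
  have hT := (isOpen_extChartAt_target (I := 𝓡 n) x).measurableSet
  have hcont : ContinuousOn (fun y => √‖matForm (G y)‖ ^ n / √(G y).det) K := by
    refine ((hG.smooth_matForm.continuousOn.norm.sqrt.pow n).div
      (contDiffOn_det hG.smooth).continuousOn.sqrt fun y hy => ?_).mono hKt
    exact (Real.sqrt_pos.mpr (hG.det_pos hy)).ne'
  obtain ⟨C, hC⟩ := hK.exists_bound_of_continuousOn hcont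
  refine ⟨max C 1, lt_max_of_lt_right one_pos, fun v hv => ?_⟩
  have hvd : ∀ p, MDifferentiableAt (𝓡 n) 𝓘(ℝ, ℝ) v p := fun p =>
    hv.contMDiffAt.mdifferentiableAt (by simp)
  have hgm : AEMeasurable (fun p => ENNReal.ofReal (gradNorm (baseMetric n M) v p ^ n))
      ((baseVolume n M).restrict (extChartAt (𝓡 n) x).source) := by
    have hc : Continuous (gradNorm (baseMetric n M) v) :=
      continuousOn_univ.mp (continuousOn_gradNorm isOpen_univ hv.contMDiffOn)
    exact (hc.pow n).aemeasurable.ennreal_ofReal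
  have hpt : ∀ y ∈ K, ‖fderiv ℝ (v ∘ (extChartAt (𝓡 n) x).symm) y‖ₑ ^ n ≤
      ENNReal.ofReal (max C 1) * (ENNReal.ofReal (√(G y).det) *
        ENNReal.ofReal (gradNorm (baseMetric n M) v ((extChartAt (𝓡 n) x).symm y) ^ n)) := by
    intro y hy
    have hyt := hKt hy
    have hd : 0 < √(G y).det := Real.sqrt_pos.mpr (hG.det_pos hyt)
    have hgr : gradNorm (baseMetric n M) v ((extChartAt (𝓡 n) x).symm y) =
        √(fderiv ℝ (v ∘ (extChartAt (𝓡 n) x).symm) y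
          (gradVec G (v ∘ (extChartAt (𝓡 n) x).symm) y)) := by
      rw [gradNorm_baseMetric, pairing_eq_chart ((extChartAt (𝓡 n) x).map_target hyt) (hvd _)
        (hvd _), (extChartAt (𝓡 n) x).right_inv hyt]
    have h1 := hG.norm_fderiv_sq_le hyt (v ∘ (extChartAt (𝓡 n) x).symm)
    rw [← hgr] at h1
    have h2 : √‖matForm (G y)‖ ^ n ≤ max C 1 * √(G y).det := by
      have := (le_abs_self _).trans ((hC y hy).trans (le_max_left C 1))
      rwa [div_le_iff₀ hd] at this
    rw [← ofReal_norm, ← ENNReal.ofReal_pow (norm_nonneg _), ← ENNReal.ofReal_mul hd.le,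
      ← ENNReal.ofReal_mul (by positivity)]
    refine ENNReal.ofReal_le_ofReal ?_
    calc _ ≤ (√‖matForm (G y)‖ *
          gradNorm (baseMetric n M) v ((extChartAt (𝓡 n) x).symm y)) ^ n :=
          pow_le_pow_left₀ (norm_nonneg _) h1 n
      _ = √‖matForm (G y)‖ ^ n *
          gradNorm (baseMetric n M) v ((extChartAt (𝓡 n) x).symm y) ^ n := mul_pow _ _ _
      _ ≤ max C 1 * √(G y).det *
          gradNorm (baseMetric n M) v ((extChartAt (𝓡 n) x).symm y) ^ n := by
          gcongr
          exact pow_nonneg (gradNorm_nonneg (baseMetric n M) v _) n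
      _ = _ := by ring
  calc _ ≤ ∫⁻ y in K, ENNReal.ofReal (max C 1) * (ENNReal.ofReal (√(G y).det) *
        ENNReal.ofReal (gradNorm (baseMetric n M) v ((extChartAt (𝓡 n) x).symm y) ^ n)) :=
        setLIntegral_mono' hK.measurableSet hpt
    _ ≤ ∫⁻ y in (extChartAt (𝓡 n) x).target, ENNReal.ofReal (max C 1) *
        (ENNReal.ofReal (√(G y).det) *
        ENNReal.ofReal (gradNorm (baseMetric n M) v ((extChartAt (𝓡 n) x).symm y) ^ n)) :=
        lintegral_mono_set hKt
    _ = ENNReal.ofReal (max C 1) * ∫⁻ p in (extChartAt (𝓡 n) x).source,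
        ENNReal.ofReal (gradNorm (baseMetric n M) v p ^ n) ∂(baseVolume n M) := by
        rw [lintegral_const_mul' _ _ ENNReal.ofReal_ne_top, setLIntegral_source_baseVolume x hgm]
    _ ≤ _ := mul_le_mul_right (setLIntegral_le_lintegral _ _) _

/-- There are cutoff functions of arbitrarily small energy that vanish on a given sublevel set of
`u` and are equal to one near `M \ Ω`. -/
def HasCutoffs (n : ℕ) {M : Type*} [TopologicalSpace M] [ChartedSpace (EuclideanSpace ℝ (Fin n)) M]
    [RiemannianBundle (fun x : M => TangentSpace (𝓡 n) x)] [MeasurableSpace M]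
    (Ω : Set M) (u : M → ℝ) : Prop :=
  ∀ (s : ℝ) (ε : ℝ≥0∞), 0 < ε →
    ∃ v : M → ℝ, ContMDiff (𝓡 n) 𝓘(ℝ, ℝ) ∞ v ∧ (∀ p ∈ Ω, u p ≤ s → v p = 0) ∧
      (∀ p, p ∉ Ω → v =ᶠ[𝓝 p] fun _ => 1) ∧
      ∫⁻ p, ENNReal.ofReal (gradNorm (baseMetric n M) v p ^ n) ∂(baseVolume n M) < ε

theorem dimH_chart_eq_zero (hn : 3 ≤ n) {Ω : Set M} (hΩ : IsOpen Ω) {u : M → ℝ}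
    (hu : ContinuousOn u Ω) (hcut : HasCutoffs n Ω u) {z : M} (hz : z ∈ closure Ω) {r₀ : ℝ}
    (hr₀ : 0 < r₀)
    (hr : Metric.closedBall (extChartAt (𝓡 n) z z) (3 * r₀) ⊆ (extChartAt (𝓡 n) z).target) :
    dimH {a | a ∈ Metric.ball (extChartAt (𝓡 n) z z) r₀ ∧ (extChartAt (𝓡 n) z).symm a ∉ Ω} = 0 := by
  set y₀ := extChartAt (𝓡 n) z z with hy₀
  set A := {a | a ∈ Metric.ball y₀ r₀ ∧ (extChartAt (𝓡 n) z).symm a ∉ Ω} with hA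
  set K := Metric.closedBall y₀ (3 * r₀) with hK
  obtain ⟨C, hC0, hC⟩ := exists_setLIntegral_fderiv_le (n := n) z (isCompact_closedBall _ _) hr
  -- A fixed ball inside Ω on which u is bounded, so that all the cutoffs for one level s₀ vanish on
  -- it.
  obtain ⟨y₁, η₁, hη₁, hball⟩ : ∃ (y₁ : EuclideanSpace ℝ (Fin n)) (η₁ : ℝ), 0 < η₁ ∧
      Metric.closedBall y₁ η₁ ⊆ Metric.ball y₀ r₀ ∩ chartDomain (n := n) z Ω := by
    have hW : IsOpen ((extChartAt (𝓡 n) z).source ∩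
        extChartAt (𝓡 n) z ⁻¹' Metric.ball y₀ r₀) :=
      (continuousOn_extChartAt z).isOpen_inter_preimage (isOpen_extChartAt_source z)
        Metric.isOpen_ball
    obtain ⟨q, ⟨hqs, hqb⟩, hqΩ⟩ := mem_closure_iff.mp hz _ hW
      ⟨mem_extChartAt_source z, Metric.mem_ball_self hr₀⟩
    have hmem : extChartAt (𝓡 n) z q ∈ Metric.ball y₀ r₀ ∩ chartDomain (n := n) z Ω := by
      refine ⟨hqb, (extChartAt (𝓡 n) z).map_source hqs, ?_⟩
      rwa [mem_preimage, (extChartAt (𝓡 n) z).left_inv hqs]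
    obtain ⟨η₁, hη₁, h⟩ := Metric.nhds_basis_closedBall.mem_iff.mp
      ((Metric.isOpen_ball.inter (isOpen_chartDomain z hΩ)).mem_nhds hmem)
    exact ⟨_, η₁, hη₁, h⟩
  set U := Metric.ball y₁ η₁ with hU
  have hUsub : U ⊆ Metric.ball y₀ r₀ ∩ chartDomain (n := n) z Ω :=
    Metric.ball_subset_closedBall.trans hball
  obtain ⟨s₀, hs₀⟩ : ∃ s₀, ∀ y ∈ U, u ((extChartAt (𝓡 n) z).symm y) ≤ s₀ := by
    have hc : ContinuousOn (fun y => u ((extChartAt (𝓡 n) z).symm y))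
        (Metric.closedBall y₁ η₁) := by
      refine hu.comp ((continuousOn_extChartAt_symm z).mono fun y hy => (hball hy).2.1) ?_
      exact fun y hy => (hball hy).2.2
    obtain ⟨s₀, hs₀⟩ := (isCompact_closedBall y₁ η₁).bddAbove_image hc
    exact ⟨s₀, fun y hy => hs₀ ⟨y, Metric.ball_subset_closedBall hy, rfl⟩⟩
  have hfin : Module.finrank ℝ (EuclideanSpace ℝ (Fin n)) = n := finrank_euclideanSpace_fin
  have hUpos : 0 < volume U := Metric.measure_ball_pos volume y₁ hη₁
  by_contra hne
  obtain ⟨s, hs0, hs⟩ := ENNReal.lt_iff_exists_nnreal_btwn.mp (pos_iff_ne_zero.mpr hne)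
  have hs0' : (0 : ℝ) < s := by exact_mod_cast hs0
  -- A ball of radius 2r₀ about a point of B(y₀, r₀) contains U and stays inside K, the ball of
  -- radius 3r₀. Thus δ depends neither on the point nor on the cutoff.
  obtain ⟨δ, hδ, hδE⟩ := exists_lt_setLIntegral_ball (E := EuclideanSpace ℝ (Fin n)) volume
    (by rw [hfin]; omega) hs0' (R := 2 * r₀) (by linarith) hUpos
  have hzero : Measure.hausdorffMeasure (s : ℝ) A = 0 := by
    refine hausdorffMeasure_eq_zero_of_forall_exists volume (R := 2 * r₀) hs0' hδ fun η hη => ?_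
    obtain ⟨v, hv, hv0, hv1, hve⟩ := hcut s₀ (ENNReal.ofReal (η / C))
      (ENNReal.ofReal_pos.mpr (div_pos hη hC0))
    set V := v ∘ (extChartAt (𝓡 n) z).symm with hV
    have hVs : ContDiffOn ℝ 1 V (extChartAt (𝓡 n) z).target := by
      have h1 := contDiffOn_comp_symm (k := 1) ENat.LEInfty.out
        (contMDiffOn_univ.mpr (hv.of_le ENat.LEInfty.out)) z
      exact h1.mono fun y hy => ⟨hy, mem_univ _⟩
    refine ⟨K.indicator fun y => ‖fderiv ℝ V y‖ₑ ^ n, ?_, fun a ha => ?_⟩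
    · rw [lintegral_indicator measurableSet_closedBall]
      refine (hC v hv).trans ((mul_le_mul_right hve.le _).trans (le_of_eq ?_))
      rw [← ENNReal.ofReal_mul hC0.le, mul_div_cancel₀ _ hC0.ne']
    · have hsub : Metric.ball a (2 * r₀) ⊆ K := by
        intro y hy
        rw [hK, Metric.mem_closedBall]
        have h1 := dist_triangle y a y₀
        have h2 := Metric.mem_ball.mp hy
        have h3 := Metric.mem_ball.mp ha.1
        linarith
      obtain ⟨r, hr1, hr2, hr3⟩ := hδE a V U (hVs.mono (hsub.trans hr))
        (hv1 _ ha.2).self_of_nhds measurableSet_ball (by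
          intro y hy
          rw [Metric.mem_ball]
          have h1 := dist_triangle_right y a y₀
          have h2 := Metric.mem_ball.mp (hUsub hy).1
          have h3 := Metric.mem_ball.mp ha.1
          linarith)
        (fun y hy => hv0 _ (hUsub hy).2.2 (hs₀ y hy)) le_rfl
      refine ⟨r, hr1, hr2, hr3.le.trans (le_of_eq ?_)⟩
      refine setLIntegral_congr_fun measurableSet_ball fun y hy => ?_
      rw [indicator_of_mem (hsub (Metric.ball_subset_ball hr2 hy)), hfin]
  have := dimH_le_of_hausdorffMeasure_ne_top (s := A) (d := s) (by rw [hzero]; simp)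
  exact absurd hs (not_lt.mpr this)

theorem exists_closedBall_subset_target (z : M) : ∃ r₀ : ℝ, 0 < r₀ ∧
    Metric.closedBall (extChartAt (𝓡 n) z z) (3 * r₀) ⊆ (extChartAt (𝓡 n) z).target := by
  obtain ⟨r, hr, h⟩ := Metric.nhds_basis_closedBall.mem_iff.mp
    ((isOpen_extChartAt_target (I := 𝓡 n) z).mem_nhds (mem_extChartAt_target (I := 𝓡 n) z))
  exact ⟨r / 3, by linarith, by rwa [mul_div_cancel₀ r (by norm_num : (3 : ℝ) ≠ 0)]⟩

/-- Near a point of the closure, the complement of Ω has dimension zero in a chart and so contains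
no open set; every nearby point is then a limit of points of Ω. As M is not assumed connected, the
closure need not be all of M. -/
theorem isOpen_closure_of_hasCutoffs (hn : 3 ≤ n) {Ω : Set M} (hΩ : IsOpen Ω) {u : M → ℝ}
    (hu : ContinuousOn u Ω) (hcut : HasCutoffs n Ω u) : IsOpen (closure Ω) := by
  rw [isOpen_iff_mem_nhds]
  intro z hz
  obtain ⟨r₀, hr₀, hr⟩ := exists_closedBall_subset_target (n := n) z
  have hdim := dimH_chart_eq_zero hn hΩ hu hcut hz hr₀ hr
  have hW : IsOpen ((extChartAt (𝓡 n) z).source ∩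
      extChartAt (𝓡 n) z ⁻¹' Metric.ball (extChartAt (𝓡 n) z z) r₀) :=
    (continuousOn_extChartAt z).isOpen_inter_preimage (isOpen_extChartAt_source z)
      Metric.isOpen_ball
  refine mem_of_superset (hW.mem_nhds ⟨mem_extChartAt_source z, Metric.mem_ball_self hr₀⟩) ?_
  intro q hq
  by_contra hqc
  have hdense := dense_compl_of_dimH_lt_finrank (E := EuclideanSpace ℝ (Fin n))
    (by rw [hdim, finrank_euclideanSpace_fin]; exact_mod_cast (by omega : 0 < n))
  obtain ⟨y, hy, hyA⟩ := hdense.inter_open_nonempty _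
    (isOpen_chartDomain (n := n) z (hW.inter isClosed_closure.isOpen_compl))
    ⟨extChartAt (𝓡 n) z q, (extChartAt (𝓡 n) z).map_source hq.1, by
      rw [mem_preimage, (extChartAt (𝓡 n) z).left_inv hq.1]; exact ⟨hq, hqc⟩⟩
  refine hyA ⟨?_, fun h => hy.2.2 (subset_closure h)⟩
  have := hy.2.1.2
  rwa [mem_preimage, (extChartAt (𝓡 n) z).right_inv hy.1] at this

end ChartDimension
end ConformalHuber
end

noncomputable section
namespace ConformalHuber

/-! ### Transfer of the dimension to the Riemannian distance. -/

section Lipschitz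

variable {n : ℕ} {M : Type*} [EMetricSpace M] [ChartedSpace (EuclideanSpace ℝ (Fin n)) M]
  [IsManifold (𝓡 n) ∞ M] [RiemannianBundle (fun x : M => TangentSpace (𝓡 n) x)]

theorem norm_mfderiv_symm_sq (x : M) (y c : EuclideanSpace ℝ (Fin n)) :
    ‖(mfderiv (𝓡 n) (𝓡 n) (extChartAt (𝓡 n) x).symm y c :
      TangentSpace (𝓡 n) ((extChartAt (𝓡 n) x).symm y))‖ ^ 2 =
      matForm (metricMatrix (baseMetric n M) x y) c c := by
  rw [matForm_metricMatrix, ← real_inner_self_eq_norm_sq]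
  rfl

variable [IsContMDiffRiemannianBundle (𝓡 n) ∞ (EuclideanSpace ℝ (Fin n))
      (fun x : M => TangentSpace (𝓡 n) x)] [IsRiemannianManifold (𝓡 n) M]

/-- The inverse of a chart is Lipschitz on the balls that lie well inside the target. -/
theorem exists_lipschitzOnWith_symm (x : M) {y₀ : EuclideanSpace ℝ (Fin n)} {r : ℝ}
    (hr : Metric.closedBall y₀ r ⊆ (extChartAt (𝓡 n) x).target) :
    ∃ C, LipschitzOnWith C (extChartAt (𝓡 n) x).symm (Metric.closedBall y₀ r) := by
  set G := metricMatrix (baseMetric n M) x with hGdef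
  have hG : IsMetricOn G (extChartAt (𝓡 n) x).target := isMetricOn_metricMatrix x
  have hT := isOpen_extChartAt_target (I := 𝓡 n) x
  obtain ⟨C, hC⟩ := (isCompact_closedBall y₀ r).exists_bound_of_continuousOn
    (hG.smooth_matForm.continuousOn.norm.sqrt.mono hr)
  refine ⟨(max C 0).toNNReal, fun a ha b hb => ?_⟩
  set η : ℝ → EuclideanSpace ℝ (Fin n) := fun t => a + t • (b - a) with hη
  have hηd : ∀ t, HasDerivAt η (b - a) t := fun t => by
    have h := ((hasDerivAt_id t).smul_const (b - a)).const_add a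
    rw [one_smul] at h
    exact h
  -- The distance of the images is at most the length of the image of the straight segment, which
  -- stays in the ball by convexity.
  have hηc : ContDiff ℝ 1 η := by fun_prop
  have hηb : ∀ t ∈ Icc (0 : ℝ) 1, η t ∈ Metric.closedBall y₀ r := by
    intro t ht
    exact (convex_closedBall y₀ r).add_smul_sub_mem ha hb ht
  set γ : ℝ → M := fun t => (extChartAt (𝓡 n) x).symm (η t) with hγ
  have hγs : ContMDiffOn 𝓘(ℝ, ℝ) (𝓡 n) 1 γ (Icc 0 1) :=
    ((contMDiffOn_extChartAt_symm (I := 𝓡 n) (n := ∞) x).of_le ENat.LEInfty.out).comp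
      hηc.contMDiff.contMDiffOn fun t ht => hr (hηb t ht)
  rw [IsRiemannianManifold.out (I := 𝓡 n) (M := M)]
  have hle := Manifold.riemannianEDist_le_pathELength (I := 𝓡 n) (γ := γ) (a := 0) (b := 1)
    (x := (extChartAt (𝓡 n) x).symm a) (y := (extChartAt (𝓡 n) x).symm b) hγs
    (by simp [hγ, hη]) (by simp [hγ, hη]) zero_le_one
  refine hle.trans ?_
  rw [Manifold.pathELength_eq_lintegral_mfderiv_Icc]
  have hb1 : ∀ t ∈ Icc (0 : ℝ) 1, ‖mfderiv 𝓘(ℝ, ℝ) (𝓡 n) γ t 1‖ₑ ≤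
      ((max C 0).toNNReal : ℝ≥0∞) * edist a b := by
    intro t ht
    have hyt := hr (hηb t ht)
    have h1 := (mdifferentiableAt_extChartAt_symm (n := n) hyt).hasMFDerivAt.comp t
      (hηd t).hasFDerivAt.hasMFDerivAt
    have h2 : mfderiv 𝓘(ℝ, ℝ) (𝓡 n) γ t 1 =
        mfderiv (𝓡 n) (𝓡 n) (extChartAt (𝓡 n) x).symm (η t) (b - a) := by
      have h3 := h1.mfderiv
      have h4 : (mfderiv 𝓘(ℝ, ℝ) (𝓡 n) γ t) = _ := h3
      rw [h4]
      exact congrArg (chartDeriv x (η t)) (one_smul ℝ (b - a))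
    rw [h2]
    have h5 := norm_mfderiv_symm_sq x (η t) (b - a)
    have h6 : ‖(mfderiv (𝓡 n) (𝓡 n) (extChartAt (𝓡 n) x).symm (η t) (b - a) :
      TangentSpace (𝓡 n) ((extChartAt (𝓡 n) x).symm (η t)))‖ ≤ max C 0 * ‖b - a‖ := by
      refine le_of_sq_le_sq ?_ (by positivity)
      rw [h5]
      refine (le_abs_self _).trans ?_
      have h7 := (matForm (G (η t))).le_opNorm₂ (b - a) (b - a)
      have h8 : ‖matForm (G (η t))‖ ≤ max C 0 ^ 2 := by
        rw [← Real.sqrt_le_left (le_max_right _ _)]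
        exact (le_abs_self _).trans ((hC _ (hηb t ht)).trans (le_max_left _ _))
      refine h7.trans ?_
      rw [mul_pow, mul_assoc, ← sq]
      gcongr
    rw [← ofReal_norm, edist_comm, edist_eq_enorm_sub, ← ofReal_norm, ENNReal.ofNNReal_toNNReal,
      ← ENNReal.ofReal_mul (le_max_right _ _)]
    exact ENNReal.ofReal_le_ofReal h6
  refine (setLIntegral_mono' measurableSet_Icc hb1).trans ?_
  simp

variable [CompactSpace M] [MeasurableSpace M] [BorelSpace M]

/-- Locally the frontier is a Lipschitz image of a set of dimension zero, and finitely many such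
pieces cover it by compactness. -/
theorem dimH_frontier_eq_zero (hn : 3 ≤ n) {Ω : Set M} (hΩ : IsOpen Ω) {u : M → ℝ}
    (hu : ContinuousOn u Ω) (hcut : HasCutoffs n Ω u) : dimH (frontier Ω) = 0 := by
  refine (isClosed_frontier (s := Ω)).isCompact.induction_on (p := fun s => dimH s = 0) ?_ ?_ ?_ ?_
  · exact dimH_empty
  · exact fun s t hst ht => le_antisymm ((dimH_mono hst).trans ht.le) zero_le
  · intro s t hs ht
    rw [dimH_union, hs, ht, max_self]
  · intro z hz
    obtain ⟨r₀, hr₀, hr⟩ := exists_closedBall_subset_target (n := n) z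
    have hdim := dimH_chart_eq_zero hn hΩ hu hcut hz.1 hr₀ hr
    obtain ⟨C, hC⟩ := exists_lipschitzOnWith_symm z hr
    have hW : IsOpen ((extChartAt (𝓡 n) z).source ∩
        extChartAt (𝓡 n) z ⁻¹' Metric.ball (extChartAt (𝓡 n) z z) r₀) :=
      (continuousOn_extChartAt z).isOpen_inter_preimage (isOpen_extChartAt_source z)
        Metric.isOpen_ball
    refine ⟨_, inter_mem_nhdsWithin _ (hW.mem_nhds ⟨mem_extChartAt_source z,
      Metric.mem_ball_self hr₀⟩), ?_⟩
    set A := {a | a ∈ Metric.ball (extChartAt (𝓡 n) z z) r₀ ∧ (extChartAt (𝓡 n) z).symm a ∉ Ω}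
    have hA : A ⊆ Metric.closedBall (extChartAt (𝓡 n) z z) (3 * r₀) := fun a ha =>
      Metric.closedBall_subset_closedBall (by linarith) (Metric.ball_subset_closedBall ha.1)
    refine le_antisymm ((dimH_mono ?_).trans (((hC.mono hA).dimH_image_le).trans hdim.le)) zero_le
    rintro q ⟨hqf, hqs, hqb⟩
    refine ⟨extChartAt (𝓡 n) z q, ⟨hqb, ?_⟩, (extChartAt (𝓡 n) z).left_inv hqs⟩
    rw [(extChartAt (𝓡 n) z).left_inv hqs]
    rw [hΩ.frontier_eq] at hqf
    exact hqf.2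

end Lipschitz
end ConformalHuber
end

noncomputable section
namespace ConformalHuber

/-! ### The capacity of the boundary and parabolicity. -/

section Capacity

variable {n : ℕ} {M : Type*} [TopologicalSpace M] [ChartedSpace (EuclideanSpace ℝ (Fin n)) M]
  [IsManifold (𝓡 n) ∞ M] [RiemannianBundle (fun x : M => TangentSpace (𝓡 n) x)]
  [CompactSpace M] [T2Space M] [MeasurableSpace M] [BorelSpace M]
  [IsContMDiffRiemannianBundle (𝓡 n) ∞ (EuclideanSpace ℝ (Fin n))
      (fun x : M => TangentSpace (𝓡 n) x)]

theorem capacity_eq_zero_of_forall {p : ℝ} {g : MetricField n M} {K D : Set M}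
    (h : ∀ ε : ℝ≥0∞, 0 < ε → ∃ v : M → ℝ, ContMDiff (𝓡 n) 𝓘(ℝ, ℝ) ∞ v ∧ tsupport v ⊆ D ∧
      (∀ x ∈ K, 1 ≤ v x) ∧ ∫⁻ x, ENNReal.ofReal (gradNorm g v x ^ p) ∂(riemVolume g D) ≤ ε) :
    capacity p g K D = 0 := by
  by_contra hne
  obtain ⟨ε, hε, hlt⟩ := exists_between (pos_iff_ne_zero.mpr hne)
  obtain ⟨v, hv, hvD, hvK, hle⟩ := h ε hε
  refine absurd hlt (not_lt.mpr (le_trans ?_ hle))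
  exact iInf₂_le v ⟨hv, (isClosed_tsupport v).isCompact, hvD, hvK⟩

/-- The cutoff v is one on all of M \ Ω, also far from the frontier. Since the closure of Ω is open
and closed, v may be replaced by zero off it without losing smoothness or adding energy. -/
theorem capacity_frontier_eq_zero (hn : 3 ≤ n) {Ω : Set M} (hΩ : IsOpen Ω) {u : M → ℝ}
    (hu : ContinuousOn u Ω) (hcut : HasCutoffs n Ω u) {D : Set M} (hD : IsOpen D)
    (hΩD : frontier Ω ⊆ D) : capacity n (baseMetric n M) (frontier Ω) D = 0 := by
  have hclo : IsOpen (closure Ω) := isOpen_closure_of_hasCutoffs hn hΩ hu hcut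
  have hKΩ : closure Ω \ D ⊆ Ω := by
    intro p hp
    by_contra h
    exact hp.2 (hΩD (by rw [hΩ.frontier_eq]; exact ⟨hp.1, h⟩))
  obtain ⟨s, hs⟩ := ((isClosed_closure.sdiff hD).isCompact).bddAbove_image (hu.mono hKΩ)
  refine capacity_eq_zero_of_forall fun ε hε => ?_
  -- Here s bounds u on the compact set closure Ω \ D. The margin 1 makes v vanish on an open
  -- neighbourhood of each point of this set, so even the closed support stays in D.
  obtain ⟨v, hv, hv0, hv1, hve⟩ := hcut (s + 1) ε hε
  set w : M → ℝ := (closure Ω).indicator v with hw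
  have hwin : ∀ p ∈ closure Ω, w =ᶠ[𝓝 p] v := by
    intro p hp
    filter_upwards [hclo.mem_nhds hp] with q hq
    exact indicator_of_mem hq _
  have hwout : ∀ p, p ∉ closure Ω → w =ᶠ[𝓝 p] fun _ => 0 := by
    intro p hp
    filter_upwards [isClosed_closure.isOpen_compl.mem_nhds hp] with q hq
    exact indicator_of_notMem hq _
  refine ⟨w, ?_, ?_, ?_, ?_⟩
  · intro p
    by_cases hp : p ∈ closure Ω
    · exact (hv p).congr_of_eventuallyEq (hwin p hp)
    · exact contMDiffAt_const.congr_of_eventuallyEq (hwout p hp)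
  · have hO : IsOpen (Ω ∩ u ⁻¹' Iio (s + 1)) := hu.isOpen_inter_preimage hΩ isOpen_Iio
    have hsub : tsupport w ⊆ closure Ω \ (Ω ∩ u ⁻¹' Iio (s + 1)) := by
      refine closure_minimal (fun p hp => ?_) (isClosed_closure.sdiff hO)
      have hpc : p ∈ closure Ω := by
        by_contra h
        exact hp (indicator_of_notMem h _)
      refine ⟨hpc, fun h => hp ?_⟩
      rw [hw, indicator_of_mem hpc]
      exact hv0 p h.1 (le_of_lt h.2)
    refine hsub.trans fun p hp => ?_
    by_contra hpD
    have hpΩ : p ∈ Ω := hKΩ ⟨hp.1, hpD⟩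
    have : u p ≤ s := hs ⟨p, ⟨hp.1, hpD⟩, rfl⟩
    exact hp.2 ⟨hpΩ, by rw [mem_preimage, mem_Iio]; linarith⟩
  · intro p hp
    have hp' := hp
    rw [hΩ.frontier_eq] at hp'
    rw [hw, indicator_of_mem hp'.1, (hv1 p hp'.2).self_of_nhds]
  · rw [riemVolume_baseMetric hD]
    refine (setLIntegral_le_lintegral _ _).trans (le_trans (lintegral_mono fun p => ?_) hve.le)
    refine ENNReal.ofReal_le_ofReal ?_
    rw [Real.rpow_natCast]
    by_cases hp : p ∈ closure Ω
    · rw [gradNorm_congr (hwin p hp)]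
    · rw [gradNorm_eq_zero_of_eventuallyEq_const (hwout p hp), zero_pow (by omega)]
      exact pow_nonneg (gradNorm_nonneg _ _ _) n

/-- Conformal invariance of the n-energy: the gradient scales by e^(−u) and the volume by e^(nu). -/
theorem lintegral_gradNorm_conformal {Ω : Set M} (hΩ : IsOpen Ω) {u v : M → ℝ}
    (hu : ContinuousOn u Ω) (hv : ContMDiff (𝓡 n) 𝓘(ℝ, ℝ) ∞ v) :
    ∫⁻ p, ENNReal.ofReal (gradNorm (conformal u (baseMetric n M)) v p ^ n)
      ∂(riemVolume (conformal u (baseMetric n M)) Ω) =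
    ∫⁻ p in Ω, ENNReal.ofReal (gradNorm (baseMetric n M) v p ^ n) ∂(baseVolume n M) := by
  have hgc : Continuous (gradNorm (baseMetric n M) v) :=
    continuousOn_univ.mp (continuousOn_gradNorm isOpen_univ hv.contMDiffOn)
  have hm1 : AEMeasurable (fun p => ENNReal.ofReal (Real.exp (n * u p)))
      ((baseVolume n M).restrict Ω) :=
    (ContinuousOn.aemeasurable (continuousOn_const.mul hu).rexp hΩ.measurableSet).ennreal_ofReal
  have hm2 : AEMeasurable (fun p => ENNReal.ofReal
      (gradNorm (conformal u (baseMetric n M)) v p ^ n)) ((baseVolume n M).restrict Ω) := by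
    simp only [gradNorm_conformal]
    exact (ContinuousOn.aemeasurable ((hu.neg.rexp.mul hgc.continuousOn).pow n)
      hΩ.measurableSet).ennreal_ofReal
  rw [riemVolume_conformal hΩ hu, lintegral_withDensity_eq_lintegral_mul₀ hm1 hm2]
  refine lintegral_congr fun p => ?_
  rw [Pi.mul_apply, ← ENNReal.ofReal_mul (Real.exp_pos _).le, gradNorm_conformal, mul_pow,
    ← Real.exp_nat_mul, ← mul_assoc, ← Real.exp_add]
  simp

/-- With s the maximum of u on K, the function 1 − v is one on K and vanishes near M \ Ω, so its
support is a compact subset of Ω. -/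
theorem isParabolic_conformal {Ω : Set M} (hΩ : IsOpen Ω) {u : M → ℝ}
    (hu : ContinuousOn u Ω) (hcut : HasCutoffs n Ω u) :
    IsParabolic n (conformal u (baseMetric n M)) Ω := by
  intro K hK hKΩ
  obtain ⟨s, hs⟩ := hK.bddAbove_image (hu.mono hKΩ)
  refine capacity_eq_zero_of_forall fun ε hε => ?_
  obtain ⟨v, hv, hv0, hv1, hve⟩ := hcut s ε hε
  have hw : ContMDiff (𝓡 n) 𝓘(ℝ, ℝ) ∞ fun p => 1 - v p := contMDiff_const.sub hv
  refine ⟨fun p => 1 - v p, hw, ?_, ?_, ?_⟩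
  · intro p hp
    by_contra hpΩ
    refine notMem_tsupport_iff_eventuallyEq.mpr ?_ hp
    filter_upwards [hv1 p hpΩ] with q hq
    simp [hq]
  · intro p hp
    beta_reduce
    rw [hv0 p (hKΩ hp) (hs ⟨p, hp, rfl⟩), sub_zero]
  · simp only [Real.rpow_natCast]
    rw [lintegral_gradNorm_conformal hΩ hu hw]
    refine (setLIntegral_le_lintegral _ _).trans (le_trans (lintegral_mono fun p => ?_) hve.le)
    have hd : HasDerivAt (fun t : ℝ => 1 - t) (-1) (v p) := by
      simpa using (hasDerivAt_id (v p)).const_sub 1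
    rw [gradNorm_comp ((hv p).mdifferentiableAt (by simp)) hd]
    simp

end Capacity
end ConformalHuber
end

theorem theorem3p1 {n : ℕ} (hn : 3 ≤ n)
    {M : Type*} [EMetricSpace M] [CompactSpace M] [MeasurableSpace M] [BorelSpace M]
    [ChartedSpace (EuclideanSpace ℝ (Fin n)) M] [IsManifold (𝓡 n) ∞ M]
    [RiemannianBundle (fun x : M => TangentSpace (𝓡 n) x)]
    [IsContMDiffRiemannianBundle (𝓡 n) ∞ (EuclideanSpace ℝ (Fin n))
      (fun x : M => TangentSpace (𝓡 n) x)]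
    [IsRiemannianManifold (𝓡 n) M]
    {Ω : Set M} (hΩ_open : IsOpen Ω) (hΩ_conn : IsConnected Ω)
    {u : M → ℝ} (hu : ContMDiffOn (𝓡 n) 𝓘(ℝ, ℝ) ∞ u Ω)
    (hu_lim : ∀ z ∈ frontier Ω, Tendsto u (𝓝[Ω] z) atTop)
    (hRic :
      MemLp (ConformalHuber.ricciNeg (ConformalHuber.conformal u (ConformalHuber.baseMetric n M)))
        ((n : ℝ≥0∞) / 2)
        (ConformalHuber.riemVolume
          (ConformalHuber.conformal u (ConformalHuber.baseMetric n M)) Ω) ∨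
      Integrable (fun x =>
          ConformalHuber.ricciNeg (ConformalHuber.conformal u (ConformalHuber.baseMetric n M)) x *
            ConformalHuber.gradNorm (ConformalHuber.baseMetric n M) u x ^ (n - 2) *
            Real.exp (2 * u x))
        (ConformalHuber.riemVolume (ConformalHuber.baseMetric n M) Ω)) :
    (∀ D : Set M, IsOpen D → frontier Ω ⊆ D →
      ConformalHuber.capacity n (ConformalHuber.baseMetric n M) (frontier Ω) D = 0) ∧
    ConformalHuber.IsParabolic n (ConformalHuber.conformal u (ConformalHuber.baseMetric n M)) Ω ∧
    dimH (frontier Ω) = 0 := by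
  have hcut : ConformalHuber.HasCutoffs n Ω u := fun s ε hε =>
    ConformalHuber.exists_cutoff hn hΩ_open hΩ_conn.nonempty hu hu_lim hRic s hε
  have huc : ContinuousOn u Ω := hu.continuousOn
  exact ⟨fun D hD hΩD => ConformalHuber.capacity_frontier_eq_zero hn hΩ_open huc hcut hD hΩD,
    ConformalHuber.isParabolic_conformal hΩ_open huc hcut,
    ConformalHuber.dimH_frontier_eq_zero hn hΩ_open huc hcut⟩
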